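/- Let $d \ge 0$ be an integer, let $I \subseteq \mathbb{R}$ be an open interval (possibly unbounded), let $X = \mathbb{T}^d = (\mathbb{R}/\mathbb{Z})^d$ or $X = \mathbb{R}^d$, and let $3 < r \le \infty$. Let $(v,p)$ be a weak solution of the incompressible Euler equations on $I \times X$, that is, $v : I \times X \to \mathbb{R}^d$ is locally square integrable, $p : I \times X \to \mathbb{R}$ is locally integrable, and $$\partial_t v^\ell + \sum_j \partial_j (v^j v^\ell) + \partial_\ell p = 0 \quad (1 \le \ell \le d), \qquad \sum_j \partial_j v^j = 0$$ in the sense of distributions on $I \times X$. For an open set $\Omega \subseteq X$, let $$\|f\|_{B^{1/3}_{q,\infty}(\Omega)} = \|f\|_{L^q(\Omega)} + \sup_{h \in \mathbb{R}^d \setminus \{0\}} |h|^{-1/3} \|f(\cdot - h) - f\|_{L^q(\Omega \cap (\Omega + h))},$$ and let $B^{1/3}_{q,c_0(\mathbb{N})}(\Omega)$ be the closure of $C^\infty(\Omega)$ in this norm. Suppose that $v \in L^r_t B^{1/3}_{r,\infty}(I \times X) \cap L^2_{t,x}(I \times X)$ and that $v$ does not conserve energy, meaning that the distribution $e(t) =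 \frac12 \int_X |v(t,x)|^2 \, dx$ on $I$ is not a constant (equivalently, $e$ is not equal almost everywhere on $I$ to a constant). Then $v$ is singular on a set of strictly positive $(d+1)$-dimensional Lebesgue measure, in both of the following senses: 1. The singular support of $v$ as a distribution, that is, the complement in $I \times X$ of the set of points with an open neighborhood on which $v$ agrees almost everywhere with a $C^\infty$ function of $(t,x)$, has strictly positive $(d+1)$-dimensional Lebesgue measure. 2. The singular support of $v$ relative to $L^3_t B^{1/3}_{3,c_0(\mathbb{N})}$, that is, the complement in $I \times X$ of the set of points with an open neighborhood $J \times \Omega \subseteq I \times X$ ($J$ and $\Omega$ open) on which $v$ is of class $L^3_t B^{1/3}_{3,c_0(\mathbb{N})}$ (for almost every $t \in J$ one has $v(t,\cdot) \in B^{1/3}_{3,c_0(\mathbb{N})}(\Omega)$, and $\int_J \|v(t,\cdot)\|_{B^{1/3}_{3,\infty}(\Omega)}^3 \, dt < \infty$), has strictly positive $(d+1)$-dimensional Lebesgue measure. -/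

import Mathlib

open MeasureTheory Set
open scoped ENNReal ContDiff

noncomputable section

namespace CriticalEuler

/-- The vector space `ℝ^d` with its Euclidean norm. -/
abbrev Vec (d : ℕ) : Type := EuclideanSpace ℝ (Fin d)

/-! Both spatial domains `X = ℝ^d` and `X = 𝕋^d = (ℝ/ℤ)^d` are abelian groups on which `ℝ^d` acts by
translation through a covering homomorphism `π : ℝ^d → X`, the identity in the first case and the
quotient map in the second. The notions below are written once, in terms of `π`. A function on
`ℝ × X` is smooth when its composition with the covering map `ℝ × ℝ^d → ℝ × X` is smooth. -/

/-- The covering homomorphism of `ℝ^d`: the identity. -/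
def spaceProj (d : ℕ) : Vec d →+ Vec d := AddMonoidHom.id (Vec d)

/-- The covering homomorphism `ℝ^d → 𝕋^d = (ℝ/ℤ)^d`, reduction of each coordinate modulo `1`. -/
def torusProj (d : ℕ) : Vec d →+ UnitAddTorus (Fin d) where
  toFun x i := (x i : UnitAddCircle)
  map_zero' := by ext i; simp
  map_add' x y := by ext i; simp

variable {d : ℕ} {X : Type} [AddCommGroup X] [TopologicalSpace X] [MeasureSpace X]

/-- The space-time domain `I × X`. -/
def spaceTime (X : Type) (I : Set ℝ) : Set (ℝ × X) := I ×ˢ univ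

/-- `φ ∈ C_c^∞(I × X)`. -/
structure IsTest (π : Vec d →+ X) (I : Set ℝ) (φ : ℝ × X → ℝ) : Prop where
  smooth : ContDiff ℝ ∞ (fun z : ℝ × Vec d => φ (z.1, π z.2))
  compact : HasCompactSupport φ
  support : tsupport φ ⊆ spaceTime X I

/-- The time derivative `∂_t φ`. -/
def timeDeriv (φ : ℝ × X → ℝ) (z : ℝ × X) : ℝ := deriv (fun s : ℝ => φ (s, z.2)) z.1

/-- The spatial partial derivative `∂_j φ`. -/
def spaceDeriv (π : Vec d →+ X) (j : Fin d) (φ : ℝ × X → ℝ) (z : ℝ × X) : ℝ :=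
  deriv (fun s : ℝ => φ (z.1, z.2 + π (EuclideanSpace.single j s))) 0

/-- `(v, p)` is a weak solution of the incompressible Euler equations on `I × X`: `v` is locally
square integrable, `p` is a locally integrable function, and
`∂_t v^l + ∂_j (v^j v^l) + ∂_l p = 0`, `∂_j v^j = 0` in the sense of distributions. -/
structure IsWeakEulerSolution (π : Vec d →+ X) (I : Set ℝ) (v : ℝ × X → Vec d) (p : ℝ × X → ℝ) :
    Prop where
  velocity_loc : ∀ K ⊆ spaceTime X I, IsCompact K → MemLp v 2 (volume.restrict K)
  pressure_loc : ∀ K ⊆ spaceTime X I, IsCompact K → IntegrableOn p K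
  momentum : ∀ l : Fin d, ∀ φ : ℝ × X → ℝ, IsTest π I φ →
    ∫ z in spaceTime X I, (v z l * timeDeriv φ z + ∑ j, v z j * v z l * spaceDeriv π j φ z
      + p z * spaceDeriv π l φ z) = 0
  divergence_free : ∀ φ : ℝ × X → ℝ, IsTest π I φ →
    ∫ z in spaceTime X I, ∑ j, v z j * spaceDeriv π j φ z = 0

/-- The kinetic energy `e(t) = ½ ∫ |v(t,x)|² dx`. -/
def kineticEnergy (v : ℝ × X → Vec d) (t : ℝ) : ℝ := (1 / 2) * ∫ x : X, ‖v (t, x)‖ ^ 2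

/-- The kinetic energy is constant on `I` as a distribution, i.e. almost everywhere. -/
def ConservesEnergy (I : Set ℝ) (v : ℝ × X → Vec d) : Prop :=
  ∃ c : ℝ, ∀ᵐ t ∂(volume.restrict I), kineticEnergy v t = c

/-- The norm of `B^s_{p,∞}(Ω)`,
`‖f‖_{L^p(Ω)} + sup_{h ≠ 0} |h|^{-s} ‖f(· - h) - f‖_{L^p(Ω ∩ (Ω + h))}`, with values in `[0,∞]`. -/
def besovNorm (π : Vec d →+ X) (s : ℝ) (p : ℝ≥0∞) (Ω : Set X) (f : X → Vec d) : ℝ≥0∞ :=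
  eLpNorm f p (volume.restrict Ω) +
    ⨆ (h : Vec d) (_ : h ≠ 0), ENNReal.ofReal (‖h‖ ^ (-s)) *
      eLpNorm (fun x => f (x - π h) - f x) p (volume.restrict {x | x ∈ Ω ∧ x - π h ∈ Ω})

/-- The norm of `L^q_t B^s_{p,∞}(J × Ω)`, with values in `[0,∞]`. -/
def timeBesovNorm (π : Vec d →+ X) (q : ℝ≥0∞) (s : ℝ) (p : ℝ≥0∞) (J : Set ℝ) (Ω : Set X)
    (v : ℝ × X → Vec d) : ℝ≥0∞ :=
  eLpNorm (fun t => besovNorm π s p Ω (fun x => v (t, x))) q (volume.restrict J)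

/-- `f ∈ B^s_{p,c₀(ℕ)}(Ω)`, the closure of `C^∞(Ω)` in the `B^s_{p,∞}(Ω)` norm. -/
def MemBesovC0 (π : Vec d →+ X) (s : ℝ) (p : ℝ≥0∞) (Ω : Set X) (f : X → Vec d) : Prop :=
  besovNorm π s p Ω f < ⊤ ∧
    ∀ ε : ℝ≥0∞, 0 < ε → ∃ w : X → Vec d, ContDiffOn ℝ ∞ (fun y => w (π y)) (π ⁻¹' Ω) ∧
      besovNorm π s p Ω (fun x => f x - w x) < ε

/-- `v` is of class `L^q_t B^s_{p,c₀(ℕ)}` on `J × Ω`. -/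
def MemTimeBesovC0 (π : Vec d →+ X) (q : ℝ≥0∞) (s : ℝ) (p : ℝ≥0∞) (J : Set ℝ) (Ω : Set X)
    (v : ℝ × X → Vec d) : Prop :=
  (∀ᵐ t ∂(volume.restrict J), MemBesovC0 π s p Ω (fun x => v (t, x))) ∧
    timeBesovNorm π q s p J Ω v < ⊤

/-- The singular support of `v` in `I × X`: the points with no open neighborhood on which `v` agrees
almost everywhere with a smooth function of `(t,x)`. -/
def singularSupport (π : Vec d →+ X) (I : Set ℝ) (v : ℝ × X → Vec d) : Set (ℝ × X) :=
  {q | q ∈ spaceTime X I ∧ ¬ ∃ O : Set (ℝ × X), IsOpen O ∧ q ∈ O ∧ O ⊆ spaceTime X I ∧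
    ∃ w : ℝ × X → Vec d,
      ContDiffOn ℝ ∞ (fun z : ℝ × Vec d => w (z.1, π z.2)) {z | (z.1, π z.2) ∈ O} ∧
      ∀ᵐ z ∂(volume.restrict O), v z = w z}

/-- The singular support of `v` in `I × X` relative to `L^3_t B^{1/3}_{3,c₀(ℕ)}`: the points with no
open neighborhood `J × Ω` on which `v` is of this class. -/
def criticalSingularSupport (π : Vec d →+ X) (I : Set ℝ) (v : ℝ × X → Vec d) : Set (ℝ × X) :=
  {q | q ∈ spaceTime X I ∧ ¬ ∃ (J : Set ℝ) (Ω : Set X), IsOpen J ∧ IsOpen Ω ∧ J ⊆ I ∧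
    q.1 ∈ J ∧ q.2 ∈ Ω ∧ MemTimeBesovC0 π 3 (1 / 3) 3 J Ω v}

end CriticalEuler

end

noncomputable section

open Filter Topology
open scoped Pointwise

set_option linter.unusedSectionVars false

namespace CriticalEuler

/-! ### Differential calculus through a covering homomorphism -/

/-! The contrapositive is proved: if either singular set is null, then the energy is constant. By
the argument of Constantin, E and Titi, the obstruction to the energy balance is the flux through
scale `ε`, which is bounded by `ε⁻¹` times the cube of the `L³` norm of the increments of `u`,
measured on the support of the test function `ζ`. It therefore suffices that `|h|⁻¹ ∫_K |u(t, x - h)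
- u(t, x)|³` tends to `0` with `h` for every compact `K ⊆ I × X`. The Besov bound alone only keeps
this quantity bounded; the gain comes from `r > 3` together with the null singular set.

Small increments (`smallIncrements_of_null`). Cover the null set by an open set `U` of small
measure. Hölder's inequality bounds the contribution of `U` by `H³ |U|^{1 - 3/r}`, uniformly in `h`,
and the exponent is positive because `r > 3`. The set `K \ U` is compact and consists of regular
points, and near each of them the quantity tends to zero: by the Lipschitz bound near a smooth
point, and by smooth approximation in the Besov norm and dominated convergence in time near a point
of class `L³_t B^{1/3}_{3,c₀}`.

Energy balance (`EulerCore.eulerForm_mollify`, `EulerCore.enorm_energy_le_of_tendsto`). The velocity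
is mollified in space and time to `w`, and the equation is tested with the mollification of `ζ w`.
The commutator in the resulting identity is quadratic in increments (`EulerCore.reynolds_eq`), and
the flux is cubic with one derivative on the kernel. The time scale is chosen after the space scale,
so that continuity of translations in `L³` suffices in time. What survives the limit involves the
spatial gradient of `ζ` and the pressure.

On the torus `ζ` depends on time only, so the gradient terms vanish and the test field is
divergence-free. On `ℝ^d` a cutoff at scale `n + 1` is needed, and the pressure, which is only
locally integrable, has to be eliminated. The weak form tested with the translates by `y` of the
test field is a function `m(y)` that decays at infinity and solves `Δm = ∂_j ∂_l n_{jl}`, where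
`n_{jl}` correlates `u_j u_l` with the divergence of the field (`EulerCore.laplacian_eulerForm`).
The bound `elliptic_estimate` for `m(0)` tends to zero with the gradient of the cutoff. In both
cases `∫ η'(t) e(t) dt = 0` for all test functions `η` on `I`, and the lemma of du Bois-Reymond
concludes. -/

/-- The properties of a covering homomorphism that are used below. -/
structure IsCover {E Y : Type} [AddCommGroup E] [TopologicalSpace E] [AddCommGroup Y]
    [TopologicalSpace Y] (P : E →+ Y) : Prop where
  continuous : Continuous P
  surjective : Function.Surjective P
  isOpenMap : IsOpenMap P

section Lift

variable {E Y : Type} [NormedAddCommGroup E] [NormedSpace ℝ E] [AddCommGroup Y]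

/-- `φ` is smooth after composition with the covering homomorphism. -/
def SmoothLift (P : E →+ Y) (φ : Y → ℝ) : Prop := ContDiff ℝ ∞ (fun e => φ (P e))

/-- The derivative of `φ` in the direction `a`. -/
def dirDeriv (P : E →+ Y) (a : E) (φ : Y → ℝ) (z : Y) : ℝ :=
  deriv (fun s : ℝ => φ (z + P (s • a))) 0

variable {P : E →+ Y} {φ ψ : Y → ℝ} {a : E}

lemma SmoothLift.differentiable (hφ : SmoothLift P φ) :
    Differentiable ℝ (fun e => φ (P e)) :=
  ContDiff.differentiable hφ (by simp)

lemma SmoothLift.hasDerivAt (hφ : SmoothLift P φ) (a e : E) (t : ℝ) :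
    HasDerivAt (fun s : ℝ => φ (P e + P (s • a)))
      (fderiv ℝ (fun e => φ (P e)) (e + t • a) a) t := by
  have h1 : HasDerivAt (fun s : ℝ => e + s • a) a t := by
    simpa using ((hasDerivAt_id t).smul_const a).const_add e
  have := (hφ.differentiable (e + t • a)).hasFDerivAt.comp_hasDerivAt t h1
  simpa [Function.comp_def, map_add] using this

lemma SmoothLift.dirDeriv_apply (hφ : SmoothLift P φ) (a e : E) :
    dirDeriv P a φ (P e) = fderiv ℝ (fun e => φ (P e)) e a := by
  simpa [dirDeriv] using (hφ.hasDerivAt a e 0).deriv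

lemma SmoothLift.hasDerivAt_line (hP : Function.Surjective P) (hφ : SmoothLift P φ) (a : E)
    (z : Y) (t : ℝ) :
    HasDerivAt (fun s : ℝ => φ (z + P (s • a))) (dirDeriv P a φ (z + P (t • a))) t := by
  obtain ⟨e, rfl⟩ := hP z
  rw [← map_add, hφ.dirDeriv_apply]
  exact hφ.hasDerivAt a e t

lemma SmoothLift.dirDeriv (hφ : SmoothLift P φ) (a : E) : SmoothLift P (dirDeriv P a φ) := by
  unfold SmoothLift
  simp_rw [hφ.dirDeriv_apply]
  exact (ContDiff.fderiv_right (m := ∞) hφ (by simp)).clm_apply contDiff_const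

lemma SmoothLift.mul (hφ : SmoothLift P φ) (hψ : SmoothLift P ψ) :
    SmoothLift P (fun z => φ z * ψ z) := ContDiff.mul hφ hψ

lemma SmoothLift.sub (hφ : SmoothLift P φ) (hψ : SmoothLift P ψ) :
    SmoothLift P (fun z => φ z - ψ z) := ContDiff.sub hφ hψ

lemma SmoothLift.const (c : ℝ) : SmoothLift P (fun _ => c) := contDiff_const

lemma SmoothLift.const_mul (c : ℝ) (hφ : SmoothLift P φ) : SmoothLift P (fun z => c * φ z) :=
  (SmoothLift.const c).mul hφ

lemma SmoothLift.sum {ι : Type} {s : Finset ι} {f : ι → Y → ℝ} (hf : ∀ i, SmoothLift P (f i)) :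
    SmoothLift P (fun z => ∑ i ∈ s, f i z) := ContDiff.sum fun i _ => hf i

lemma dirDeriv_mul (hP : Function.Surjective P) (hφ : SmoothLift P φ) (hψ : SmoothLift P ψ)
    (a : E) (z : Y) : dirDeriv P a (fun z => φ z * ψ z) z =
      dirDeriv P a φ z * ψ z + φ z * dirDeriv P a ψ z := by
  simpa [dirDeriv] using ((hφ.hasDerivAt_line hP a z 0).fun_mul (hψ.hasDerivAt_line hP a z 0)).deriv

lemma dirDeriv_sub (hP : Function.Surjective P) (hφ : SmoothLift P φ) (hψ : SmoothLift P ψ)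
    (a : E) (z : Y) : dirDeriv P a (fun z => φ z - ψ z) z =
      dirDeriv P a φ z - dirDeriv P a ψ z := by
  simpa [dirDeriv] using ((hφ.hasDerivAt_line hP a z 0).fun_sub (hψ.hasDerivAt_line hP a z 0)).deriv

lemma dirDeriv_sum (hP : Function.Surjective P) {ι : Type} {s : Finset ι} {f : ι → Y → ℝ}
    (hf : ∀ i, SmoothLift P (f i)) (a : E) (z : Y) :
    dirDeriv P a (fun z => ∑ i ∈ s, f i z) z = ∑ i ∈ s, dirDeriv P a (f i) z := by
  simpa [dirDeriv] using (HasDerivAt.fun_sum (u := s) fun i _ => (hf i).hasDerivAt_line hP a z 0).deriv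

lemma dirDeriv_translate (e₀ : E) (a : E) (z : Y) :
    dirDeriv P a (fun z => φ (z - P e₀)) z = dirDeriv P a φ (z - P e₀) := by
  simp only [dirDeriv]
  congr 1; ext s; congr 1; abel

lemma dirDeriv_comm (hφ : SmoothLift P φ) (hP : Function.Surjective P) (a b : E) (z : Y) :
    dirDeriv P a (dirDeriv P b φ) z = dirDeriv P b (dirDeriv P a φ) z := by
  obtain ⟨e, rfl⟩ := hP z
  rw [(hφ.dirDeriv b).dirDeriv_apply, (hφ.dirDeriv a).dirDeriv_apply]
  simp_rw [hφ.dirDeriv_apply]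
  have h2 : ContDiff ℝ ∞ (fderiv ℝ (fun e => φ (P e))) :=
    ContDiff.fderiv_right (m := ∞) hφ (by simp)
  have hd : DifferentiableAt ℝ (fderiv ℝ (fun e => φ (P e))) e :=
    h2.differentiable (by simp) e
  rw [fderiv_clm_apply hd (differentiableAt_const _), fderiv_clm_apply hd (differentiableAt_const _)]
  simp only [fderiv_fun_const, Pi.zero_apply, ContinuousLinearMap.comp_zero, zero_add,
    ContinuousLinearMap.flip_apply]
  have hs := (ContDiff.contDiffAt (x := e) hφ).isSymmSndFDerivAt
    (by simpa using WithTop.coe_le_coe.2 (le_top : (2 : ℕ∞) ≤ ⊤))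
  exact hs a b

end Lift

section LiftTop

variable {E Y : Type} [NormedAddCommGroup E] [NormedSpace ℝ E] [AddCommGroup Y]
  [TopologicalSpace Y] [IsTopologicalAddGroup Y] {P : E →+ Y} {φ ψ : Y → ℝ}

/-- An open continuous surjection is a quotient map. -/
lemma IsCover.continuous_of_comp (hP : IsCover P) {Z : Type} [TopologicalSpace Z] {f : Y → Z}
    (hf : Continuous (fun e => f (P e))) : Continuous f :=
  (hP.isOpenMap.isQuotientMap hP.continuous hP.surjective).continuous_iff.2 hf

lemma SmoothLift.continuous (hP : IsCover P) (hφ : SmoothLift P φ) : Continuous φ :=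
  hP.continuous_of_comp (ContDiff.continuous hφ)

lemma dirDeriv_eq_zero_of_notMem (hP : IsCover P) (a : E) {z : Y} (hz : z ∉ tsupport φ) :
    dirDeriv P a φ z = 0 := by
  have hc : Continuous (fun s : ℝ => z + P (s • a)) :=
    continuous_const.add (hP.continuous.comp (continuous_id.smul continuous_const))
  have h1 : ∀ᶠ s : ℝ in 𝓝 0, φ (z + P (s • a)) = 0 := by
    have : ∀ᶠ y in 𝓝 z, φ y = 0 := by
      filter_upwards [(isClosed_tsupport φ).isOpen_compl.mem_nhds hz] with y hy
      exact image_eq_zero_of_notMem_tsupport hy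
    have ht : Tendsto (fun s : ℝ => z + P (s • a)) (𝓝 0) (𝓝 z) := by
      simpa using hc.tendsto 0
    exact ht.eventually this
  have : (fun s : ℝ => φ (z + P (s • a))) =ᶠ[𝓝 0] fun _ => (0 : ℝ) := h1
  simp [dirDeriv, this.deriv_eq]

lemma tsupport_dirDeriv_subset (hP : IsCover P) (a : E) :
    tsupport (dirDeriv P a φ) ⊆ tsupport φ := by
  refine closure_minimal (fun z hz => ?_) (isClosed_tsupport φ)
  by_contra h
  exact hz (dirDeriv_eq_zero_of_notMem hP a h)

lemma hasCompactSupport_dirDeriv (hP : IsCover P) (hφ : HasCompactSupport φ) (a : E) :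
    HasCompactSupport (dirDeriv P a φ) :=
  hφ.of_isClosed_subset (isClosed_tsupport _) (tsupport_dirDeriv_subset hP a)

variable [LocallyCompactSpace Y] [T2Space Y] [SecondCountableTopology Y]
  [MeasureSpace Y] [BorelSpace Y] [(volume : Measure Y).IsAddHaarMeasure]

/-- By invariance of the measure, `s ↦ ∫ φ (z + P (s • a))` is constant, and differentiation under
the integral sign at `s = 0` gives the claim. -/
lemma integral_dirDeriv_eq_zero (hP : IsCover P) (hφ : SmoothLift P φ)
    (hc : HasCompactSupport φ) (a : E) : ∫ z, dirDeriv P a φ z = 0 := by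
  have hcont := hφ.continuous hP
  have hD := (hφ.dirDeriv a).continuous hP
  have hDc := hasCompactSupport_dirDeriv hP hc a
  obtain ⟨C, hC⟩ := hDc.exists_bound_of_continuous hD
  -- `K` contains the supports of all translates with `|s| ≤ 1`, so a multiple of its indicator
  -- dominates the difference quotients.
  set K : Set Y := tsupport φ - (fun s : ℝ => P (s • a)) '' Icc (-1) 1 with hK
  have hKc : IsCompact K := by
    rw [hK, sub_eq_add_neg]
    exact IsCompact.add hc (isCompact_Icc.image
    (hP.continuous.comp (continuous_id.smul continuous_const))).neg
  have key := hasDerivAt_integral_of_dominated_loc_of_deriv_le (μ := (volume : Measure Y))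
    (F := fun (s : ℝ) (z : Y) => φ (z + P (s • a)))
    (F' := fun (s : ℝ) (z : Y) => dirDeriv P a φ (z + P (s • a))) (x₀ := 0)
    (s := Ioo (-1) 1) (bound := K.indicator fun _ => C) (Ioo_mem_nhds (by norm_num) (by norm_num))
    (Eventually.of_forall fun s => (hcont.comp (continuous_add_const _)).aestronglyMeasurable)
    (by simpa using hcont.integrable_of_hasCompactSupport hc)
    ((hD.comp (continuous_add_const _)).aestronglyMeasurable)
    (Eventually.of_forall fun z s hs => by
      by_cases hz : z ∈ K
      · simpa [hz] using hC (z + P (s • a))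
      · have : z + P (s • a) ∉ tsupport φ := fun h => hz
          ⟨_, h, P (s • a), ⟨s, Ioo_subset_Icc_self hs, rfl⟩, by simp⟩
        simp [hz, dirDeriv_eq_zero_of_notMem hP a this])
    ((integrable_indicator_iff hKc.measurableSet).2
      (integrableOn_const hKc.measure_lt_top.ne))
    (Eventually.of_forall fun z s hs => hφ.hasDerivAt_line hP.surjective a z s)
  have h2 : (fun s : ℝ => ∫ z, φ (z + P (s • a))) = fun _ => ∫ z, φ z := by
    ext s; exact integral_add_right_eq_self φ _
  have h3 := key.2
  simp only [h2, zero_smul, map_zero, add_zero] at h3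
  exact h3.unique (hasDerivAt_const _ _)

lemma integral_mul_dirDeriv (hP : IsCover P) (hφ : SmoothLift P φ) (hψ : SmoothLift P ψ)
    (hc : HasCompactSupport φ) (a : E) :
    ∫ z, φ z * dirDeriv P a ψ z = - ∫ z, dirDeriv P a φ z * ψ z := by
  have h := integral_dirDeriv_eq_zero hP (hφ.mul hψ) (hc.mul_right) a
  simp_rw [dirDeriv_mul hP.surjective hφ hψ] at h
  rw [integral_add] at h
  · linarith
  · exact (((hφ.dirDeriv a).mul hψ).continuous hP).integrable_of_hasCompactSupport
      ((hasCompactSupport_dirDeriv hP hc a).mul_right)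
  · exact ((hφ.mul (hψ.dirDeriv a)).continuous hP).integrable_of_hasCompactSupport hc.mul_right

end LiftTop

/-! ### Averages in Lebesgue spaces -/

section Minkowski

variable {E Y : Type} [MeasurableSpace E] [MeasurableSpace Y]

/-- Minkowski's integral inequality for a finite measure. -/
lemma eLpNorm_lintegral_le {κ : Measure E} [IsFiniteMeasure κ] {μ : Measure Y} [SFinite μ]
    {G : E → Y → ℝ≥0∞} (hG : Measurable (Function.uncurry G)) {p : ℝ≥0∞} (hp : 1 ≤ p) {B : ℝ≥0∞}
    (hB : ∀ᵐ e ∂κ, eLpNorm (G e) p μ ≤ B) :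
    eLpNorm (fun z => ∫⁻ e, G e z ∂κ) p μ ≤ κ univ * B := by
  have hp0 : p ≠ 0 := (one_pos.trans_le hp).ne'
  have hG' : Measurable (Function.uncurry fun z e => G e z) := hG.comp measurable_swap
  rcases eq_or_ne p ∞ with rfl | hpt
  · simp only [eLpNorm_exponent_top] at hB ⊢
    have h1 : ∀ᵐ e ∂κ, ∀ᵐ z ∂μ, G e z ≤ B := by
      filter_upwards [hB] with e he
      filter_upwards [enorm_ae_le_eLpNormEssSup (G e) μ] with z hz
      exact hz.trans he
    have hms : MeasurableSet {q : E × Y | G q.1 q.2 ≤ B} := measurableSet_le hG measurable_const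
    have h2 : ∀ᵐ z ∂μ, ∀ᵐ e ∂κ, G e z ≤ B :=
      (Measure.ae_ae_comm (p := fun e z => G e z ≤ B) hms).1 h1
    refine eLpNormEssSup_le_of_ae_enorm_bound ?_
    filter_upwards [h2] with z hz
    calc ‖∫⁻ e, G e z ∂κ‖ₑ = ∫⁻ e, G e z ∂κ := rfl
      _ ≤ ∫⁻ _, B ∂κ := lintegral_mono_ae hz
      _ = κ univ * B := by rw [lintegral_const, mul_comm]
  · have hq : 0 < p.toReal := ENNReal.toReal_pos hp0 hpt
    have hq1 : 1 ≤ p.toReal := by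
      rw [← ENNReal.toReal_one]; exact (ENNReal.toReal_le_toReal (by simp) hpt).2 hp
    -- Hölder's inequality in `κ` against the constant `1`. After Tonelli, integrating the bound `B
    -- ^ p` supplies the one missing factor `κ univ`.
    have key : ∀ z, (∫⁻ e, G e z ∂κ) ^ p.toReal ≤
        (κ univ) ^ (p.toReal - 1) * ∫⁻ e, (G e z) ^ p.toReal ∂κ := by
      intro z
      have h := eLpNorm_le_eLpNorm_mul_rpow_measure_univ (μ := κ) (f := fun e => G e z) hp
        (hG'.of_uncurry_left.aestronglyMeasurable)
      rw [eLpNorm_one_eq_lintegral_enorm, eLpNorm_eq_lintegral_rpow_enorm_toReal hp0 hpt] at h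
      simp only [enorm_eq_self, ENNReal.toReal_one] at h
      calc _ ≤ (((∫⁻ e, (G e z) ^ p.toReal ∂κ) ^ (1 / p.toReal)) *
              κ univ ^ (1 / 1 - 1 / p.toReal)) ^ p.toReal := by gcongr
        _ = _ := by
          rw [ENNReal.mul_rpow_of_nonneg _ _ hq.le, ← ENNReal.rpow_mul, ← ENNReal.rpow_mul,
            one_div_mul_cancel hq.ne', ENNReal.rpow_one, mul_comm]
          congr 2; field_simp
    rw [eLpNorm_eq_lintegral_rpow_enorm_toReal hp0 hpt]
    simp only [enorm_eq_self]
    have h2 : ∫⁻ z, (∫⁻ e, G e z ∂κ) ^ p.toReal ∂μ ≤ (κ univ * B) ^ p.toReal := by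
      calc _ ≤ ∫⁻ z, (κ univ) ^ (p.toReal - 1) * ∫⁻ e, (G e z) ^ p.toReal ∂κ ∂μ :=
            lintegral_mono key
        _ = (κ univ) ^ (p.toReal - 1) * ∫⁻ z, ∫⁻ e, (G e z) ^ p.toReal ∂κ ∂μ := by
            rw [lintegral_const_mul]
            exact (hG'.pow_const _).lintegral_prod_right'
        _ = (κ univ) ^ (p.toReal - 1) * ∫⁻ e, ∫⁻ z, (G e z) ^ p.toReal ∂μ ∂κ := by
            rw [lintegral_lintegral_swap (hG'.pow_const _).aemeasurable]
        _ ≤ (κ univ) ^ (p.toReal - 1) * ∫⁻ _, B ^ p.toReal ∂κ := by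
            refine mul_le_mul_right (lintegral_mono_ae ?_) _
            filter_upwards [hB] with e he
            rw [eLpNorm_eq_lintegral_rpow_enorm_toReal hp0 hpt] at he
            simp only [enorm_eq_self] at he
            calc _ = ((∫⁻ z, (G e z) ^ p.toReal ∂μ) ^ (1 / p.toReal)) ^ p.toReal := by
                  rw [← ENNReal.rpow_mul, one_div_mul_cancel hq.ne', ENNReal.rpow_one]
              _ ≤ _ := by gcongr
        _ = _ := by
            rw [lintegral_const, ENNReal.mul_rpow_of_nonneg _ _ hq.le, mul_comm (B ^ p.toReal),
              ← mul_assoc]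
            congr 1
            nth_rewrite 2 [← ENNReal.rpow_one (κ univ)]
            rw [← ENNReal.rpow_add_of_nonneg _ _ (by linarith) zero_le_one, sub_add_cancel]
    calc _ ≤ ((κ univ * B) ^ p.toReal) ^ (1 / p.toReal) := by gcongr
      _ = _ := by rw [← ENNReal.rpow_mul, mul_one_div_cancel hq.ne', ENNReal.rpow_one]

/-- Minkowski's inequality for the measure `|k| dν`, which is finite because `k` is integrable. The
bound on `G e` is needed only where `k e ≠ 0`; in the applications this confines `e` to the support
of a mollifier. -/
lemma eLpNorm_integral_kernel_le {ν : Measure E} [SFinite ν] {μ : Measure Y} [SFinite μ]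
    {k : E → ℝ} (hk : Integrable k ν) (hkm : Measurable k) {G : E → Y → ℝ}
    (hG : Measurable (Function.uncurry G)) {p : ℝ≥0∞} (hp : 1 ≤ p) {B : ℝ≥0∞}
    (hB : ∀ e, k e ≠ 0 → eLpNorm (G e) p μ ≤ B) :
    eLpNorm (fun z => ∫ e, k e * G e z ∂ν) p μ ≤ (∫⁻ e, ‖k e‖ₑ ∂ν) * B := by
  set κ := ν.withDensity (fun e => ‖k e‖ₑ) with hκ
  have hf : IsFiniteMeasure κ := isFiniteMeasure_withDensity hk.2.ne
  have h1 : eLpNorm (fun z => ∫ e, k e * G e z ∂ν) p μ ≤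
      eLpNorm (fun z => ∫⁻ e, ‖G e z‖ₑ ∂κ) p μ := by
    refine eLpNorm_mono_enorm fun z => ?_
    refine (enorm_integral_le_lintegral_enorm _).trans ?_
    rw [enorm_eq_self, hκ, lintegral_withDensity_eq_lintegral_mul _ hkm.enorm
      (hG.of_uncurry_right.enorm)]
    simp [enorm_mul]
  refine h1.trans ((eLpNorm_lintegral_le hG.enorm hp (B := B) ?_).trans_eq ?_)
  · rw [hκ, ae_withDensity_iff hkm.enorm]
    refine Eventually.of_forall fun e he => ?_
    rw [eLpNorm_enorm]
    exact hB e (by simpa using he)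
  · rw [hκ, withDensity_apply _ MeasurableSet.univ, Measure.restrict_univ]

end Minkowski

/-! ### Mollification -/

section Mollify

variable {E Y : Type} [NormedAddCommGroup E] [NormedSpace ℝ E] [FiniteDimensional ℝ E]
  [MeasureSpace E] [BorelSpace E] [(volume : Measure E).IsAddHaarMeasure]
  [AddCommGroup Y] [TopologicalSpace Y] [IsTopologicalAddGroup Y]
  [LocallyCompactSpace Y] [T2Space Y] [SecondCountableTopology Y]
  [MeasureSpace Y] [BorelSpace Y] [(volume : Measure Y).IsAddHaarMeasure]

/-- The average `∫ k(e) f(z - P e) de`. -/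
def mollify (P : E →+ Y) (k : E → ℝ) (f : Y → ℝ) (z : Y) : ℝ := ∫ e, k e * f (z - P e)

variable {P : E →+ Y} {f φ : Y → ℝ} {k : E → ℝ}

lemma IsCover.measurable_shear (hP : IsCover P) {Z : Type} [MeasurableSpace Z] {f : Y → Z}
    (hm : Measurable f) : Measurable (fun q : Y × E => f (q.1 - P q.2)) :=
  hm.comp (measurable_fst.sub (hP.continuous.measurable.comp measurable_snd))

lemma IsCover.measurable_shear' (hP : IsCover P) {Z : Type} [MeasurableSpace Z] {f : Y → Z}
    (hm : Measurable f) : Measurable (fun q : E × Y => f (q.2 - P q.1)) :=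
  hm.comp (measurable_snd.sub (hP.continuous.measurable.comp measurable_fst))

lemma integrable_shear (hP : IsCover P) (hm : Measurable f) (hf : Integrable f)
    (hk : Integrable k) :
    Integrable (fun q : Y × E => k q.2 * f (q.1 - P q.2))
      ((volume : Measure Y).prod (volume : Measure E)) := by
  rw [integrable_prod_iff']
  · refine ⟨Eventually.of_forall fun e => (hf.comp_sub_right (P e)).const_mul (k e), ?_⟩
    simp_rw [norm_mul, integral_const_mul]
    have : ∀ e : E, ∫ z, ‖f (z - P e)‖ = ∫ z, ‖f z‖ := fun e =>
      integral_sub_right_eq_self (fun z => ‖f z‖) _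
    simp_rw [this]
    exact hk.norm.mul_const _
  · exact (hk.1.comp_snd).mul (hP.measurable_shear hm).aestronglyMeasurable

lemma integrable_mul_shear (hP : IsCover P) (hm : Measurable f) (hf : LocallyIntegrable f)
    (hk : Continuous k) (hkc : HasCompactSupport k) (hφ : Continuous φ)
    (hφc : HasCompactSupport φ) :
    Integrable (fun q : Y × E => k q.2 * f (q.1 - P q.2) * φ q.1)
      ((volume : Measure Y).prod (volume : Measure E)) := by
  -- Only the values of `f` on this compact set enter, so `f` may be replaced by an integrable
  -- function.
  set K : Set Y := tsupport φ + P '' (-tsupport k) with hK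
  have hKc : IsCompact K := IsCompact.add hφc (IsCompact.image hkc.isCompact.neg hP.continuous)
  have hg : Integrable (K.indicator f) :=
    (integrable_indicator_iff hKc.measurableSet).2 (hf.integrableOn_isCompact hKc)
  have h1 := integrable_shear hP (hm.indicator hKc.measurableSet) hg
    (hk.integrable_of_hasCompactSupport hkc)
  obtain ⟨C, hC⟩ := hφc.exists_bound_of_continuous hφ
  have h2 := h1.mul_bdd (c := C) (hφ.comp continuous_fst).aestronglyMeasurable
    (Eventually.of_forall fun q : Y × E => hC q.1)
  refine h2.congr (Eventually.of_forall fun q => ?_)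
  by_cases h1 : q.1 ∈ tsupport φ
  · by_cases h2 : q.2 ∈ tsupport k
    · have : q.1 - P q.2 ∈ K := by
        rw [sub_eq_add_neg, ← map_neg]
        exact add_mem_add h1 ⟨-q.2, by simpa using h2, rfl⟩
      simp [this]
    · simp [image_eq_zero_of_notMem_tsupport h2]
  · simp [image_eq_zero_of_notMem_tsupport h1]

/-- By Fubini, for almost every `z` the function `e ↦ f (z - P e)` is integrable on all balls. A
single such `z = P y₀` suffices, after the reflection `e ↦ y₀ - e`; no comparison of the Haar
measures of `E` and `Y` is required. -/
lemma locallyIntegrable_lift_of_integrable (hP : IsCover P) (hm : Measurable f)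
    (hf : Integrable f) : LocallyIntegrable (fun e => f (P e)) := by
  have h1 : ∀ n : ℕ, ∀ᵐ z : Y, IntegrableOn (fun e : E => f (z - P e)) (Metric.ball 0 n) := by
    intro n
    have hk : Integrable ((Metric.ball (0 : E) n).indicator fun _ => (1 : ℝ)) :=
      (integrable_indicator_iff measurableSet_ball).2 (integrableOn_const measure_ball_lt_top.ne)
    filter_upwards [(integrable_shear hP hm hf hk).prod_right_ae] with z hz
    rw [← integrable_indicator_iff measurableSet_ball]
    refine hz.congr (Eventually.of_forall fun e => ?_)
    by_cases he : e ∈ Metric.ball (0 : E) n <;> simp [he, indicator]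
  obtain ⟨z, hz⟩ := (ae_all_iff.2 h1).exists
  obtain ⟨y₀, rfl⟩ := hP.surjective z
  rw [locallyIntegrable_iff]
  intro K hK
  obtain ⟨R, hR⟩ := (hK.isBounded.sub (Bornology.isBounded_singleton (x := y₀))).subset_ball 0
  obtain ⟨n, hn⟩ := exists_nat_gt R
  have h2 : IntegrableOn (fun e : E => f (P (y₀ - e))) (Metric.ball 0 n) := by
    simpa [map_sub] using hz n
  have h3 : MeasurePreserving (fun e : E => y₀ - e) volume volume :=
    Measure.measurePreserving_sub_left volume y₀
  have h4 := (h3.integrableOn_comp_preimage (f := fun e => f (P e)) (s := K)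
    (MeasurableEquiv.subLeft y₀).measurableEmbedding).1
  refine h4 (h2.mono_set fun e he => ?_)
  have : y₀ - e - y₀ ∈ Metric.ball (0 : E) R := hR ⟨_, he, y₀, rfl, rfl⟩
  simp only [sub_sub_cancel_left, Metric.mem_ball, dist_zero_right, norm_neg] at this ⊢
  linarith

lemma locallyIntegrable_lift (hP : IsCover P) (hm : Measurable f) (hf : LocallyIntegrable f) :
    LocallyIntegrable (fun e => f (P e)) := by
  rw [locallyIntegrable_iff]
  intro K hK
  have hKc := hK.image hP.continuous
  have h1 : Integrable ((P '' K).indicator f) :=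
    (integrable_indicator_iff hKc.measurableSet).2 (hf.integrableOn_isCompact hKc)
  refine ((locallyIntegrable_lift_of_integrable hP (hm.indicator hKc.measurableSet)
    h1).integrableOn_isCompact hK).congr_fun (fun e he => ?_) hK.measurableSet
  simp [indicator, mem_image_of_mem P he]

/-- Pulled back to `E`, the average is an ordinary convolution, and smoothness and the formula for
its derivative follow from this. -/
lemma mollify_lift (k : E → ℝ) (f : Y → ℝ) (y : E) :
    mollify P k f (P y) = convolution (fun e => f (P e)) k (ContinuousLinearMap.mul ℝ ℝ) volume y := by
  rw [convolution_mul_swap]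
  simp [mollify, mul_comm]

lemma smoothLift_mollify (hP : IsCover P) (hm : Measurable f) (hf : LocallyIntegrable f)
    (hk : ContDiff ℝ ∞ k) (hkc : HasCompactSupport k) : SmoothLift P (mollify P k f) := by
  unfold SmoothLift
  simp_rw [mollify_lift]
  exact hkc.contDiff_convolution_right _ (locallyIntegrable_lift hP hm hf) hk

lemma dirDeriv_mollify (hP : IsCover P) (hm : Measurable f) (hf : LocallyIntegrable f)
    (hk : ContDiff ℝ ∞ k) (hkc : HasCompactSupport k) (a : E) (z : Y) :
    dirDeriv P a (mollify P k f) z = mollify P (fun e => fderiv ℝ k e a) f z := by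
  obtain ⟨y, rfl⟩ := hP.surjective z
  rw [(smoothLift_mollify hP hm hf hk hkc).dirDeriv_apply, mollify_lift]
  simp_rw [mollify_lift]
  have hl := locallyIntegrable_lift hP hm hf
  have h1 : ContDiff ℝ 1 k := hk.of_le (by exact_mod_cast le_top)
  have := hkc.hasFDerivAt_convolution_right (ContinuousLinearMap.mul ℝ ℝ) hl h1 y
  rw [HasFDerivAt.fderiv this]
  exact convolution_precompR_apply _ hl (hkc.fderiv ℝ) (h1.continuous_fderiv one_ne_zero) y a

/-- The derivative first falls on the kernel. Integration by parts in `E` moves it to `φ`, and its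
sign cancels with the one from `e ↦ y - e`. -/
lemma dirDeriv_mollify_smooth (hP : IsCover P) (hφ : SmoothLift P φ)
    (hk : ContDiff ℝ ∞ k) (hkc : HasCompactSupport k) (a : E) (z : Y) :
    dirDeriv P a (mollify P k φ) z = mollify P k (dirDeriv P a φ) z := by
  have hc := hφ.continuous hP
  rw [dirDeriv_mollify hP hc.measurable hc.locallyIntegrable hk hkc]
  obtain ⟨y, rfl⟩ := hP.surjective z
  simp only [mollify, ← map_sub, hφ.dirDeriv_apply]
  have hψ : ContDiff ℝ ∞ (fun e => φ (P (y - e))) :=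
    ContDiff.comp (g := fun e => φ (P e)) hφ (contDiff_const.sub contDiff_id)
  have hder : ∀ e, fderiv ℝ (fun e => φ (P (y - e))) e a
      = - fderiv ℝ (fun e => φ (P e)) (y - e) a := by
    intro e
    have h1 : HasFDerivAt (fun e : E => y - e) (-ContinuousLinearMap.id ℝ E) e := by
      simpa using (hasFDerivAt_id e).const_sub y
    have := ((hφ.differentiable (y - e)).hasFDerivAt.comp e h1).fderiv
    simp only [Function.comp_def] at this
    rw [this]; simp
  have hk1 := (hk.continuous_fderiv (by simp)).clm_apply (continuous_const (y := a))
  have hψ1 := (hψ.continuous_fderiv (by simp)).clm_apply (continuous_const (y := a))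
  have hk1c : HasCompactSupport (fun e => fderiv ℝ k e a) := hkc.fderiv_apply ℝ a
  have := integral_mul_fderiv_eq_neg_fderiv_mul_of_integrable (μ := (volume : Measure E)) (f := k)
    (g := fun e => φ (P (y - e))) (v := a)
    ((hk1.mul hψ.continuous).integrable_of_hasCompactSupport hk1c.mul_right)
    ((hk.continuous.mul hψ1).integrable_of_hasCompactSupport hkc.mul_right)
    ((hk.continuous.mul hψ.continuous).integrable_of_hasCompactSupport hkc.mul_right)
    (fun x _ => hk.differentiable (by simp) x) (fun x _ => hψ.differentiable (by simp) x)
  simp_rw [hder, mul_neg, integral_neg] at this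
  linarith

/-- Fubini and a translation replace the kernel by its reflection, which is the same kernel by
evenness. -/
lemma mollify_adjoint (hP : IsCover P) (hm : Measurable f) (hf : LocallyIntegrable f)
    (hk : Continuous k) (hkc : HasCompactSupport k) (heven : ∀ e, k (-e) = k e)
    (hφ : Continuous φ) (hφc : HasCompactSupport φ) :
    ∫ z, f z * mollify P k φ z = ∫ z, mollify P k f z * φ z := by
  have h1 := integrable_mul_shear hP hm hf hk hkc hφ hφc
  have h2 : Integrable (fun q : Y × E => k q.2 * φ (q.1 - P q.2) * f q.1)
      ((volume : Measure Y).prod (volume : Measure E)) := by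
    set K : Set Y := tsupport φ + P '' (tsupport k) with hK
    have hKc : IsCompact K := IsCompact.add hφc (IsCompact.image hkc hP.continuous)
    have hg : Integrable (K.indicator f) volume :=
      (integrable_indicator_iff hKc.measurableSet).2 (hf.integrableOn_isCompact hKc)
    have hki : Integrable k volume := hk.integrable_of_hasCompactSupport hkc
    obtain ⟨C, hC⟩ := hφc.exists_bound_of_continuous hφ
    have h3 := (hg.mul_prod hki).mul_bdd (c := C)
      (hP.measurable_shear hφ.measurable).aestronglyMeasurable
      (Eventually.of_forall fun q : Y × E => hC _)
    refine h3.congr (Eventually.of_forall fun q => ?_)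
    by_cases h1 : q.1 - P q.2 ∈ tsupport φ
    · by_cases h2 : q.2 ∈ tsupport k
      · have : q.1 ∈ K := ⟨_, h1, P q.2, ⟨q.2, h2, rfl⟩, by simp⟩
        simp [this]; ring
      · simp [image_eq_zero_of_notMem_tsupport h2]
    · simp [image_eq_zero_of_notMem_tsupport h1]
  calc ∫ z, f z * mollify P k φ z = ∫ z, ∫ e, k e * φ (z - P e) * f z := by
        congr 1; ext z; rw [mollify, ← integral_const_mul]; congr 1; ext e; ring
    _ = ∫ e, ∫ z, k e * φ (z - P e) * f z := integral_integral_swap h2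
    _ = ∫ e, ∫ z, k e * f (z + P e) * φ z := by
        congr 1; ext e
        rw [← integral_add_right_eq_self (fun z => k e * φ (z - P e) * f z) (P e)]
        congr 1; ext z; rw [add_sub_cancel_right]; ring
    _ = ∫ e, ∫ z, k e * f (z - P e) * φ z := by
        rw [← integral_neg_eq_self (fun e : E => ∫ z, k e * f (z - P e) * φ z)]
        simp [heven]
    _ = ∫ z, ∫ e, k e * f (z - P e) * φ z := (integral_integral_swap h1).symm
    _ = _ := by congr 1; ext z; rw [mollify, ← integral_mul_const]

lemma support_mollify_subset :
    tsupport (mollify P k φ) ⊆ closure (tsupport φ + P '' tsupport k) := by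
  refine closure_mono fun z hz => ?_
  by_contra h
  refine hz (integral_eq_zero_of_ae (Eventually.of_forall fun e => ?_))
  by_cases he : e ∈ tsupport k
  · have : z - P e ∉ tsupport φ := fun h' => h ⟨_, h', P e, ⟨e, he, rfl⟩, by simp⟩
    simp [image_eq_zero_of_notMem_tsupport this]
  · simp [image_eq_zero_of_notMem_tsupport he]

lemma tsupport_mollify_subset (hP : IsCover P) (hk : HasCompactSupport k)
    (hφ : HasCompactSupport φ) :
    tsupport (mollify P k φ) ⊆ tsupport φ + P '' tsupport k := by
  have hc : IsCompact (tsupport φ + P '' tsupport k) :=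
    IsCompact.add hφ (hk.isCompact.image hP.continuous)
  exact support_mollify_subset.trans hc.isClosed.closure_subset

lemma hasCompactSupport_mollify (hP : IsCover P) (hk : HasCompactSupport k)
    (hφ : HasCompactSupport φ) : HasCompactSupport (mollify P k φ) :=
  (IsCompact.add hφ (hk.isCompact.image hP.continuous)).of_isClosed_subset (isClosed_tsupport _)
    (tsupport_mollify_subset hP hk hφ)

lemma eLpNorm_mollify_le (hP : IsCover P) (hm : Measurable f)
    (hk : Continuous k) (hkc : HasCompactSupport k) {p : ℝ≥0∞} (hp : 1 ≤ p) :
    eLpNorm (mollify P k f) p volume ≤ (∫⁻ e, ‖k e‖ₑ) * eLpNorm f p volume := by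
  refine eLpNorm_integral_kernel_le (hk.integrable_of_hasCompactSupport hkc) hk.measurable
    (G := fun e z => f (z - P e)) (hP.measurable_shear' hm) hp fun e _ => ?_
  exact (eLpNorm_comp_measurePreserving hm.aestronglyMeasurable
    (measurePreserving_sub_right volume (P e))).le

end Mollify

/-! ### The local energy identity for mollified solutions -/

section Energy

variable {E Y : Type} [NormedAddCommGroup E] [NormedSpace ℝ E] [FiniteDimensional ℝ E]
  [MeasureSpace E] [BorelSpace E] [(volume : Measure E).IsAddHaarMeasure]
  [AddCommGroup Y] [TopologicalSpace Y] [IsTopologicalAddGroup Y]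
  [LocallyCompactSpace Y] [T2Space Y] [SecondCountableTopology Y]
  [MeasureSpace Y] [BorelSpace Y] [(volume : Measure Y).IsAddHaarMeasure]

/-- A smooth, even, compactly supported kernel. -/
structure IsKernel (k : E → ℝ) : Prop where
  smooth : ContDiff ℝ ∞ k
  compact : HasCompactSupport k
  even : ∀ e, k (-e) = k e

/-- Smooth functions with compact support in `U`. -/
structure IsTestOn (P : E →+ Y) (U : Set Y) (φ : Y → ℝ) : Prop where
  smooth : SmoothLift P φ
  compact : HasCompactSupport φ
  support : tsupport φ ⊆ U

/-- The weak form of the momentum equation without pressure, tested with the field `Ψ`. -/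
def eulerForm (P : E →+ Y) (a₀ : E) {d : ℕ} (a : Fin d → E) (u Ψ : Fin d → Y → ℝ) : ℝ :=
  ∫ z, ∑ l, (u l z * dirDeriv P a₀ (Ψ l) z + ∑ j, u j z * u l z * dirDeriv P (a j) (Ψ l) z)

/-- Weak solutions of the Euler equations with the pressure eliminated. -/
structure EulerCore (P : E →+ Y) (a₀ : E) {d : ℕ} (a : Fin d → E) (U : Set Y)
    (u : Fin d → Y → ℝ) : Prop where
  measurable : ∀ l, Measurable (u l)
  memLp_two : ∀ l, MemLp (u l) 2
  memLp_three : ∀ l, MemLp (u l) 3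
  div_free : ∀ φ, IsTestOn P U φ → ∫ z, ∑ j, u j z * dirDeriv P (a j) φ z = 0
  momentum : ∀ Ψ : Fin d → Y → ℝ, (∀ l, IsTestOn P U (Ψ l)) →
    (∀ z, ∑ l, dirDeriv P (a l) (Ψ l) z = 0) → eulerForm P a₀ a u Ψ = 0

/-- The Reynolds stress of the mollification. -/
def reynolds (P : E →+ Y) (k : E → ℝ) {d : ℕ} (u : Fin d → Y → ℝ) (j l : Fin d) (z : Y) : ℝ :=
  mollify P k (fun z => u j z * u l z) z - mollify P k (u j) z * mollify P k (u l) z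

variable {P : E →+ Y} {a₀ : E} {d : ℕ} {a : Fin d → E} {U : Set Y} {u : Fin d → Y → ℝ} {k : E → ℝ}
  {ζ φ : Y → ℝ}

lemma IsTestOn.integrable (hP : IsCover P) (h : IsTestOn P U φ) : Integrable φ :=
  (h.smooth.continuous hP).integrable_of_hasCompactSupport h.compact

lemma IsTestOn.dirDeriv (hP : IsCover P) (h : IsTestOn P U φ) (b : E) :
    IsTestOn P U (dirDeriv P b φ) :=
  ⟨h.smooth.dirDeriv b, hasCompactSupport_dirDeriv hP h.compact b,
    (tsupport_dirDeriv_subset hP b).trans h.support⟩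

lemma IsTestOn.mul_right {ψ : Y → ℝ} (h : IsTestOn P U φ) (hψ : SmoothLift P ψ) :
    IsTestOn P U (fun z => φ z * ψ z) :=
  ⟨h.smooth.mul hψ, h.compact.mul_right, (tsupport_mul_subset_left).trans h.support⟩

lemma IsTestOn.sum {ι : Type} {s : Finset ι} {f : ι → Y → ℝ} (hf : ∀ i, IsTestOn P U (f i)) :
    IsTestOn P U (fun z => ∑ i ∈ s, f i z) := by
  have hsub : tsupport (fun z => ∑ i ∈ s, f i z) ⊆ ⋃ i ∈ s, tsupport (f i) := by
    refine closure_minimal (fun z hz => ?_)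
      (s.finite_toSet.isClosed_biUnion fun i _ => isClosed_tsupport _)
    obtain ⟨i, hi, hne⟩ := Finset.exists_ne_zero_of_sum_ne_zero hz
    exact mem_iUnion₂.2 ⟨i, hi, subset_tsupport _ hne⟩
  exact ⟨SmoothLift.sum fun i => (hf i).smooth,
    (s.finite_toSet.isCompact_biUnion fun i _ => (hf i).compact).of_isClosed_subset
      (isClosed_tsupport _) hsub, hsub.trans (iUnion₂_subset fun i _ => (hf i).support)⟩

lemma IsTestOn.mollify (hP : IsCover P) (h : IsTestOn P U φ) {U' : Set Y} (hk : IsKernel k)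
    (hU : tsupport φ + P '' tsupport k ⊆ U') : IsTestOn P U' (mollify P k φ) :=
  ⟨smoothLift_mollify hP (h.smooth.continuous hP).measurable
      (h.smooth.continuous hP).locallyIntegrable hk.smooth hk.compact,
    hasCompactSupport_mollify hP hk.compact h.compact,
    (tsupport_mollify_subset hP hk.compact h.compact).trans hU⟩

lemma integrable_mul_test (hP : IsCover P) {f : Y → ℝ} (hf : LocallyIntegrable f)
    (h : IsTestOn P U φ) : Integrable (fun z => f z * φ z) := by
  have := hf.integrable_smul_right_of_hasCompactSupport (h.smooth.continuous hP) h.compact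
  simpa [smul_eq_mul] using this

lemma integral_mul_dirDeriv_mollify (hP : IsCover P) {f : Y → ℝ} (hm : Measurable f)
    (hf : LocallyIntegrable f) (hk : IsKernel k) (h : IsTestOn P U φ) (b : E) :
    ∫ z, f z * dirDeriv P b (mollify P k φ) z = ∫ z, mollify P k f z * dirDeriv P b φ z := by
  simp_rw [dirDeriv_mollify_smooth hP h.smooth hk.smooth hk.compact]
  exact mollify_adjoint hP hm hf hk.smooth.continuous hk.compact hk.even
    ((h.smooth.dirDeriv b).continuous hP) (hasCompactSupport_dirDeriv hP h.compact b)

lemma integral_add_five {α : Type} [MeasurableSpace α] {μ : Measure α} {f₁ f₂ f₃ f₄ f₅ : α → ℝ}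
    (h₁ : Integrable f₁ μ) (h₂ : Integrable f₂ μ) (h₃ : Integrable f₃ μ) (h₄ : Integrable f₄ μ)
    (h₅ : Integrable f₅ μ) : ∫ z, (f₁ z + f₂ z + f₃ z + f₄ z + f₅ z) ∂μ =
      (∫ z, f₁ z ∂μ) + (∫ z, f₂ z ∂μ) + (∫ z, f₃ z ∂μ) + (∫ z, f₄ z ∂μ) + ∫ z, f₅ z ∂μ := by
  rw [integral_add (by exact ((h₁.add h₂).add h₃).add h₄) h₅,
    integral_add (by exact (h₁.add h₂).add h₃) h₄, integral_add (by exact h₁.add h₂) h₃,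
    integral_add h₁ h₂]

/-- The pointwise algebra of the energy identity. Here `ζ₀`, `ζ'`, `w₀`, `D` stand for `∂_t ζ`, `∂_j
ζ`, `∂_t w_l`, `∂_j w_l`, and `R j l + w j * w l` for the mollified product. The last bracket is the
material derivative of `ζ |w|² / 2` along `w`. -/
lemma sum_energy_identity (w : Fin d → ℝ) (R D : Fin d → Fin d → ℝ) (ζ ζ₀ : ℝ) (ζ' w₀ : Fin d → ℝ) :
    ∑ l, (w l * (ζ₀ * w l + ζ * w₀ l) + ∑ j, (R j l + w j * w l) * (ζ' j * w l + ζ * D j l)) =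
      2⁻¹ * ζ₀ * ∑ l, w l ^ 2 + ∑ j, ∑ l, ζ * R j l * D j l + ∑ j, ∑ l, ζ' j * (R j l * w l) +
      ∑ j, ∑ l, 2⁻¹ * ζ' j * (w j * w l ^ 2) +
      (2⁻¹ * ζ₀ * ∑ l, w l ^ 2 + ζ * ∑ l, w l * w₀ l +
        ∑ j, w j * (2⁻¹ * ζ' j * ∑ l, w l ^ 2 + ζ * ∑ l, w l * D j l)) := by
  have A : ∑ l, w l * (ζ₀ * w l + ζ * w₀ l) =
      2⁻¹ * ζ₀ * ∑ l, w l ^ 2 + (2⁻¹ * ζ₀ * ∑ l, w l ^ 2 + ζ * ∑ l, w l * w₀ l) := by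
    simp only [Finset.mul_sum, ← Finset.sum_add_distrib]
    exact Finset.sum_congr rfl fun l _ => by ring
  have B : ∑ l, ∑ j, (R j l + w j * w l) * (ζ' j * w l + ζ * D j l) =
      ∑ j, ∑ l, ζ * R j l * D j l + ∑ j, ∑ l, ζ' j * (R j l * w l) +
      ∑ j, ∑ l, 2⁻¹ * ζ' j * (w j * w l ^ 2) +
      ∑ j, w j * (2⁻¹ * ζ' j * ∑ l, w l ^ 2 + ζ * ∑ l, w l * D j l) := by
    rw [Finset.sum_comm]
    simp only [Finset.mul_sum, ← Finset.sum_add_distrib]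
    exact Finset.sum_congr rfl fun j _ => Finset.sum_congr rfl fun l _ => by ring
  rw [Finset.sum_add_distrib, A, B]; ring

namespace EulerCore

variable (hu : EulerCore P a₀ a U u)
include hu

lemma locallyIntegrable (l : Fin d) : LocallyIntegrable (u l) :=
  (hu.memLp_two l).locallyIntegrable (by norm_num)

lemma integrable_mul (j l : Fin d) : Integrable (fun z => u j z * u l z) :=
  (hu.memLp_two j).integrable_mul (hu.memLp_two l)

lemma smooth_mollify (hP : IsCover P) (hk : IsKernel k) (l : Fin d) :
    SmoothLift P (mollify P k (u l)) :=
  smoothLift_mollify hP (hu.measurable l) (hu.locallyIntegrable l) hk.smooth hk.compact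

lemma smooth_mollify_mul (hP : IsCover P) (hk : IsKernel k) (j l : Fin d) :
    SmoothLift P (mollify P k (fun z => u j z * u l z)) :=
  smoothLift_mollify hP ((hu.measurable j).mul (hu.measurable l))
    (hu.integrable_mul j l).locallyIntegrable hk.smooth hk.compact

lemma smooth_reynolds (hP : IsCover P) (hk : IsKernel k) (j l : Fin d) :
    SmoothLift P (reynolds P k u j l) :=
  (hu.smooth_mollify_mul hP hk j l).sub ((hu.smooth_mollify hP hk j).mul (hu.smooth_mollify hP hk l))

lemma integral_mollify_div (hP : IsCover P) (hk : IsKernel k) {V : Set Y} (h : IsTestOn P V φ)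
    (hU : tsupport φ + P '' tsupport k ⊆ U) :
    ∫ z, ∑ j, mollify P k (u j) z * dirDeriv P (a j) φ z = 0 := by
  have h1 := hu.div_free _ (h.mollify hP hk hU)
  rw [integral_finsetSum] at h1 ⊢
  · rw [← h1]
    refine Finset.sum_congr rfl fun j _ => ?_
    rw [integral_mul_dirDeriv_mollify hP (hu.measurable j) (hu.locallyIntegrable j) hk h]
  · exact fun j _ => integrable_mul_test hP ((hu.smooth_mollify hP hk j).continuous hP).locallyIntegrable
      (h.dirDeriv hP _)
  · exact fun j _ => integrable_mul_test hP (hu.locallyIntegrable j)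
      ((h.mollify hP hk hU).dirDeriv hP _)

/-- The mollified velocity is divergence-free only at points from which the kernel does not leave
`U`, and the factor `ζ` localizes to such points. With `q` its divergence, testing with `ζ² q` gives
`∫ (ζ q)² = 0`, and `ζ q` is continuous. -/
lemma mul_div_mollify_eq_zero (hP : IsCover P) (hk : IsKernel k) {V : Set Y} (h : IsTestOn P V ζ)
    (hU : tsupport ζ + P '' tsupport k ⊆ U) (z : Y) :
    ζ z * ∑ j, dirDeriv P (a j) (mollify P k (u j)) z = 0 := by
  set q : Y → ℝ := fun z => ∑ j, dirDeriv P (a j) (mollify P k (u j)) z with hq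
  have hqs : SmoothLift P q := SmoothLift.sum fun j => (hu.smooth_mollify hP hk j).dirDeriv _
  have hφ : IsTestOn P V (fun z => ζ z * (ζ z * q z)) := h.mul_right (h.smooth.mul hqs)
  have h1 := hu.integral_mollify_div hP hk hφ
    ((add_subset_add_right tsupport_mul_subset_left).trans hU)
  have h2 : ∫ z, (ζ z * q z) ^ 2 = 0 := by
    rw [integral_finsetSum] at h1
    · have : ∀ j, ∫ z, mollify P k (u j) z * dirDeriv P (a j) (fun z => ζ z * (ζ z * q z)) z
          = - ∫ z, (ζ z * (ζ z * q z)) * dirDeriv P (a j) (mollify P k (u j)) z := by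
        intro j
        rw [integral_mul_dirDeriv hP hφ.smooth (hu.smooth_mollify hP hk j) hφ.compact, neg_neg]
        simp_rw [mul_comm]
      simp_rw [this] at h1
      rw [Finset.sum_neg_distrib, neg_eq_zero, ← integral_finsetSum] at h1
      · rw [← h1]; congr 1; ext z; rw [← Finset.mul_sum]; simp only [hq]; ring
      · exact fun j _ => (hφ.mul_right ((hu.smooth_mollify hP hk j).dirDeriv _)).integrable hP
    · exact fun j _ => integrable_mul_test hP
        ((hu.smooth_mollify hP hk j).continuous hP).locallyIntegrable (hφ.dirDeriv hP _)
  have hT : IsTestOn P V (fun z => ζ z * q z) := h.mul_right hqs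
  have hc := hT.smooth.continuous hP
  have hint : Integrable (fun z => (ζ z * q z) ^ 2) := by
    simpa [sq] using (hT.mul_right hT.smooth).integrable hP
  rw [integral_eq_zero_iff_of_nonneg (fun z => sq_nonneg _) hint] at h2
  have := (Continuous.ae_eq_iff_eq volume (hc.pow 2) continuous_const).1 h2
  have h3 : (ζ z * q z) ^ 2 = 0 := congrFun this z
  exact pow_eq_zero_iff (two_ne_zero) |>.1 h3

lemma isTestOn_field (hP : IsCover P) (hk : IsKernel k) {V : Set Y} (h : IsTestOn P V ζ)
    (l : Fin d) : IsTestOn P V (fun z => ζ z * mollify P k (u l) z) :=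
  h.mul_right (hu.smooth_mollify hP hk l)

lemma isTestOn_mollify_field (hP : IsCover P) (hk : IsKernel k) {V : Set Y} (h : IsTestOn P V ζ)
    (hU : tsupport ζ + P '' tsupport k ⊆ U) (l : Fin d) :
    IsTestOn P U (mollify P k fun z => ζ z * mollify P k (u l) z) :=
  (hu.isTestOn_field hP hk h l).mollify hP hk
    ((add_subset_add_right tsupport_mul_subset_left).trans hU)

/-- Since `ζ` times the divergence of the mollified velocity vanishes, only the gradient of `ζ`
survives. In particular the field is divergence-free when `ζ` depends on time alone. -/
lemma div_field (hP : IsCover P) (hk : IsKernel k) {V : Set Y} (h : IsTestOn P V ζ)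
    (hU : tsupport ζ + P '' tsupport k ⊆ U) (z : Y) :
    ∑ l, dirDeriv P (a l) (mollify P k fun z => ζ z * mollify P k (u l) z) z =
      mollify P k (fun z => ∑ l, dirDeriv P (a l) ζ z * mollify P k (u l) z) z := by
  have hT := hu.isTestOn_field hP hk h
  have hint : ∀ (f : Y → ℝ), Continuous f → Integrable (fun e => k e * f (z - P e)) := fun f hf =>
    (hk.smooth.continuous.mul (hf.comp (continuous_const.sub hP.continuous))
      ).integrable_of_hasCompactSupport hk.compact.mul_right
  simp_rw [fun l => dirDeriv_mollify_smooth hP (hT l).smooth hk.smooth hk.compact (a l) z]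
  simp only [mollify]
  rw [← integral_finsetSum]
  · congr 1; ext e
    rw [← Finset.mul_sum]
    congr 1
    have := hu.mul_div_mollify_eq_zero hP hk h hU (z - P e)
    calc _ = ∑ l, (dirDeriv P (a l) ζ (z - P e) * mollify P k (u l) (z - P e) +
          ζ (z - P e) * dirDeriv P (a l) (mollify P k (u l)) (z - P e)) := by
            refine Finset.sum_congr rfl fun l _ => ?_
            exact dirDeriv_mul hP.surjective h.smooth (hu.smooth_mollify hP hk l) _ _
      _ = _ := by rw [Finset.sum_add_distrib, ← Finset.mul_sum, this, add_zero]; rfl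
  · exact fun l _ => hint _ (((hT l).smooth.dirDeriv _).continuous hP)

/-- The local energy identity for the mollified velocity. -/
lemma eulerForm_mollify (hP : IsCover P) (hk : IsKernel k) {V : Set Y} (h : IsTestOn P V ζ)
    (hU : tsupport ζ + P '' tsupport k ⊆ U) :
    eulerForm P a₀ a u (fun l => mollify P k fun z => ζ z * mollify P k (u l) z) =
      (∫ z, 2⁻¹ * dirDeriv P a₀ ζ z * ∑ l, mollify P k (u l) z ^ 2) +
      (∫ z, ∑ j, ∑ l, ζ z * reynolds P k u j l z * dirDeriv P (a j) (mollify P k (u l)) z) +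
      (∫ z, ∑ j, ∑ l, dirDeriv P (a j) ζ z * (reynolds P k u j l z * mollify P k (u l) z)) +
      (∫ z, ∑ j, ∑ l, 2⁻¹ * dirDeriv P (a j) ζ z *
        (mollify P k (u j) z * mollify P k (u l) z ^ 2)) := by
  set w : Fin d → Y → ℝ := fun l => mollify P k (u l) with hw
  have hws : ∀ l, SmoothLift P (w l) := hu.smooth_mollify hP hk
  have hRs := hu.smooth_reynolds hP hk
  have hT := hu.isTestOn_field hP hk h
  have hT' := hu.isTestOn_mollify_field hP hk h hU
  have hli : ∀ {f : Y → ℝ}, SmoothLift P f → LocallyIntegrable f := fun hf =>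
    (hf.continuous hP).locallyIntegrable
  -- The energy density `ζ |w|² / 2`: the integral of its time derivative vanishes, and so does that
  -- of `w · ∇ψ` because `w` is weakly divergence-free near the support.
  set ψ : Y → ℝ := fun z => ζ z * (2⁻¹ * ∑ l, w l z * w l z) with hψdef
  have hψ : IsTestOn P V ψ := h.mul_right ((SmoothLift.sum fun l => (hws l).mul (hws l)).const_mul _)
  -- The outer mollification is moved onto `u l` and `u j * u l`; the mollified product it creates
  -- is the source of the Reynolds stress.
  have step1 : eulerForm P a₀ a u (fun l => mollify P k fun z => ζ z * w l z) =
      ∫ z, ∑ l, (w l z * dirDeriv P a₀ (fun z => ζ z * w l z) z + ∑ j,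
        mollify P k (fun z => u j z * u l z) z * dirDeriv P (a j) (fun z => ζ z * w l z) z) := by
    have i1 : ∀ l, Integrable (fun z => u l z * dirDeriv P a₀ (mollify P k fun z => ζ z * w l z) z) :=
      fun l => integrable_mul_test hP (hu.locallyIntegrable l) ((hT' l).dirDeriv hP _)
    have i2 : ∀ l j, Integrable (fun z => u j z * u l z *
        dirDeriv P (a j) (mollify P k fun z => ζ z * w l z) z) := fun l j =>
      integrable_mul_test hP (hu.integrable_mul j l).locallyIntegrable ((hT' l).dirDeriv hP _)
    have i3 : ∀ l, Integrable (fun z => w l z * dirDeriv P a₀ (fun z => ζ z * w l z) z) := fun l =>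
      integrable_mul_test hP (hli (hws l)) ((hT l).dirDeriv hP _)
    have i4 : ∀ l j, Integrable (fun z => mollify P k (fun z => u j z * u l z) z *
        dirDeriv P (a j) (fun z => ζ z * w l z) z) := fun l j =>
      integrable_mul_test hP (hli (hu.smooth_mollify_mul hP hk j l)) ((hT l).dirDeriv hP _)
    have j2 : ∀ l, Integrable (fun z => ∑ j, u j z * u l z *
        dirDeriv P (a j) (mollify P k fun z => ζ z * w l z) z) := fun l =>
      integrable_finsetSum _ fun j _ => i2 l j
    have j4 : ∀ l, Integrable (fun z => ∑ j, mollify P k (fun z => u j z * u l z) z *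
        dirDeriv P (a j) (fun z => ζ z * w l z) z) := fun l =>
      integrable_finsetSum _ fun j _ => i4 l j
    rw [eulerForm, integral_finsetSum _ (fun l _ => by exact (i1 l).add (j2 l)),
      integral_finsetSum _ (fun l _ => by exact (i3 l).add (j4 l))]
    refine Finset.sum_congr rfl fun l _ => ?_
    rw [integral_add (i1 l) (j2 l), integral_add (i3 l) (j4 l),
      integral_finsetSum _ (fun j _ => i2 l j), integral_finsetSum _ (fun j _ => i4 l j),
      integral_mul_dirDeriv_mollify hP (hu.measurable l) (hu.locallyIntegrable l) hk (hT l)]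
    congr 1
    refine Finset.sum_congr rfl fun j _ => ?_
    exact integral_mul_dirDeriv_mollify hP ((hu.measurable j).mul (hu.measurable l))
      (hu.integrable_mul j l).locallyIntegrable hk (hT l) (a j)
  have hDψ : ∀ b z, dirDeriv P b ψ z = 2⁻¹ * dirDeriv P b ζ z * ∑ l, w l z ^ 2 +
      ζ z * ∑ l, w l z * dirDeriv P b (w l) z := by
    intro b z
    have h1 : dirDeriv P b (fun z => 2⁻¹ * ∑ l, w l z * w l z) z =
        ∑ l, w l z * dirDeriv P b (w l) z := by
      have := ((HasDerivAt.fun_sum (u := Finset.univ) fun l _ =>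
        ((hws l).hasDerivAt_line hP.surjective b z 0).fun_mul
          ((hws l).hasDerivAt_line hP.surjective b z 0)).const_mul (2⁻¹ : ℝ)).deriv
      simp only [zero_smul, map_zero, add_zero] at this
      rw [dirDeriv, this, Finset.mul_sum]
      exact Finset.sum_congr rfl fun l _ => by ring
    rw [hψdef, dirDeriv_mul hP.surjective h.smooth
      ((SmoothLift.sum fun l => (hws l).mul (hws l)).const_mul _), h1]
    simp_rw [sq]; ring
  have hDT : ∀ b l z, dirDeriv P b (fun z => ζ z * w l z) z =
      dirDeriv P b ζ z * w l z + ζ z * dirDeriv P b (w l) z := fun b l z =>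
    dirDeriv_mul hP.surjective h.smooth (hws l) b z
  have step2 : ∀ z, ∑ l, (w l z * dirDeriv P a₀ (fun z => ζ z * w l z) z + ∑ j,
        mollify P k (fun z => u j z * u l z) z * dirDeriv P (a j) (fun z => ζ z * w l z) z) =
      2⁻¹ * dirDeriv P a₀ ζ z * ∑ l, w l z ^ 2 +
      ∑ j, ∑ l, ζ z * reynolds P k u j l z * dirDeriv P (a j) (w l) z +
      ∑ j, ∑ l, dirDeriv P (a j) ζ z * (reynolds P k u j l z * w l z) +
      ∑ j, ∑ l, 2⁻¹ * dirDeriv P (a j) ζ z * (w j z * w l z ^ 2) +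
      (dirDeriv P a₀ ψ z + ∑ j, w j z * dirDeriv P (a j) ψ z) := by
    intro z
    simp_rw [hDψ, hDT]
    have hS : ∀ j l, mollify P k (fun z => u j z * u l z) z = reynolds P k u j l z + w j z * w l z :=
      fun j l => by simp [reynolds, hw]
    simp_rw [hS]
    exact sum_energy_identity _ _ _ _ _ _ _
  have hR : ∀ j l, IsTestOn P V (fun z => ζ z * reynolds P k u j l z) := fun j l => h.mul_right (hRs j l)
  have iA : Integrable (fun z => 2⁻¹ * dirDeriv P a₀ ζ z * ∑ l, w l z ^ 2) := by
    have := (((h.dirDeriv hP a₀).mul_right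
      (SmoothLift.sum (s := Finset.univ) fun l => (hws l).mul (hws l))).integrable hP).const_mul 2⁻¹
    refine this.congr (Eventually.of_forall fun z => ?_)
    simp_rw [sq]; ring
  have iB : Integrable (fun z => ∑ j, ∑ l, ζ z * reynolds P k u j l z * dirDeriv P (a j) (w l) z) :=
    integrable_finsetSum _ fun j _ => integrable_finsetSum _ fun l _ =>
      ((hR j l).mul_right ((hws l).dirDeriv _)).integrable hP
  have iC : Integrable (fun z => ∑ j, ∑ l, dirDeriv P (a j) ζ z *
      (reynolds P k u j l z * w l z)) :=
    integrable_finsetSum _ fun j _ => integrable_finsetSum _ fun l _ =>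
      ((h.dirDeriv hP _).mul_right ((hRs j l).mul (hws l))).integrable hP
  have iD : Integrable (fun z => ∑ j, ∑ l, 2⁻¹ * dirDeriv P (a j) ζ z * (w j z * w l z ^ 2)) := by
    refine integrable_finsetSum _ fun j _ => integrable_finsetSum _ fun l _ => ?_
    have := (((h.dirDeriv hP (a j)).mul_right
      ((hws j).mul ((hws l).mul (hws l)))).integrable hP).const_mul 2⁻¹
    refine this.congr (Eventually.of_forall fun z => ?_)
    simp_rw [sq]; ring
  have iE : Integrable (fun z => dirDeriv P a₀ ψ z) := (hψ.dirDeriv hP _).integrable hP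
  have iF : Integrable (fun z => ∑ j, w j z * dirDeriv P (a j) ψ z) :=
    integrable_finsetSum _ fun j _ => integrable_mul_test hP (hli (hws j)) (hψ.dirDeriv hP _)
  have e1 := integral_dirDeriv_eq_zero hP hψ.smooth hψ.compact a₀
  have e2 := hu.integral_mollify_div hP hk hψ ((add_subset_add_right tsupport_mul_subset_left).trans hU)
  have e3 : ∫ z, (dirDeriv P a₀ ψ z + ∑ j, w j z * dirDeriv P (a j) ψ z) = 0 := by
    rw [integral_add iE iF, e1, e2, add_zero]
  rw [step1, integral_congr_ae (Eventually.of_forall step2),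
    integral_add_five iA iB iC iD (by exact iE.add iF), e3, add_zero]

end EulerCore

end Energy

/-! ### Estimates for the terms of the energy identity -/

instance holderTriple_three_three : ENNReal.HolderTriple 3 3 (3 / 2) where
  inv_add_inv_eq_inv := by
    rw [ENNReal.inv_div (by simp) (by simp), ← two_mul, ENNReal.div_eq_inv_mul, mul_comm]

instance holderTriple_three_halves_three : ENNReal.HolderTriple (3 / 2) 3 1 where
  inv_add_inv_eq_inv := by
    rw [ENNReal.inv_div (by simp) (by simp), ENNReal.div_eq_inv_mul, inv_one,
      show (3 : ℝ≥0∞)⁻¹ * 2 + 3⁻¹ = 3⁻¹ * 3 by rw [show (3 : ℝ≥0∞) = 2 + 1 by norm_num]; ring]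
    exact ENNReal.inv_mul_cancel (by simp) (by simp)

lemma one_le_three_halves : (1 : ℝ≥0∞) ≤ 3 / 2 := by
  rw [ENNReal.le_div_iff_mul_le (by simp) (by simp)]; norm_num

section Holder

variable {α : Type} [MeasurableSpace α] {μ : Measure α} {f g h : α → ℝ}

lemma eLpNorm_mul_le (hf : AEStronglyMeasurable f μ) (hg : AEStronglyMeasurable g μ)
    (p q r : ℝ≥0∞) [ENNReal.HolderTriple p q r] :
    eLpNorm (fun z => f z * g z) r μ ≤ eLpNorm f p μ * eLpNorm g q μ := by
  have h := eLpNorm_smul_le_mul_eLpNorm (p := p) (q := q) (r := r) hg hf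
  have e : (f • g) = fun z => f z * g z := by ext z; simp
  rwa [e] at h

lemma enorm_integral_mul_le (hf : AEStronglyMeasurable f μ) (hg : AEStronglyMeasurable g μ)
    (p q : ℝ≥0∞) [ENNReal.HolderTriple p q 1] :
    ‖∫ z, f z * g z ∂μ‖ₑ ≤ eLpNorm f p μ * eLpNorm g q μ := by
  refine (enorm_integral_le_lintegral_enorm _).trans ?_
  rw [← eLpNorm_one_eq_lintegral_enorm]
  exact eLpNorm_mul_le hf hg p q 1

lemma enorm_integral_bdd_mul_le {Z : ℝ≥0∞} (hh : ∀ z, ‖h z‖ₑ ≤ Z)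
    (hf : AEStronglyMeasurable f μ) (hg : AEStronglyMeasurable g μ)
    (p q : ℝ≥0∞) [ENNReal.HolderTriple p q 1] :
    ‖∫ z, h z * (f z * g z) ∂μ‖ₑ ≤ Z * (eLpNorm f p μ * eLpNorm g q μ) := by
  refine (enorm_integral_le_lintegral_enorm _).trans ?_
  calc ∫⁻ z, ‖h z * (f z * g z)‖ₑ ∂μ ≤ ∫⁻ z, Z * ‖f z * g z‖ₑ ∂μ := by
        refine lintegral_mono fun z => ?_
        rw [enorm_mul]; exact mul_le_mul_left (hh z) _
    _ = Z * ∫⁻ z, ‖f z * g z‖ₑ ∂μ :=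
        lintegral_const_mul'' _ (hf.mul hg).enorm
    _ ≤ _ := by
        gcongr
        rw [← eLpNorm_one_eq_lintegral_enorm]
        exact eLpNorm_mul_le hf hg p q 1

end Holder

/-! ### Bounds for the commutator, the flux and the cutoff terms -/

section Flux

variable {E Y : Type} [NormedAddCommGroup E] [NormedSpace ℝ E] [FiniteDimensional ℝ E]
  [MeasureSpace E] [BorelSpace E] [(volume : Measure E).IsAddHaarMeasure]
  [AddCommGroup Y] [TopologicalSpace Y] [IsTopologicalAddGroup Y]
  [LocallyCompactSpace Y] [T2Space Y] [SecondCountableTopology Y]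
  [MeasureSpace Y] [BorelSpace Y] [(volume : Measure Y).IsAddHaarMeasure]

/-- A nonnegative kernel of mass one with control of its first derivatives in the directions `a`. -/
structure IsMollifier {d : ℕ} (a : Fin d → E) (S : Set E) (M : ℝ≥0∞) (k : E → ℝ) : Prop
    extends IsKernel k where
  mass : ∫ e, k e = 1
  nonneg : ∀ e, 0 ≤ k e
  support : tsupport k ⊆ S
  deriv_le : ∀ j, ∫⁻ e, ‖fderiv ℝ k e (a j)‖ₑ ≤ M

variable {P : E →+ Y} {a₀ : E} {d : ℕ} {a : Fin d → E} {U V : Set Y} {u : Fin d → Y → ℝ} {k : E → ℝ}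
  {ζ φ f g : Y → ℝ} {S : Set E} {M : ℝ≥0∞}

lemma IsMollifier.integrable (hk : IsMollifier a S M k) : Integrable k :=
  hk.smooth.continuous.integrable_of_hasCompactSupport hk.compact

lemma IsMollifier.lintegral_enorm (hk : IsMollifier a S M k) : ∫⁻ e, ‖k e‖ₑ = 1 := by
  have h := ofReal_integral_eq_lintegral_ofReal hk.integrable (Eventually.of_forall hk.nonneg)
  rw [hk.mass, ENNReal.ofReal_one] at h
  rw [h]
  exact lintegral_congr fun e => by rw [Real.enorm_eq_ofReal (hk.nonneg e)]

lemma IsMollifier.eLpNorm_le (hP : IsCover P) (hk : IsMollifier a S M k) (hm : Measurable f)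
    {p : ℝ≥0∞} (hp : 1 ≤ p) : eLpNorm (mollify P k f) p ≤ eLpNorm f p := by
  have := eLpNorm_mollify_le hP hm hk.smooth.continuous hk.compact hp
  rwa [hk.lintegral_enorm, one_mul] at this

lemma integrable_kernel_mul (hP : IsCover P) (hm : Measurable f) (hf : LocallyIntegrable f)
    (hk : Continuous k) (hkc : HasCompactSupport k) (z : Y) :
    Integrable (fun e => k e * f (z - P e)) := by
  obtain ⟨y, rfl⟩ := hP.surjective z
  have := (hkc.convolutionExists_left (ContinuousLinearMap.mul ℝ ℝ) hk
    (locallyIntegrable_lift hP hm hf) y)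
  simpa [ConvolutionExistsAt, map_sub] using this

lemma IsMollifier.mollify_sub (hP : IsCover P) (hk : IsMollifier a S M k) (hm : Measurable f)
    (hf : LocallyIntegrable f) (z : Y) :
    mollify P k f z - f z = ∫ e, k e * (f (z - P e) - f z) := by
  simp_rw [mul_sub]
  rw [integral_sub (integrable_kernel_mul hP hm hf hk.smooth.continuous hk.compact z)
    (hk.integrable.mul_const _), integral_mul_const, hk.mass, one_mul]
  rfl

lemma integral_fderiv_eq_zero (hk : IsKernel k) (b : E) : ∫ e, fderiv ℝ k e b = 0 := by
  have := integral_mul_fderiv_eq_neg_fderiv_mul_of_integrable (μ := (volume : Measure E))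
    (f := fun _ => (1 : ℝ)) (g := k) (v := b) (by simp)
    (by simpa using ((hk.smooth.continuous_fderiv (by simp)).clm_apply
      continuous_const).integrable_of_hasCompactSupport (hk.compact.fderiv_apply ℝ b))
    (by simpa using hk.smooth.continuous.integrable_of_hasCompactSupport hk.compact)
    (by simp) (fun x _ => hk.smooth.differentiable (by simp) x)
  simpa using this

lemma measurable_increment (hP : IsCover P) (hm : Measurable f) :
    Measurable (Function.uncurry fun (e : E) (z : Y) => f (z - P e) - f z) :=
  (hP.measurable_shear' hm).sub (hm.comp measurable_snd)

/-- Since the kernel has mass one, the difference is an average of increments based at the same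
point `z`. Hence the measure `μ` may be a restriction, and increments are measured only over the
support of `ζ` later on. -/
lemma IsMollifier.eLpNorm_sub_le (hP : IsCover P) (hk : IsMollifier a S M k) (hm : Measurable f)
    (hf : LocallyIntegrable f) {μ : Measure Y} [SFinite μ] {p B : ℝ≥0∞} (hp : 1 ≤ p)
    (hB : ∀ e ∈ S, eLpNorm (fun z => f (z - P e) - f z) p μ ≤ B) :
    eLpNorm (fun z => mollify P k f z - f z) p μ ≤ B := by
  simp_rw [hk.mollify_sub hP hm hf]
  refine (eLpNorm_integral_kernel_le hk.integrable hk.smooth.continuous.measurable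
    (measurable_increment hP hm) hp fun e he => hB e (hk.support (subset_tsupport _ he))).trans ?_
  rw [hk.lintegral_enorm, one_mul]

/-- The derivative of the kernel has integral zero, so `f z` can be subtracted under the integral.
The loss of one inverse power of the scale sits in `M`. -/
lemma IsMollifier.eLpNorm_dirDeriv_le (hP : IsCover P) (hk : IsMollifier a S M k)
    (hm : Measurable f) (hf : LocallyIntegrable f) {μ : Measure Y} [SFinite μ] {p B : ℝ≥0∞}
    (hp : 1 ≤ p) (hB : ∀ e ∈ S, eLpNorm (fun z => f (z - P e) - f z) p μ ≤ B) (j : Fin d) :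
    eLpNorm (dirDeriv P (a j) (mollify P k f)) p μ ≤ M * B := by
  have hcont : Continuous fun e => fderiv ℝ k e (a j) :=
    (hk.smooth.continuous_fderiv (by simp)).clm_apply continuous_const
  have hcs : HasCompactSupport fun e => fderiv ℝ k e (a j) := hk.compact.fderiv_apply ℝ (a j)
  have hi : Integrable fun e => fderiv ℝ k e (a j) := hcont.integrable_of_hasCompactSupport hcs
  have h1 : dirDeriv P (a j) (mollify P k f) =
      fun z => ∫ e, fderiv ℝ k e (a j) * (f (z - P e) - f z) := by
    ext z
    rw [dirDeriv_mollify hP hm hf hk.smooth hk.compact]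
    simp_rw [mul_sub]
    rw [integral_sub (integrable_kernel_mul hP hm hf hcont hcs z) (hi.mul_const _),
      integral_mul_const, integral_fderiv_eq_zero hk.toIsKernel, zero_mul, sub_zero]
    rfl
  rw [h1]
  refine (eLpNorm_integral_kernel_le hi hcont.measurable (measurable_increment hP hm) hp
    fun e he => hB e (hk.support ?_)).trans (mul_le_mul_left (hk.deriv_le j) _)
  exact tsupport_fderiv_apply_subset ℝ (a j) (subset_tsupport _ he)

namespace EulerCore

variable (hu : EulerCore P a₀ a U u)
include hu

/-- The commutator identity of Constantin, E and Titi: with a kernel of mass one all terms linear in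
the increments cancel. -/
lemma reynolds_eq (hP : IsCover P) (hk : IsMollifier a S M k) (j l : Fin d) (z : Y) :
    reynolds P k u j l z = (∫ e, k e * ((u j (z - P e) - u j z) * (u l (z - P e) - u l z))) -
      (mollify P k (u j) z - u j z) * (mollify P k (u l) z - u l z) := by
  have i1 : Integrable (fun e => k e * (u j (z - P e) * u l (z - P e))) :=
    integrable_kernel_mul hP ((hu.measurable j).mul (hu.measurable l))
    (hu.integrable_mul j l).locallyIntegrable hk.smooth.continuous hk.compact z
  have i2 := fun l => integrable_kernel_mul hP (hu.measurable l) (hu.locallyIntegrable l)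
    hk.smooth.continuous hk.compact z
  have h1 : ∀ e, k e * ((u j (z - P e) - u j z) * (u l (z - P e) - u l z)) =
      k e * (u j (z - P e) * u l (z - P e)) - u l z * (k e * u j (z - P e))
        - u j z * (k e * u l (z - P e)) + u j z * u l z * k e := fun e => by ring
  simp_rw [h1]
  rw [integral_add (by exact (i1.sub ((i2 j).const_mul _)).sub ((i2 l).const_mul _))
      (hk.integrable.const_mul _), integral_sub (by exact i1.sub ((i2 j).const_mul _))
      ((i2 l).const_mul _), integral_sub i1 ((i2 j).const_mul _), integral_const_mul,
    integral_const_mul, integral_const_mul, hk.mass]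
  simp only [reynolds, mollify]
  ring

lemma eLpNorm_reynolds_le_increment (hP : IsCover P) (hk : IsMollifier a S M k)
    {μ : Measure Y} [SFinite μ] {D : ℝ≥0∞}
    (hD : ∀ e ∈ S, ∀ l, eLpNorm (fun z => u l (z - P e) - u l z) 3 μ ≤ D) (j l : Fin d) :
    eLpNorm (reynolds P k u j l) (3 / 2) μ ≤ 2 * D ^ 2 := by
  have hmi := fun (l : Fin d) (e : E) =>
    ((measurable_increment hP (hu.measurable l)).of_uncurry_left (x := e)).aestronglyMeasurable (μ := μ)
  have hG : Measurable (Function.uncurry fun (e : E) (z : Y) =>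
      (u j (z - P e) - u j z) * (u l (z - P e) - u l z)) :=
    (measurable_increment hP (hu.measurable j)).mul (measurable_increment hP (hu.measurable l))
  have h1 : eLpNorm (fun z => ∫ e, k e * ((u j (z - P e) - u j z) * (u l (z - P e) - u l z)))
      (3 / 2) μ ≤ D ^ 2 := by
    refine (eLpNorm_integral_kernel_le hk.integrable hk.smooth.continuous.measurable hG
      one_le_three_halves (B := D ^ 2) fun e he => ?_).trans ?_
    · have heS := hk.support (subset_tsupport _ he)
      refine (eLpNorm_mul_le (hmi j e) (hmi l e) 3 3 (3 / 2)).trans ?_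
      rw [sq]; exact mul_le_mul' (hD e heS j) (hD e heS l)
    · rw [hk.lintegral_enorm, one_mul]
  have hwm : ∀ l, Measurable (fun z => mollify P k (u l) z - u l z) := fun l =>
    ((hu.smooth_mollify hP hk.toIsKernel l).continuous hP).measurable.sub (hu.measurable l)
  have h2 : eLpNorm (fun z => (mollify P k (u j) z - u j z) * (mollify P k (u l) z - u l z))
      (3 / 2) μ ≤ D ^ 2 := by
    refine (eLpNorm_mul_le (hwm j).aestronglyMeasurable (hwm l).aestronglyMeasurable 3 3
      (3 / 2)).trans ?_
    rw [sq]
    exact mul_le_mul' (hk.eLpNorm_sub_le hP (hu.measurable j) (hu.locallyIntegrable j) (by norm_num)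
      fun e he => hD e he j) (hk.eLpNorm_sub_le hP (hu.measurable l) (hu.locallyIntegrable l)
      (by norm_num) fun e he => hD e he l)
  have h3 : reynolds P k u j l =
      (fun z => ∫ e, k e * ((u j (z - P e) - u j z) * (u l (z - P e) - u l z))) -
        fun z => (mollify P k (u j) z - u j z) * (mollify P k (u l) z - u l z) := by
    ext z; exact hu.reynolds_eq hP hk j l z
  have hm3 : Measurable (fun z => (mollify P k (u j) z - u j z) * (mollify P k (u l) z - u l z)) :=
    (hwm j).mul (hwm l)
  -- Measurability of the averaged product is read off from the commutator identity, whose other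
  -- terms are already known to be measurable.
  have hm1 : Measurable
      (fun z => ∫ e, k e * ((u j (z - P e) - u j z) * (u l (z - P e) - u l z))) := by
    have : (fun z => ∫ e, k e * ((u j (z - P e) - u j z) * (u l (z - P e) - u l z))) =
        reynolds P k u j l +
          fun z => (mollify P k (u j) z - u j z) * (mollify P k (u l) z - u l z) := by
      rw [h3, sub_add_cancel]
    rw [this]
    exact ((hu.smooth_reynolds hP hk.toIsKernel j l).continuous hP).measurable.add hm3
  rw [h3]
  refine (eLpNorm_sub_le hm1.aestronglyMeasurable hm3.aestronglyMeasurable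
    one_le_three_halves).trans ?_
  rw [two_mul]; exact add_le_add h1 h2

/-- A bound without smallness, for the term in which the derivative falls on `ζ`. -/
lemma eLpNorm_reynolds_le (hP : IsCover P) (hk : IsMollifier a S M k) {N : ℝ≥0∞}
    (hN : ∀ l, eLpNorm (u l) 3 ≤ N) (j l : Fin d) :
    eLpNorm (reynolds P k u j l) (3 / 2) ≤ 2 * N ^ 2 := by
  have hws : ∀ l, Measurable (mollify P k (u l)) := fun l =>
    ((hu.smooth_mollify hP hk.toIsKernel l).continuous hP).measurable
  have h1 : eLpNorm (mollify P k fun z => u j z * u l z) (3 / 2) ≤ N ^ 2 := by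
    refine (hk.eLpNorm_le hP ((hu.measurable j).mul (hu.measurable l)) one_le_three_halves).trans ?_
    refine (eLpNorm_mul_le (hu.measurable j).aestronglyMeasurable
      (hu.measurable l).aestronglyMeasurable 3 3 (3 / 2)).trans ?_
    rw [sq]; exact mul_le_mul' (hN j) (hN l)
  have h2 : eLpNorm (fun z => mollify P k (u j) z * mollify P k (u l) z) (3 / 2) ≤ N ^ 2 := by
    refine (eLpNorm_mul_le (hws j).aestronglyMeasurable (hws l).aestronglyMeasurable 3 3
      (3 / 2)).trans ?_
    rw [sq]
    exact mul_le_mul' ((hk.eLpNorm_le hP (hu.measurable j) (by norm_num)).trans (hN j))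
      ((hk.eLpNorm_le hP (hu.measurable l) (by norm_num)).trans (hN l))
  refine (eLpNorm_sub_le
    (((hu.smooth_mollify_mul hP hk.toIsKernel j l).continuous hP).measurable.aestronglyMeasurable)
    ((hws j).mul (hws l)).aestronglyMeasurable one_le_three_halves).trans ?_
  rw [two_mul]; exact add_le_add h1 h2

/-- Hölder with exponents `3/2` and `3`: two increments from the Reynolds stress, and a third one
with the factor `M` from the gradient. The integrand vanishes off the support of `ζ`, so only
increments there count. -/
lemma enorm_flux_le (hP : IsCover P) (hk : IsMollifier a S M k) {D Z : ℝ≥0∞}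
    (hD : ∀ e ∈ S, ∀ l, eLpNorm (fun z => u l (z - P e) - u l z) 3
      (volume.restrict (tsupport ζ)) ≤ D) (hZ : ∀ z, ‖ζ z‖ₑ ≤ Z) (j l : Fin d) :
    ‖∫ z, ζ z * reynolds P k u j l z * dirDeriv P (a j) (mollify P k (u l)) z‖ₑ ≤
      Z * (2 * D ^ 2 * (M * D)) := by
  have h1 : ∫ z, ζ z * reynolds P k u j l z * dirDeriv P (a j) (mollify P k (u l)) z =
      ∫ z in tsupport ζ, ζ z * (reynolds P k u j l z * dirDeriv P (a j) (mollify P k (u l)) z) := by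
    rw [setIntegral_eq_integral_of_forall_compl_eq_zero fun z hz => by
      rw [image_eq_zero_of_notMem_tsupport hz, zero_mul]]
    congr 1; ext z; ring
  rw [h1]
  refine (enorm_integral_bdd_mul_le hZ
    ((hu.smooth_reynolds hP hk.toIsKernel j l).continuous hP).measurable.aestronglyMeasurable
    (((hu.smooth_mollify hP hk.toIsKernel l).dirDeriv _).continuous hP).measurable.aestronglyMeasurable
    (3 / 2) 3).trans ?_
  exact mul_le_mul_right (mul_le_mul' (hu.eLpNorm_reynolds_le_increment hP hk hD j l)
    (hk.eLpNorm_dirDeriv_le hP (hu.measurable l) (hu.locallyIntegrable l) (by norm_num)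
      (fun e he => hD e he l) j)) _

lemma enorm_gradient_term_le (hP : IsCover P) (hk : IsMollifier a S M k) {N Z : ℝ≥0∞}
    (hN : ∀ l, eLpNorm (u l) 3 ≤ N) (hZ : ∀ j z, ‖dirDeriv P (a j) ζ z‖ₑ ≤ Z) (j l : Fin d) :
    ‖∫ z, dirDeriv P (a j) ζ z * (reynolds P k u j l z * mollify P k (u l) z)‖ₑ ≤
      2 * Z * N ^ 3 := by
  refine (enorm_integral_bdd_mul_le (hZ j)
    ((hu.smooth_reynolds hP hk.toIsKernel j l).continuous hP).measurable.aestronglyMeasurable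
    ((hu.smooth_mollify hP hk.toIsKernel l).continuous hP).measurable.aestronglyMeasurable
    (3 / 2) 3).trans ?_
  calc _ ≤ Z * (2 * N ^ 2 * N) := by
        gcongr
        · exact hu.eLpNorm_reynolds_le hP hk hN j l
        · exact (hk.eLpNorm_le hP (hu.measurable l) (by norm_num)).trans (hN l)
    _ = _ := by ring

lemma enorm_cubic_term_le (hP : IsCover P) (hk : IsMollifier a S M k) {N Z : ℝ≥0∞}
    (hN : ∀ l, eLpNorm (u l) 3 ≤ N) (hZ : ∀ j z, ‖dirDeriv P (a j) ζ z‖ₑ ≤ Z) (j l : Fin d) :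
    ‖∫ z, 2⁻¹ * dirDeriv P (a j) ζ z * (mollify P k (u j) z * mollify P k (u l) z ^ 2)‖ₑ ≤
      Z * N ^ 3 := by
  have hws : ∀ l, Measurable (mollify P k (u l)) := fun l =>
    ((hu.smooth_mollify hP hk.toIsKernel l).continuous hP).measurable
  have hwN : ∀ l, eLpNorm (mollify P k (u l)) 3 ≤ N := fun l =>
    (hk.eLpNorm_le hP (hu.measurable l) (by norm_num)).trans (hN l)
  have h1 : ∫ z, 2⁻¹ * dirDeriv P (a j) ζ z * (mollify P k (u j) z * mollify P k (u l) z ^ 2) =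
      ∫ z, (2⁻¹ * dirDeriv P (a j) ζ z) *
        ((mollify P k (u j) z * mollify P k (u l) z) * mollify P k (u l) z) := by
    congr 1; ext z; ring
  rw [h1]
  refine (enorm_integral_bdd_mul_le (Z := Z) (fun z => ?_)
    ((hws j).mul (hws l)).aestronglyMeasurable (hws l).aestronglyMeasurable (3 / 2) 3).trans ?_
  · rw [enorm_mul]
    refine (mul_le_mul' (b := 1) ?_ (hZ j z)).trans_eq (one_mul _)
    rw [Real.enorm_eq_ofReal (by norm_num)]
    exact ENNReal.ofReal_le_one.2 (by norm_num)
  · calc _ ≤ Z * ((N * N) * N) := by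
          gcongr
          · exact (eLpNorm_mul_le (hws j).aestronglyMeasurable (hws l).aestronglyMeasurable 3 3
              (3 / 2)).trans (mul_le_mul' (hwN j) (hwN l))
          · exact hwN l
      _ = _ := by ring

/-- The difference of squares factors as `(w - u)(w + u)`, and `w - u` is controlled in `L²` by
increments. -/
lemma enorm_energy_sub_le (hP : IsCover P) (hk : IsMollifier a S M k) {V : Set Y}
    (h : IsTestOn P V ζ) {N₂ D₂ Z : ℝ≥0∞}
    (hN : ∀ l, eLpNorm (u l) 2 ≤ N₂) (hZ : ∀ z, ‖dirDeriv P a₀ ζ z‖ₑ ≤ Z)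
    (hD : ∀ e ∈ S, ∀ l, eLpNorm (fun z => u l (z - P e) - u l z) 2 ≤ D₂) :
    ‖(∫ z, 2⁻¹ * dirDeriv P a₀ ζ z * ∑ l, u l z ^ 2) -
      ∫ z, 2⁻¹ * dirDeriv P a₀ ζ z * ∑ l, mollify P k (u l) z ^ 2‖ₑ ≤ d * (Z * (D₂ * (2 * N₂))) := by
  have hws : ∀ l, Measurable (mollify P k (u l)) := fun l =>
    ((hu.smooth_mollify hP hk.toIsKernel l).continuous hP).measurable
  have hwN : ∀ l, eLpNorm (mollify P k (u l)) 2 ≤ N₂ := fun l =>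
    (hk.eLpNorm_le hP (hu.measurable l) (by norm_num)).trans (hN l)
  have hT := h.dirDeriv hP a₀
  have i1 : ∀ l, Integrable fun z => 2⁻¹ * dirDeriv P a₀ ζ z * u l z ^ 2 := fun l => by
    refine ((integrable_mul_test hP (hu.integrable_mul l l).locallyIntegrable hT).const_mul
      2⁻¹).congr (Eventually.of_forall fun z => ?_)
    ring
  have i2 : ∀ l, Integrable fun z => 2⁻¹ * dirDeriv P a₀ ζ z * mollify P k (u l) z ^ 2 := fun l => by
    have hs := hu.smooth_mollify hP hk.toIsKernel l
    refine (((hT.mul_right (hs.mul hs)).integrable hP).const_mul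
      2⁻¹).congr (Eventually.of_forall fun z => ?_)
    ring
  simp_rw [Finset.mul_sum]
  rw [integral_finsetSum _ fun l _ => i1 l, integral_finsetSum _ fun l _ => i2 l,
    ← Finset.sum_sub_distrib]
  refine (enorm_sum_le _ _).trans ?_
  have : ∀ l ∈ Finset.univ, ‖(∫ z, 2⁻¹ * dirDeriv P a₀ ζ z * u l z ^ 2) -
      ∫ z, 2⁻¹ * dirDeriv P a₀ ζ z * mollify P k (u l) z ^ 2‖ₑ ≤ Z * (D₂ * (2 * N₂)) := by
    intro l _
    rw [← integral_sub (i1 l) (i2 l)]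
    have h1 : ∫ z, (2⁻¹ * dirDeriv P a₀ ζ z * u l z ^ 2 -
        2⁻¹ * dirDeriv P a₀ ζ z * mollify P k (u l) z ^ 2) = ∫ z, (-2⁻¹ * dirDeriv P a₀ ζ z) *
          ((mollify P k (u l) z - u l z) * (mollify P k (u l) z + u l z)) := by
      congr 1; ext z; ring
    rw [h1]
    refine (enorm_integral_bdd_mul_le (Z := Z) (fun z => ?_)
      ((hws l).sub (hu.measurable l)).aestronglyMeasurable
      ((hws l).add (hu.measurable l)).aestronglyMeasurable 2 2).trans ?_
    · rw [enorm_mul]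
      refine (mul_le_mul' (b := 1) ?_ (hZ z)).trans_eq (one_mul _)
      rw [enorm_neg, Real.enorm_eq_ofReal (by norm_num)]
      exact ENNReal.ofReal_le_one.2 (by norm_num)
    · gcongr
      · exact hk.eLpNorm_sub_le hP (hu.measurable l) (hu.locallyIntegrable l) (by norm_num)
          fun e he => hD e he l
      · refine (eLpNorm_add_le (hws l).aestronglyMeasurable
          (hu.measurable l).aestronglyMeasurable (by norm_num)).trans ?_
        rw [two_mul]; exact add_le_add (hwN l) (hN l)
  refine (Finset.sum_le_sum this).trans ?_
  simp

lemma enorm_sum_integral_le {F : Fin d → Fin d → Y → ℝ} (hF : ∀ j l, Integrable (F j l)) {B : ℝ≥0∞}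
    (hB : ∀ j l, ‖∫ z, F j l z‖ₑ ≤ B) : ‖∫ z, ∑ j, ∑ l, F j l z‖ₑ ≤ d ^ 2 * B := by
  rw [integral_finsetSum _ fun j _ => integrable_finsetSum _ fun l _ => hF j l]
  refine (enorm_sum_le _ _).trans ?_
  have : ∀ j ∈ Finset.univ, ‖∫ z, ∑ l, F j l z‖ₑ ≤ d * B := by
    intro j _
    rw [integral_finsetSum _ fun l _ => hF j l]
    refine (enorm_sum_le _ _).trans ((Finset.sum_le_sum fun l _ => hB j l).trans ?_)
    simp
  refine (Finset.sum_le_sum this).trans ?_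
  simp [sq, mul_assoc]

/-- The energy balance of `u` tested with `ζ`, with all error terms estimated. -/
lemma enorm_energy_le (hP : IsCover P) (hk : IsMollifier a S M k) {V : Set Y}
    (h : IsTestOn P V ζ) (hU : tsupport ζ + P '' tsupport k ⊆ U) {N N₂ D D₂ Z₀ Z₁ Z₂ : ℝ≥0∞}
    (hN₂ : ∀ l, eLpNorm (u l) 2 ≤ N₂) (hN : ∀ l, eLpNorm (u l) 3 ≤ N)
    (hZ₀ : ∀ z, ‖ζ z‖ₑ ≤ Z₀) (hZ₁ : ∀ j z, ‖dirDeriv P (a j) ζ z‖ₑ ≤ Z₁)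
    (hZ₂ : ∀ z, ‖dirDeriv P a₀ ζ z‖ₑ ≤ Z₂)
    (hD : ∀ e ∈ S, ∀ l, eLpNorm (fun z => u l (z - P e) - u l z) 3
      (volume.restrict (tsupport ζ)) ≤ D)
    (hD₂ : ∀ e ∈ S, ∀ l, eLpNorm (fun z => u l (z - P e) - u l z) 2 ≤ D₂) :
    ‖∫ z, 2⁻¹ * dirDeriv P a₀ ζ z * ∑ l, u l z ^ 2‖ₑ ≤
      ‖eulerForm P a₀ a u (fun l => mollify P k fun z => ζ z * mollify P k (u l) z)‖ₑ +
      3 * d ^ 2 * (Z₁ * N ^ 3) + 2 * d ^ 2 * Z₀ * (M * D ^ 3) + 2 * d * (Z₂ * N₂) * D₂ := by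
  have hws := hu.smooth_mollify hP hk.toIsKernel
  have hRs := hu.smooth_reynolds hP hk.toIsKernel
  have b1 := enorm_sum_integral_le hu (F := fun j l z =>
    ζ z * reynolds P k u j l z * dirDeriv P (a j) (mollify P k (u l)) z)
    (fun j l => ((h.mul_right (hRs j l)).mul_right ((hws l).dirDeriv _)).integrable hP)
    (fun j l => hu.enorm_flux_le hP hk hD hZ₀ j l)
  have b2 := enorm_sum_integral_le hu (F := fun j l z =>
    dirDeriv P (a j) ζ z * (reynolds P k u j l z * mollify P k (u l) z))
    (fun j l => ((h.dirDeriv hP _).mul_right ((hRs j l).mul (hws l))).integrable hP)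
    (fun j l => hu.enorm_gradient_term_le hP hk hN hZ₁ j l)
  have b3 := enorm_sum_integral_le hu (F := fun j l z =>
    2⁻¹ * dirDeriv P (a j) ζ z * (mollify P k (u j) z * mollify P k (u l) z ^ 2))
    (fun j l => by
      refine ((((h.dirDeriv hP (a j)).mul_right
        ((hws j).mul ((hws l).mul (hws l)))).integrable hP).const_mul 2⁻¹).congr
        (Eventually.of_forall fun z => ?_)
      simp_rw [sq]; ring)
    (fun j l => hu.enorm_cubic_term_le hP hk hN hZ₁ j l)
  have b4 := hu.enorm_energy_sub_le hP hk h hN₂ hZ₂ hD₂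
  have key := hu.eulerForm_mollify hP hk.toIsKernel h hU
  set A := ∫ z, 2⁻¹ * dirDeriv P a₀ ζ z * ∑ l, u l z ^ 2
  set A' := ∫ z, 2⁻¹ * dirDeriv P a₀ ζ z * ∑ l, mollify P k (u l) z ^ 2
  set Q := eulerForm P a₀ a u (fun l => mollify P k fun z => ζ z * mollify P k (u l) z)
  set B₁ := ∫ z, ∑ j, ∑ l, ζ z * reynolds P k u j l z * dirDeriv P (a j) (mollify P k (u l)) z
  set B₂ := ∫ z, ∑ j, ∑ l, dirDeriv P (a j) ζ z * (reynolds P k u j l z * mollify P k (u l) z)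
  set B₃ := ∫ z, ∑ j, ∑ l, 2⁻¹ * dirDeriv P (a j) ζ z *
    (mollify P k (u j) z * mollify P k (u l) z ^ 2)
  have hA : A = Q - B₂ - B₃ - B₁ + (A - A') := by rw [key]; ring
  calc ‖A‖ₑ = ‖Q - B₂ - B₃ - B₁ + (A - A')‖ₑ := by rw [← hA]
    _ ≤ ‖Q‖ₑ + ‖B₂‖ₑ + ‖B₃‖ₑ + ‖B₁‖ₑ + ‖A - A'‖ₑ := by
        refine (enorm_add_le _ _).trans (add_le_add ?_ le_rfl)
        refine (enorm_sub_le).trans (add_le_add ?_ le_rfl)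
        refine (enorm_sub_le).trans (add_le_add ?_ le_rfl)
        exact enorm_sub_le
    _ ≤ ‖Q‖ₑ + d ^ 2 * (2 * Z₁ * N ^ 3) + d ^ 2 * (Z₁ * N ^ 3) +
          d ^ 2 * (Z₀ * (2 * D ^ 2 * (M * D))) + d * (Z₂ * (D₂ * (2 * N₂))) := by gcongr
    _ = _ := by ring

end EulerCore

end Flux

/-! ### Space-time mollifiers -/

/-- The unit vector in the time direction. -/
def timeDir (d : ℕ) : ℝ × Vec d := (1, 0)

/-- The unit vectors in the spatial directions. -/
def spaceDir (d : ℕ) (j : Fin d) : ℝ × Vec d := (0, EuclideanSpace.single j 1)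

instance isAddHaarMeasure_timeVec (d : ℕ) :
    (volume : Measure (ℝ × Vec d)).IsAddHaarMeasure := Measure.prod.instIsAddHaarMeasure _ _

lemma le_sum_univ {d : ℕ} (f : Fin d → ℝ≥0∞) (l : Fin d) : f l ≤ ∑ l, f l :=
  Finset.single_le_sum (fun _ _ => zero_le) (Finset.mem_univ l)

lemma integral_abs_scaled_fderiv {d : ℕ} (κ : Vec d → ℝ) {ε : ℝ} (hε : 0 < ε) (b : Vec d) :
    ∫ h, ‖(ε⁻¹) ^ d * (ε⁻¹ * fderiv ℝ κ (ε⁻¹ • h) b)‖ = ε⁻¹ * ∫ h, ‖fderiv ℝ κ h b‖ := by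
  have hi : 0 < ε⁻¹ := inv_pos.2 hε
  have h1 := Measure.integral_comp_smul (volume : Measure (Vec d)) (fun h => ‖fderiv ℝ κ h b‖) ε⁻¹
  simp only [finrank_euclideanSpace, Fintype.card_fin, smul_eq_mul] at h1
  simp_rw [norm_mul, integral_const_mul, h1, norm_pow, Real.norm_of_nonneg hi.le]
  rw [abs_of_pos (by positivity)]
  field_simp

/-- The kernel is a product of bumps in time and in space. Only its spatial derivatives are
controlled, so the constant does not see `δ`, which may then be chosen depending on `ε`. -/
lemma exists_isMollifier (d : ℕ) : ∃ C : ℝ≥0∞, C ≠ ⊤ ∧ ∀ δ ε : ℝ, 0 < δ → 0 < ε →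
    ∃ k : ℝ × Vec d → ℝ, IsMollifier (spaceDir d)
      (Metric.closedBall 0 δ ×ˢ Metric.closedBall 0 ε) (C * ENNReal.ofReal ε⁻¹) k := by
  let β : ContDiffBump (0 : Vec d) := ⟨1 / 2, 1, by norm_num, by norm_num⟩
  set κ : Vec d → ℝ := β.normed volume with hκ
  have hκs : ContDiff ℝ ∞ κ := β.contDiff_normed
  have hκc : HasCompactSupport κ := β.hasCompactSupport_normed
  have hκi : ∀ b, Integrable fun h => fderiv ℝ κ h b := fun b =>
    ((hκs.continuous_fderiv (by simp)).clm_apply continuous_const).integrable_of_hasCompactSupport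
      (hκc.fderiv_apply ℝ b)
  refine ⟨∑ j, ENNReal.ofReal (∫ h, ‖fderiv ℝ κ h (EuclideanSpace.single j 1)‖),
    by simp [ENNReal.sum_eq_top], fun δ ε hδ hε => ?_⟩
  have hi : 0 < ε⁻¹ := inv_pos.2 hε
  let β₁ : ContDiffBump (0 : ℝ) := ⟨δ / 2, δ, by positivity, by linarith⟩
  set ρ : ℝ → ℝ := β₁.normed volume with hρ
  have hρs : ContDiff ℝ ∞ ρ := β₁.contDiff_normed
  set κ' : Vec d → ℝ := fun h => (ε⁻¹) ^ d * κ (ε⁻¹ • h) with hκ'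
  have hκ's : ContDiff ℝ ∞ κ' := contDiff_const.mul (hκs.comp (contDiff_const_smul _))
  set k : ℝ × Vec d → ℝ := fun e => ρ e.1 * κ' e.2 with hk
  have hks : ContDiff ℝ ∞ k := (hρs.comp contDiff_fst).mul (hκ's.comp contDiff_snd)
  have hsupp : tsupport k ⊆ Metric.closedBall 0 δ ×ˢ Metric.closedBall 0 ε := by
    refine closure_minimal (fun e he => ?_) (Metric.isClosed_closedBall.prod Metric.isClosed_closedBall)
    have h1 : ρ e.1 ≠ 0 := left_ne_zero_of_mul he
    have h2 : κ (ε⁻¹ • e.2) ≠ 0 := right_ne_zero_of_mul (right_ne_zero_of_mul he)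
    have h3 : e.1 ∈ tsupport ρ := subset_tsupport _ h1
    have h4 : ε⁻¹ • e.2 ∈ tsupport κ := subset_tsupport _ h2
    rw [hρ, β₁.tsupport_normed_eq] at h3
    rw [hκ, β.tsupport_normed_eq] at h4
    refine ⟨h3, ?_⟩
    simp only [Metric.mem_closedBall, dist_zero_right, norm_smul, Real.norm_of_nonneg hi.le] at h4 ⊢
    rwa [inv_mul_le_iff₀ hε, show β.rOut = 1 from rfl, mul_one] at h4
  have hint : ∫ h, κ' h = 1 := by
    have h1 := Measure.integral_comp_smul (volume : Measure (Vec d)) κ ε⁻¹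
    simp only [finrank_euclideanSpace, Fintype.card_fin, smul_eq_mul] at h1
    simp_rw [hκ', integral_const_mul, h1, hκ, β.integral_normed]
    rw [abs_of_pos (by positivity)]
    field_simp
  have hder : ∀ e j, fderiv ℝ k e (spaceDir d j) =
      ρ e.1 * ((ε⁻¹) ^ d * (ε⁻¹ * fderiv ℝ κ (ε⁻¹ • e.2) (EuclideanSpace.single j 1))) := by
    intro e j
    have h1 : HasFDerivAt (fun h : Vec d => κ (ε⁻¹ • h))
        ((fderiv ℝ κ (ε⁻¹ • e.2)).comp (ε⁻¹ • ContinuousLinearMap.id ℝ (Vec d))) e.2 :=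
      ((hκs.differentiable (by simp) _).hasFDerivAt).comp e.2
        ((hasFDerivAt_id e.2).const_smul ε⁻¹)
    have h2 := (((hρs.differentiable (by simp) e.1).hasFDerivAt).comp e hasFDerivAt_fst).mul
      ((h1.const_mul ((ε⁻¹) ^ d)).comp e hasFDerivAt_snd)
    have h3 : fderiv ℝ k e = _ := h2.fderiv
    rw [h3]
    simp [spaceDir]
  have hkc : HasCompactSupport k := ((isCompact_closedBall _ _).prod
    (isCompact_closedBall _ _)).of_isClosed_subset (isClosed_tsupport _) hsupp
  refine ⟨k, ⟨⟨hks, hkc, fun e => ?_⟩, ?_, fun e => ?_, hsupp, fun j => ?_⟩⟩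
  · simp [hk, hκ', hρ, hκ, ContDiffBump.normed_neg]
  · rw [Measure.volume_eq_prod, integral_prod_mul, hint, hρ, β₁.integral_normed, one_mul]
  · exact mul_nonneg (β₁.nonneg_normed _) (mul_nonneg (by positivity) (β.nonneg_normed _))
  · have hI : Integrable (fun e => fderiv ℝ k e (spaceDir d j)) :=
      ((hks.continuous_fderiv (by simp)).clm_apply continuous_const).integrable_of_hasCompactSupport
        (hkc.fderiv_apply ℝ _)
    rw [← ofReal_integral_norm_eq_lintegral_enorm hI]
    simp_rw [hder, norm_mul (ρ _)]
    rw [Measure.volume_eq_prod, integral_prod_mul (fun s => ‖ρ s‖)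
      (fun h => ‖(ε⁻¹) ^ d * (ε⁻¹ * fderiv ℝ κ (ε⁻¹ • h) (EuclideanSpace.single j 1))‖),
      integral_abs_scaled_fderiv κ hε]
    have : ∫ s, ‖ρ s‖ = 1 := by
      rw [← β₁.integral_normed (μ := volume)]
      exact integral_congr_ae (Eventually.of_forall fun s =>
        Real.norm_of_nonneg (β₁.nonneg_normed s))
    rw [this, one_mul, ENNReal.ofReal_mul hi.le, mul_comm]
    gcongr
    exact le_sum_univ
      (fun j => ENNReal.ofReal (∫ h, ‖fderiv ℝ κ h (EuclideanSpace.single j 1)‖)) j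

/-! ### Bounds for test functions and continuity of translations -/

section Translation

variable {E Y : Type} [NormedAddCommGroup E] [NormedSpace ℝ E] [FiniteDimensional ℝ E]
  [AddCommGroup Y] [TopologicalSpace Y] [IsTopologicalAddGroup Y]
  [LocallyCompactSpace Y] [T2Space Y] [SecondCountableTopology Y]
  [MeasureSpace Y] [BorelSpace Y] [(volume : Measure Y).IsAddHaarMeasure]

lemma IsTestOn.exists_bound {P : E →+ Y} (hP : IsCover P) {U : Set Y} {φ : Y → ℝ}
    (h : IsTestOn P U φ) : ∃ Z : ℝ≥0∞, Z ≠ ⊤ ∧ ∀ z, ‖φ z‖ₑ ≤ Z := by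
  obtain ⟨c, hc⟩ := h.compact.exists_bound_of_continuous (h.smooth.continuous hP)
  exact ⟨ENNReal.ofReal c, by simp, fun z => by
    rw [← ofReal_norm]; exact ENNReal.ofReal_le_ofReal (hc z)⟩

/-- Translations act continuously on `L^p` for finite `p`. -/
lemma tendsto_eLpNorm_increment {P : E →+ Y} (hP : IsCover P) {f : Y → ℝ} {p : ℝ≥0∞}
    (hp : 1 ≤ p) (hp' : p ≠ ⊤) (hf : MemLp f p) :
    Tendsto (fun e : E => eLpNorm (fun z => f (z - P e) - f z) p) (𝓝 0) (𝓝 0) := by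
  have : Fact (1 ≤ p) := ⟨hp⟩
  let g : E → C(Y, Y) := fun e => ⟨fun z => z - P e, continuous_id.sub continuous_const⟩
  have hg : Continuous g := ContinuousMap.continuous_of_continuous_uncurry _
    (continuous_snd.sub (hP.continuous.comp continuous_fst))
  have hgm : ∀ e, MeasurePreserving (g e) (volume : Measure Y) volume := fun e =>
    measurePreserving_sub_right volume (P e)
  have h1 := Filter.Tendsto.compMeasurePreservingLp (l := 𝓝 (0 : E)) (f := fun _ => hf.toLp f)
    (f₀ := hf.toLp f) tendsto_const_nhds (hg.tendsto 0) hgm (hgm 0) hp'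
  have h0 : Lp.compMeasurePreserving (g 0) (hgm 0) (hf.toLp f) = hf.toLp f := by
    rw [Lp.toLp_compMeasurePreserving]
    congr 1
    ext z; simp [g]
  rw [h0, Lp.tendsto_Lp_iff_tendsto_eLpNorm'] at h1
  refine h1.congr fun e => ?_
  rw [Lp.toLp_compMeasurePreserving]
  refine eLpNorm_congr_ae ?_
  filter_upwards [(hf.comp_measurePreserving (hgm e)).coeFn_toLp, hf.coeFn_toLp] with z h2 h3
  simpa [h3, g] using h2

end Translation

/-! ### Space-time -/

section SpaceTime

variable {d : ℕ} {X : Type} [AddCommGroup X] [TopologicalSpace X] [IsTopologicalAddGroup X]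
  [LocallyCompactSpace X] [T2Space X] [SecondCountableTopology X]
  [MeasureSpace X] [BorelSpace X] [(volume : Measure X).IsAddHaarMeasure]

instance isAddHaarMeasure_spaceTime : (volume : Measure (ℝ × X)).IsAddHaarMeasure :=
  Measure.prod.instIsAddHaarMeasure _ _

/-- The covering homomorphism of space-time. -/
def timeProj (π : Vec d →+ X) : ℝ × Vec d →+ ℝ × X := (AddMonoidHom.id ℝ).prodMap π

@[simp] lemma timeProj_apply (π : Vec d →+ X) (e : ℝ × Vec d) : timeProj π e = (e.1, π e.2) := rfl

lemma IsCover.timeProj {π : Vec d →+ X} (hπ : IsCover π) : IsCover (timeProj π) where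
  continuous := by
    change Continuous fun e : ℝ × Vec d => (e.1, π e.2)
    exact continuous_fst.prodMk (hπ.continuous.comp continuous_snd)
  surjective := fun z => by
    obtain ⟨y, hy⟩ := hπ.surjective z.2
    exact ⟨(z.1, y), by simp [hy]⟩
  isOpenMap := IsOpenMap.prodMap IsOpenMap.id hπ.isOpenMap

variable {π : Vec d →+ X} {U : Set (ℝ × X)} {u : Fin d → ℝ × X → ℝ} {ζ : ℝ × X → ℝ}

set_option maxHeartbeats 400000 in
/-- If the spatial increments satisfy `‖δ_h u‖_{L^3(K)}^3 = o(|h|)` then the energy flux through the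
test function `ζ` vanishes in the limit. -/
lemma EulerCore.enorm_energy_le_of_tendsto (hπ : IsCover π)
    (hu : EulerCore (timeProj π) (timeDir d) (spaceDir d) U u) (hUo : IsOpen U)
    (hsmall : ∀ l, Tendsto (fun h : Vec d => ENNReal.ofReal ‖h‖⁻¹ *
      eLpNorm (fun z => u l (z - timeProj π (0, h)) - u l z) 3 (volume.restrict (tsupport ζ)) ^ 3)
      (𝓝[≠] 0) (𝓝 0))
    (h : IsTestOn (timeProj π) U ζ) {N Z₁ A : ℝ≥0∞} (hN : ∀ l, eLpNorm (u l) 3 ≤ N)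
    (hZ₁ : ∀ j z, ‖dirDeriv (timeProj π) (spaceDir d j) ζ z‖ₑ ≤ Z₁)
    (hA : ∀ (S : Set (ℝ × Vec d)) (M : ℝ≥0∞) (k : ℝ × Vec d → ℝ), IsMollifier (spaceDir d) S M k →
      tsupport ζ + timeProj π '' tsupport k ⊆ U → ‖eulerForm (timeProj π) (timeDir d) (spaceDir d) u
        (fun l => mollify (timeProj π) k fun z => ζ z * mollify (timeProj π) k (u l) z)‖ₑ ≤ A) :
    ‖∫ z, 2⁻¹ * dirDeriv (timeProj π) (timeDir d) ζ z * ∑ l, u l z ^ 2‖ₑ ≤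
      A + 3 * d ^ 2 * (Z₁ * N ^ 3) := by
  set P := timeProj π with hPdef
  have hP : IsCover P := hπ.timeProj
  obtain ⟨Z₀, hZ₀t, hZ₀⟩ := h.exists_bound hP
  obtain ⟨Z₂, hZ₂t, hZ₂⟩ := (h.dirDeriv hP (timeDir d)).exists_bound hP
  set N₂ := ∑ l, eLpNorm (u l) 2 with hN₂def
  have hN₂t : N₂ ≠ ⊤ := by
    rw [hN₂def, ENNReal.sum_ne_top]; exact fun l _ => (hu.memLp_two l).2.ne
  have hN₂ : ∀ l, eLpNorm (u l) 2 ≤ N₂ := le_sum_univ _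
  obtain ⟨C, hCt, hC⟩ := exists_isMollifier d
  -- The total coefficient of `τ` in the error terms; the `8` is the cube of the factor in `2 * D₁`.
  set c : ℝ≥0∞ := 2 * d ^ 2 * Z₀ * (8 * C) + 2 * d * (Z₂ * N₂) with hc
  have hct : c ≠ ⊤ := by rw [hc]; finiteness
  have main : ∀ n : ℕ, ‖∫ z, 2⁻¹ * dirDeriv P (timeDir d) ζ z * ∑ l, u l z ^ 2‖ₑ ≤
      A + 3 * d ^ 2 * (Z₁ * N ^ 3) + c * ((n + 1 : ℕ) : ℝ≥0∞)⁻¹ := by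
    intro n
    set τ : ℝ≥0∞ := ((n + 1 : ℕ) : ℝ≥0∞)⁻¹ with hτ
    have hτ0 : 0 < τ := ENNReal.inv_pos.2 (ENNReal.natCast_ne_top _)
    have hτt : τ ≠ ⊤ := ENNReal.inv_ne_top.2 (by simp)
    -- the support condition
    obtain ⟨W, hW, hWU⟩ := compact_open_separated_add_right h.compact hUo h.support
    have e1 : ∀ᶠ e : ℝ × Vec d in 𝓝 0, P e ∈ W :=
      (hP.continuous.tendsto 0).eventually (by simpa using hW)
    have e2 : ∀ᶠ e : ℝ × Vec d in 𝓝 0, ∀ l, eLpNorm (fun z => u l (z - P e) - u l z) 2 ≤ τ :=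
      eventually_all.2 fun l => (tendsto_eLpNorm_increment hP (by norm_num) (by norm_num)
        (hu.memLp_two l)).eventually (ge_mem_nhds hτ0)
    obtain ⟨r, hr, hrb⟩ := Metric.nhds_basis_closedBall.eventually_iff.1 (e1.and e2)
    have e3 : ∀ᶠ h : Vec d in 𝓝 0, h ≠ 0 → ∀ l, ENNReal.ofReal ‖h‖⁻¹ *
        eLpNorm (fun z => u l (z - P (0, h)) - u l z) 3 (volume.restrict (tsupport ζ)) ^ 3 ≤ τ := by
      have := eventually_all.2 fun l => (hsmall l).eventually (ge_mem_nhds hτ0)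
      exact eventually_nhdsWithin_iff.1 this
    obtain ⟨r', hr', hrb'⟩ := Metric.nhds_basis_closedBall.eventually_iff.1 e3
    set ε := min r r' with hε
    have hε0 : 0 < ε := lt_min hr hr'
    -- Chosen so that `ε⁻¹ * D₁ ^ 3 = τ`, which is what the flux bound needs.
    set D₁ : ℝ≥0∞ := (τ * ENNReal.ofReal ε) ^ (3⁻¹ : ℝ) with hD₁
    have hD₁3 : D₁ ^ 3 = τ * ENNReal.ofReal ε := by
      rw [hD₁, ← ENNReal.rpow_natCast, ← ENNReal.rpow_mul]; norm_num
    have hD₁0 : 0 < D₁ := ENNReal.rpow_pos (by positivity) (by finiteness)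
    have hx : ∀ h : Vec d, ‖h‖ ≤ ε → ∀ l,
        eLpNorm (fun z => u l (z - P (0, h)) - u l z) 3 (volume.restrict (tsupport ζ)) ≤ D₁ := by
      intro h hh l
      rcases eq_or_ne h 0 with rfl | hne
      · rw [show ((0 : ℝ), (0 : Vec d)) = 0 from rfl]; simp
      have h1 := hrb' (by simpa using hh.trans (min_le_right _ _)) hne l
      have hpos : 0 < ‖h‖ := norm_pos_iff.2 hne
      rw [ENNReal.ofReal_inv_of_pos hpos, ← ENNReal.div_eq_inv_mul,
        ENNReal.div_le_iff (by simpa using hne) (by simp)] at h1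
      have h2 := h1.trans (mul_le_mul_right (ENNReal.ofReal_le_ofReal hh) τ)
      rw [← hD₁3] at h2
      exact (ENNReal.pow_le_pow_left_iff (by norm_num)).1 h2
    -- The time scale is fixed only now, when `ε` and `D₁` are known, so qualitative continuity of
    -- translations in `L³` is enough.
    have e4 : ∀ᶠ e : ℝ × Vec d in 𝓝 0, ∀ l, eLpNorm (fun z => u l (z - P e) - u l z) 3 ≤ D₁ :=
      eventually_all.2 fun l => (tendsto_eLpNorm_increment hP (by norm_num) (by norm_num)
        (hu.memLp_three l)).eventually (ge_mem_nhds hD₁0)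
    obtain ⟨r'', hr'', hrb''⟩ := Metric.nhds_basis_closedBall.eventually_iff.1 e4
    set δ := min r r'' with hδ
    have hδ0 : 0 < δ := lt_min hr hr''
    obtain ⟨k, hk⟩ := hC δ ε hδ0 hε0
    have hin : ∀ e ∈ Metric.closedBall (0 : ℝ) δ ×ˢ Metric.closedBall (0 : Vec d) ε,
        e ∈ Metric.closedBall (0 : ℝ × Vec d) r := by
      rintro ⟨s, y⟩ ⟨h1, h2⟩
      simp only [Metric.mem_closedBall, dist_zero_right, Prod.norm_def] at h1 h2 ⊢
      exact max_le (h1.trans (min_le_left _ _)) (h2.trans (min_le_left _ _))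
    have hsub : tsupport ζ + P '' tsupport k ⊆ U := by
      refine (add_subset_add_left ?_).trans hWU
      rintro _ ⟨e, he, rfl⟩
      exact (hrb (hin e (hk.support he))).1
    have hD : ∀ e ∈ Metric.closedBall (0 : ℝ) δ ×ˢ Metric.closedBall (0 : Vec d) ε, ∀ l,
        eLpNorm (fun z => u l (z - P e) - u l z) 3 (volume.restrict (tsupport ζ)) ≤ 2 * D₁ := by
      rintro ⟨s, y⟩ ⟨h1, h2⟩ l
      have hm := hu.measurable l
      -- The time increment is based at the shifted point, which may lie outside the support of `ζ`,
      -- and is therefore bounded over all of space-time. The space increment stays based at `z`,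
      -- where the localized hypothesis applies.
      have hsplit : (fun z => u l (z - P (s, y)) - u l z) =
          (fun z => (fun z => u l (z - P (s, 0)) - u l z) (z - P (0, y))) +
            fun z => u l (z - P (0, y)) - u l z := by
        ext z
        have : z - P (0, y) - P (s, 0) = z - P (s, y) := by
          rw [sub_sub, ← map_add]; simp
        simp [this]
      have hm1 : Measurable (fun z => u l (z - P (s, 0)) - u l z) :=
        (hm.comp (measurable_id.sub_const _)).sub hm
      have hm2 : Measurable (fun z => u l (z - P (0, y)) - u l z) :=
        (hm.comp (measurable_id.sub_const _)).sub hm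
      rw [hsplit, two_mul]
      refine (eLpNorm_add_le (hm1.comp (measurable_id.sub_const _)).aestronglyMeasurable
        hm2.aestronglyMeasurable (by norm_num)).trans (add_le_add ?_ (hx y (by simpa using h2) l))
      refine (eLpNorm_mono_measure _ Measure.restrict_le_self).trans ?_
      refine (eLpNorm_comp_measurePreserving hm1.aestronglyMeasurable
        (measurePreserving_sub_right volume (P (0, y)))).le.trans (hrb'' ?_ l)
      simp only [Metric.mem_closedBall, dist_zero_right, Prod.norm_def] at h1 ⊢
      have h3 := h1.trans (min_le_right r r'')
      simpa [hr''.le] using h3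
    have hfin := hu.enorm_energy_le hP hk h hsub hN₂ hN hZ₀ hZ₁ hZ₂ hD
      (fun e he l => (hrb (hin e he)).2 l)
    refine hfin.trans ?_
    have hM : C * ENNReal.ofReal ε⁻¹ * (2 * D₁) ^ 3 = 8 * C * τ := by
      rw [mul_pow, hD₁3, ENNReal.ofReal_inv_of_pos hε0]
      have : (ENNReal.ofReal ε)⁻¹ * ENNReal.ofReal ε = 1 :=
        ENNReal.inv_mul_cancel (by simpa using hε0) (by simp)
      calc _ = (2 ^ 3) * C * τ * ((ENNReal.ofReal ε)⁻¹ * ENNReal.ofReal ε) := by ring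
        _ = _ := by rw [this]; norm_num
    rw [hM]
    calc _ ≤ A + 3 * d ^ 2 * (Z₁ * N ^ 3) + 2 * d ^ 2 * Z₀ * (8 * C * τ) +
          2 * d * (Z₂ * N₂) * τ := by
          gcongr
          exact hA _ _ k hk hsub
      _ = _ := by rw [hc]; ring
  have hlim : Tendsto (fun n : ℕ => A + 3 * d ^ 2 * (Z₁ * N ^ 3) + c * ((n + 1 : ℕ) : ℝ≥0∞)⁻¹)
      atTop (𝓝 (A + 3 * d ^ 2 * (Z₁ * N ^ 3) + c * 0)) :=
    tendsto_const_nhds.add (ENNReal.Tendsto.const_mul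
      (ENNReal.tendsto_inv_nat_nhds_zero.comp (tendsto_add_atTop_nat 1)) (Or.inr hct))
  rw [mul_zero, add_zero] at hlim
  exact ge_of_tendsto' hlim main

end SpaceTime

/-! ### An elliptic estimate on `ℝ^d` -/

section Elliptic

variable {d : ℕ}

/-- The `j`-th partial derivative of a function on `ℝ^d`. -/
def pd (j : Fin d) (f : Vec d → ℝ) (y : Vec d) : ℝ := fderiv ℝ f y (EuclideanSpace.single j 1)

/-- Averages of `g` at scale `s` with weight `ψ`. -/
def scaleAvg (ψ g : Vec d → ℝ) (s : ℝ) : ℝ := ∫ y, ψ y * g (s • y)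

/-- Smooth functions supported in the unit ball. -/
structure IsUnitBump (ψ : Vec d → ℝ) : Prop where
  smooth : ContDiff ℝ ∞ ψ
  support : tsupport ψ ⊆ Metric.closedBall 0 1

variable {ψ g m : Vec d → ℝ}

lemma contDiff_pd (hg : ContDiff ℝ ∞ g) (j : Fin d) : ContDiff ℝ ∞ (pd j g) :=
  (hg.fderiv_right (m := ∞) (by simp)).clm_apply contDiff_const

lemma IsUnitBump.compact (h : IsUnitBump ψ) : HasCompactSupport ψ :=
  (isCompact_closedBall _ _).of_isClosed_subset (isClosed_tsupport _) h.support

lemma isUnitBump_pd (h : IsUnitBump ψ) (j : Fin d) : IsUnitBump (pd j ψ) :=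
  ⟨contDiff_pd h.smooth j, (tsupport_fderiv_apply_subset ℝ _).trans h.support⟩

lemma IsUnitBump.integrable (h : IsUnitBump ψ) : Integrable ψ :=
  h.smooth.continuous.integrable_of_hasCompactSupport h.compact

lemma IsUnitBump.integrable_mul (h : IsUnitBump ψ) (hg : Continuous g) (s : ℝ) :
    Integrable (fun y => ψ y * g (s • y)) :=
  (h.smooth.continuous.mul (hg.comp (continuous_const_smul s))).integrable_of_hasCompactSupport
    h.compact.mul_right

lemma fderiv_eq_sum_pd (x y : Vec d) :
    fderiv ℝ g x y = ∑ j, y j * pd j g x := by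
  have hy : y = ∑ j, y j • EuclideanSpace.single j (1 : ℝ) := by
    ext i
    simp [Pi.single_apply]
  conv_lhs => rw [hy]
  simp [pd]

/-- Integration by parts: moving a derivative from `g` to the weight gains a factor `s⁻¹`. -/
lemma scaleAvg_pd (h : IsUnitBump ψ) (hg : ContDiff ℝ ∞ g) (j : Fin d) (s : ℝ) :
    s * scaleAvg ψ (pd j g) s = - scaleAvg (pd j ψ) g s := by
  have hgs : ContDiff ℝ ∞ fun y : Vec d => g (s • y) := hg.comp (contDiff_const_smul s)
  have hder : ∀ y, fderiv ℝ (fun y => g (s • y)) y (EuclideanSpace.single j 1) =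
      s * pd j g (s • y) := by
    intro y
    have h1 : HasFDerivAt (fun y : Vec d => g (s • y))
        ((fderiv ℝ g (s • y)).comp (s • ContinuousLinearMap.id ℝ (Vec d))) y :=
      ((hg.differentiable (by simp) _).hasFDerivAt).comp y ((hasFDerivAt_id y).const_smul s)
    rw [h1.fderiv]; simp [pd]
  have := integral_mul_fderiv_eq_neg_fderiv_mul_of_integrable (𝕜 := ℝ) (E := Vec d) (μ := (volume : Measure (Vec d)))
    (f := ψ) (g := fun y => g (s • y)) (v := EuclideanSpace.single j 1)
    ((isUnitBump_pd h j).integrable_mul hg.continuous s)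
    (((h.smooth.continuous.mul ((hgs.continuous_fderiv (by simp)).clm_apply
      continuous_const))).integrable_of_hasCompactSupport h.compact.mul_right)
    (h.integrable_mul hg.continuous s) (fun x _ => h.smooth.differentiable (by simp) x)
    (fun x _ => hgs.differentiable (by simp) x)
  simp_rw [hder] at this
  rw [scaleAvg, ← integral_const_mul, scaleAvg]
  simp only [pd] at this ⊢
  rw [← this]; congr 1; ext y; ring

lemma abs_scaleAvg_le (h : IsUnitBump ψ) {s B : ℝ} (hB : ∀ y : Vec d, ‖y‖ ≤ 1 → |g (s • y)| ≤ B) :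
    |scaleAvg ψ g s| ≤ (∫ y, |ψ y|) * B := by
  rw [scaleAvg, ← integral_mul_const, ← Real.norm_eq_abs]
  refine norm_integral_le_of_norm_le (h.integrable.abs.mul_const B) (Eventually.of_forall fun y => ?_)
  by_cases hy : y ∈ tsupport ψ
  · have := h.support hy
    rw [norm_mul]
    exact mul_le_mul_of_nonneg_left (hB y (by simpa using this)) (abs_nonneg _)
  · simp [image_eq_zero_of_notMem_tsupport hy]

lemma scaleAvg_sub_const (h : IsUnitBump ψ) (hg : Continuous g) (c s : ℝ) :
    scaleAvg ψ (fun y => g y - c) s = scaleAvg ψ g s - (∫ y, ψ y) * c := by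
  simp only [scaleAvg, mul_sub]
  rw [integral_sub (h.integrable_mul hg s) (h.integrable.mul_const c), integral_mul_const]

lemma IsUnitBump.integral_pd (h : IsUnitBump ψ) (j : Fin d) : ∫ y, pd j ψ y = 0 := by
  have := scaleAvg_pd h (contDiff_const (c := (1 : ℝ))) j 1
  simpa [scaleAvg, pd] using this

lemma scaleAvg_sum (h : IsUnitBump ψ) {ι : Type} {t : Finset ι} {f : ι → Vec d → ℝ}
    (hf : ∀ i, Continuous (f i)) (s : ℝ) :
    scaleAvg ψ (fun y => ∑ i ∈ t, f i y) s = ∑ i ∈ t, scaleAvg ψ (f i) s := by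
  simp only [scaleAvg, Finset.mul_sum]
  exact integral_finsetSum _ fun i _ => h.integrable_mul (hf i) s

lemma hasDerivAt_scaleAvg (h : IsUnitBump ψ) (hm : ContDiff ℝ ∞ m) (s : ℝ) :
    HasDerivAt (scaleAvg ψ m) (∫ y, ψ y * fderiv ℝ m (s • y) y) s := by
  have hF : Continuous fun q : ℝ × Vec d => ψ q.2 * fderiv ℝ m (q.1 • q.2) q.2 :=
    (h.smooth.continuous.comp continuous_snd).mul
      (((hm.continuous_fderiv (by simp)).comp (continuous_fst.smul continuous_snd)).clm_apply
        continuous_snd)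
  obtain ⟨C, hC⟩ := ((isCompact_closedBall s 1).prod
    (isCompact_closedBall (0 : Vec d) 1)).exists_bound_of_continuousOn hF.continuousOn
  refine (hasDerivAt_integral_of_dominated_loc_of_deriv_le (μ := (volume : Measure (Vec d)))
    (F := fun s y => ψ y * m (s • y)) (F' := fun s y => ψ y * fderiv ℝ m (s • y) y)
    (s := Metric.ball s 1) (bound := (Metric.closedBall (0 : Vec d) 1).indicator fun _ => C)
    (Metric.ball_mem_nhds s one_pos)
    (Eventually.of_forall fun t => (h.integrable_mul hm.continuous t).aestronglyMeasurable)
    (h.integrable_mul hm.continuous s) ?_ ?_ ?_ ?_).2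
  · exact (hF.comp (continuous_const.prodMk continuous_id)).aestronglyMeasurable
  · refine Eventually.of_forall fun y t ht => ?_
    by_cases hy : y ∈ Metric.closedBall (0 : Vec d) 1
    · simpa [hy] using hC (t, y) ⟨Metric.ball_subset_closedBall ht, hy⟩
    · simp [hy, image_eq_zero_of_notMem_tsupport fun h' => hy (h.support h')]
  · exact (integrable_indicator_iff measurableSet_closedBall).2
      (integrableOn_const measure_closedBall_lt_top.ne)
  · refine Eventually.of_forall fun y t _ => HasDerivAt.const_mul _ ?_
    have h1 : HasDerivAt (fun t : ℝ => t • y) y t := by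
      simpa using (hasDerivAt_id t).smul_const y
    exact (hm.differentiable (by simp) _).hasFDerivAt.comp_hasDerivAt t h1

/-- A radial mollifier `φ` with `y φ(y) = -∇Λ(y)`. -/
lemma exists_radial_mollifier (hd : 0 < d) : ∃ φ Λ : Vec d → ℝ, IsUnitBump φ ∧ IsUnitBump Λ ∧
    ∫ y, φ y = 1 ∧ ∀ y j, pd j Λ y = - (φ y * y j) := by
  set θ := Real.smoothTransition with hθ
  have hθs : ContDiff ℝ ∞ θ := Real.smoothTransition.contDiff
  have hθ' : ContDiff ℝ ∞ (deriv θ) := (contDiff_infty_iff_deriv.1 hθs).2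
  set ρ : Vec d → ℝ := fun y => 1 - ‖y‖ ^ 2 with hρ
  have hρs : ContDiff ℝ ∞ ρ := contDiff_const.sub (contDiff_norm_sq ℝ)
  -- The chain rule gives `∇ (θ (1 - |y|²)) = -2 θ' (1 - |y|²) y`, which dictates the choice of
  -- `φ₀`.
  set Λ₀ : Vec d → ℝ := fun y => θ (ρ y) with hΛ
  set φ₀ : Vec d → ℝ := fun y => 2 * deriv θ (ρ y) with hφ
  have hneg : ∀ t < 0, deriv θ t = 0 := by
    intro t ht
    have : θ =ᶠ[𝓝 t] fun _ => 0 := by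
      filter_upwards [Iio_mem_nhds ht] with x hx
      exact Real.smoothTransition.zero_of_nonpos (le_of_lt hx)
    rw [this.deriv_eq]; simp
  have hρneg : ∀ y, y ∉ Metric.closedBall (0 : Vec d) 1 → ρ y < 0 := by
    intro y hy
    simp only [Metric.mem_closedBall, dist_zero_right, not_le] at hy
    simp only [hρ]; nlinarith
  have hΛb : IsUnitBump Λ₀ := ⟨hθs.comp hρs, closure_minimal (fun y hy => by
    by_contra h
    exact hy (Real.smoothTransition.zero_of_nonpos (hρneg y h).le)) Metric.isClosed_closedBall⟩
  have hφb : IsUnitBump φ₀ := ⟨contDiff_const.mul (hθ'.comp hρs), closure_minimal (fun y hy => by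
    by_contra h
    exact hy (by simp [hφ, hneg _ (hρneg y h)])) Metric.isClosed_closedBall⟩
  have hpd : ∀ y j, pd j Λ₀ y = - (φ₀ y * y j) := by
    intro y j
    have h1 : HasFDerivAt ρ (-(2 • innerSL ℝ y)) y := by
      simpa using ((hasStrictFDerivAt_norm_sq y).hasFDerivAt.const_sub 1)
    have h2 := ((hθs.differentiable (by simp) (ρ y)).hasDerivAt).comp_hasFDerivAt y h1
    have h3 : fderiv ℝ Λ₀ y = _ := h2.fderiv
    rw [pd, h3]
    simp [EuclideanSpace.inner_single_right, hφ]
    ring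
  have hmono : Monotone θ := Real.smoothTransition.monotone
  have hnn : ∀ y, 0 ≤ φ₀ y := fun y => mul_nonneg zero_le_two hmono.deriv_nonneg
  have hpos : 0 < ∫ y, φ₀ y := by
    rw [lt_iff_le_and_ne]
    refine ⟨integral_nonneg hnn, fun h0 => ?_⟩
    have h1 := (integral_eq_zero_iff_of_nonneg hnn hφb.integrable).1 h0.symm
    have h2 : φ₀ = fun _ => (0 : ℝ) := (Continuous.ae_eq_iff_eq volume hφb.smooth.continuous continuous_const).1 h1
    -- If `φ₀` vanished identically then `Λ₀` would be constant, although it is `1` at the origin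
    -- and `0` at a unit vector.
    have h3 : ∀ y, fderiv ℝ Λ₀ y = 0 := by
      intro y; ext b
      rw [fderiv_eq_sum_pd]
      simp [hpd, h2]
    have h4 := is_const_of_fderiv_eq_zero (hΛb.smooth.differentiable (by simp)) h3 0
      (EuclideanSpace.single ⟨0, hd⟩ 1)
    simp [hΛ, hρ, hθ] at h4
  refine ⟨fun y => (∫ y, φ₀ y)⁻¹ * φ₀ y, fun y => (∫ y, φ₀ y)⁻¹ * Λ₀ y,
    ⟨contDiff_const.mul hφb.smooth, tsupport_mul_subset_right.trans hφb.support⟩,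
    ⟨contDiff_const.mul hΛb.smooth, tsupport_mul_subset_right.trans hΛb.support⟩, ?_, ?_⟩
  · rw [integral_const_mul, inv_mul_cancel₀ hpos.ne']
  · intro y j
    have := hpd y j
    simp only [pd] at this ⊢
    rw [fderiv_const_mul (hΛb.smooth.differentiable (by simp) y)]
    simp [this]; ring

set_option maxHeartbeats 1000000 in
/-- Pointwise bound for a solution of `Δm = ∂_j ∂_l n_{jl}` that vanishes at infinity. -/
theorem elliptic_estimate (hd : 0 < d) : ∃ C : ℝ, 0 ≤ C ∧ ∀ (m : Vec d → ℝ)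
    (n : Fin d → Fin d → Vec d → ℝ) (q : Fin d → Fin d → Fin d → Vec d → ℝ) (A B B' : ℝ),
    ContDiff ℝ ∞ m → (∀ j l, ContDiff ℝ ∞ (n j l)) → (∀ j l i, ContDiff ℝ ∞ (q j l i)) →
    Tendsto m (cocompact (Vec d)) (𝓝 0) →
    (∀ h, ∑ j, pd j (pd j m) h = ∑ j, ∑ l, pd j (pd l (n j l)) h) →
    (∀ j l h, n j l h = ∑ i, pd i (q j l i) h) →
    (∀ j l h, |n j l h - n j l 0| ≤ A * ‖h‖ ^ (1 / 3 : ℝ)) → (∀ j l h, |n j l h| ≤ B') →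
    (∀ j l i h, |q j l i h| ≤ B) → |m 0| ≤ C * (A + √(B * B')) := by
  obtain ⟨φ, Λ, hφ, hΛ, hφ1, hφΛ⟩ := exists_radial_mollifier hd
  obtain ⟨Θ, hΘ⟩ : ∃ Θ : Fin d → Fin d → Vec d → ℝ, ∀ j l, Θ j l = pd l (pd j Λ) :=
    ⟨fun j l => pd l (pd j Λ), fun _ _ => rfl⟩
  have hΘb : ∀ j l, IsUnitBump (Θ j l) := fun j l => hΘ j l ▸ isUnitBump_pd (isUnitBump_pd hΛ j) l
  obtain ⟨K₂, hK₂⟩ : ∃ K₂ : ℝ, K₂ = ∑ j, ∑ l, ∫ y, |Θ j l y| := ⟨_, rfl⟩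
  obtain ⟨K₃, hK₃⟩ : ∃ K₃ : ℝ, K₃ = ∑ j, ∑ l, ∑ i, ∫ y, |pd i (Θ j l) y| := ⟨_, rfl⟩
  have hK₂0 : 0 ≤ K₂ := hK₂ ▸ Finset.sum_nonneg fun j _ => Finset.sum_nonneg fun l _ =>
    integral_nonneg fun y => abs_nonneg (Θ j l y)
  have hK₃0 : 0 ≤ K₃ := hK₃ ▸ Finset.sum_nonneg fun j _ => Finset.sum_nonneg fun l _ =>
    Finset.sum_nonneg fun i _ => integral_nonneg fun y => abs_nonneg (pd i (Θ j l) y)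
  refine ⟨3 * K₂ + 2 * √(K₂ * K₃), by positivity, ?_⟩
  intro m n q A B B' hm hn hq hlim hΔ hnq hA hB' hB
  have : Nonempty (Fin d) := ⟨⟨0, hd⟩⟩
  obtain ⟨j₀⟩ := this
  have hA0 : 0 ≤ A := by
    have := (abs_nonneg _).trans (hA j₀ j₀ (EuclideanSpace.single j₀ 1))
    simpa using this
  have hB'0 : 0 ≤ B' := (abs_nonneg _).trans (hB' j₀ j₀ 0)
  have hB0 : 0 ≤ B := (abs_nonneg _).trans (hB j₀ j₀ j₀ 0)
  -- `I` connects `m 0` at scale `0` to the limit `0` at infinite scale, so `m 0` is controlled by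
  -- integrating its derivative `T`. The relation `φ y = -∇Λ` turns that derivative into an average
  -- of the Laplacian of `m`.
  set I : ℝ → ℝ := scaleAvg φ m with hI
  set T : ℝ → ℝ := fun s => s * scaleAvg Λ (fun y => ∑ j, pd j (pd j m) y) s with hT
  have hder : ∀ s, HasDerivAt I (T s) s := by
    intro s
    convert hasDerivAt_scaleAvg hφ hm s using 1
    have h1 : ∀ y, φ y * fderiv ℝ m (s • y) y = ∑ j, - (pd j Λ y * pd j m (s • y)) := by
      intro y
      rw [fderiv_eq_sum_pd, Finset.mul_sum]
      exact Finset.sum_congr rfl fun j _ => by rw [hφΛ]; ring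
    simp_rw [h1]
    have h2 : ∀ j : Fin d, Integrable fun y => - (pd j Λ y * pd j m (s • y)) := fun j =>
      ((isUnitBump_pd hΛ j).integrable_mul (contDiff_pd hm j).continuous s).neg
    rw [integral_finsetSum _ fun j _ => h2 j, hT]
    simp only
    rw [scaleAvg_sum hΛ fun j => (contDiff_pd (contDiff_pd hm j) j).continuous, Finset.mul_sum]
    refine Finset.sum_congr rfl fun j _ => ?_
    rw [integral_neg, scaleAvg_pd hΛ (contDiff_pd hm j)]; rfl
  -- Inserting the equation and integrating by parts twice moves both derivatives from `n` to `Λ`.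
  have hsT : ∀ s, s * T s = ∑ j, ∑ l, scaleAvg (Θ j l) (n j l) s := by
    intro s
    have h0 : (fun y => ∑ j, pd j (pd j m) y) = fun y => ∑ j, ∑ l, pd j (pd l (n j l)) y :=
      funext hΔ
    simp only [hT, h0]
    rw [scaleAvg_sum hΛ fun j => continuous_finsetSum _ fun l _ =>
      (contDiff_pd (contDiff_pd (hn j l) l) j).continuous, Finset.mul_sum, Finset.mul_sum]
    refine Finset.sum_congr rfl fun j _ => ?_
    rw [scaleAvg_sum hΛ fun l => (contDiff_pd (contDiff_pd (hn j l) l) j).continuous,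
      Finset.mul_sum, Finset.mul_sum]
    refine Finset.sum_congr rfl fun l _ => ?_
    rw [scaleAvg_pd hΛ (contDiff_pd (hn j l) l), mul_neg, scaleAvg_pd (isUnitBump_pd hΛ j) (hn j l),
      neg_neg, hΘ]
  -- The weight `Θ` has mean zero, so `n j l 0` may be subtracted and the Hölder bound used.
  have hnear : ∀ s, 0 ≤ s → |s * T s| ≤ K₂ * (A * s ^ (1 / 3 : ℝ)) := by
    intro s hs
    rw [hsT, hK₂, Finset.sum_mul]
    refine (Finset.abs_sum_le_sum_abs _ _).trans (Finset.sum_le_sum fun j _ => ?_)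
    rw [Finset.sum_mul]
    refine (Finset.abs_sum_le_sum_abs _ _).trans (Finset.sum_le_sum fun l _ => ?_)
    have h1 := scaleAvg_sub_const (hΘb j l) (hn j l).continuous (n j l 0) s
    have h2 : ∫ y, Θ j l y = 0 := by rw [hΘ]; exact (isUnitBump_pd hΛ j).integral_pd l
    rw [h2, zero_mul, sub_zero] at h1
    rw [← h1]
    refine abs_scaleAvg_le (hΘb j l) fun y hy => (hA j l _).trans ?_
    gcongr
    rw [norm_smul, Real.norm_of_nonneg hs]
    exact mul_le_of_le_one_right hs hy
  have hfar1 : ∀ s, |s * T s| ≤ K₂ * B' := by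
    intro s
    rw [hsT, hK₂, Finset.sum_mul]
    refine (Finset.abs_sum_le_sum_abs _ _).trans (Finset.sum_le_sum fun j _ => ?_)
    rw [Finset.sum_mul]
    refine (Finset.abs_sum_le_sum_abs _ _).trans (Finset.sum_le_sum fun l _ => ?_)
    exact abs_scaleAvg_le (hΘb j l) fun y hy => hB' j l _
  -- The divergence form of `n` permits a third integration by parts, which gains one more power of
  -- `s`.
  have hfar2 : ∀ s, |s * (s * T s)| ≤ K₃ * B := by
    intro s
    rw [hsT, hK₃, Finset.sum_mul, Finset.mul_sum]
    refine (Finset.abs_sum_le_sum_abs _ _).trans (Finset.sum_le_sum fun j _ => ?_)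
    rw [Finset.sum_mul, Finset.mul_sum]
    refine (Finset.abs_sum_le_sum_abs _ _).trans (Finset.sum_le_sum fun l _ => ?_)
    have h0 : n j l = fun y => ∑ i, pd i (q j l i) y := funext (hnq j l)
    rw [h0, scaleAvg_sum (hΘb j l) fun i => (contDiff_pd (hq j l i) i).continuous, Finset.sum_mul,
      Finset.mul_sum]
    refine (Finset.abs_sum_le_sum_abs _ _).trans (Finset.sum_le_sum fun i _ => ?_)
    rw [scaleAvg_pd (hΘb j l) (hq j l i), abs_neg]
    exact abs_scaleAvg_le (isUnitBump_pd (hΘb j l) i) fun y hy => hB j l i _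
  -- the part between scale zero and scale one
  have hone : |I 1 - I 0| ≤ 3 * (K₂ * A) := by
    have hJ : ∀ σ : ℝ, HasDerivAt (fun σ : ℝ => I (σ ^ 3)) (T (σ ^ 3) * (3 * σ ^ 2)) σ := fun σ => by
      have := (hder (σ ^ 3)).comp σ (hasDerivAt_pow 3 σ)
      simpa using! this
    -- With `s = σ³` the bound `|T s| ≤ K₂ A s^{-2/3}` becomes a constant bound on the derivative in
    -- `σ`, and the mean value inequality replaces `∫₀¹ s^{-2/3} ds = 3`.
    have := norm_image_sub_le_of_norm_deriv_le_segment_01' (C := 3 * (K₂ * A))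
      (fun σ _ => (hJ σ).hasDerivWithinAt) (fun σ hσ => ?_)
    · simpa using this
    rcases eq_or_lt_of_le hσ.1 with h0 | h0
    · rw [← h0]; simp; positivity
    · have h1 := hnear (σ ^ 3) (by positivity)
      have h2 : (σ ^ 3) ^ (1 / 3 : ℝ) = σ := by
        rw [← Real.rpow_natCast, ← Real.rpow_mul h0.le]; norm_num
      rw [h2, abs_mul, abs_of_pos (by positivity : 0 < σ ^ 3)] at h1
      rw [norm_mul, Real.norm_eq_abs, Real.norm_of_nonneg (by positivity)]
      have h3 : σ * (σ ^ 2 * |T (σ ^ 3)|) ≤ σ * (K₂ * A) := by nlinarith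
      have h4 := le_of_mul_le_mul_left h3 h0
      nlinarith
  -- the part beyond scale one
  have htwo : ∀ σ : ℝ, 0 < σ → σ ≤ 1 → |I 1 - I ((σ ^ 2)⁻¹)| ≤ 2 * √(K₂ * K₃) * √(B * B') := by
    intro σ hσ hσ1
    have hJ : ∀ x ∈ Icc σ 1, HasDerivWithinAt (fun x : ℝ => I ((x ^ 2)⁻¹))
        (T ((x ^ 2)⁻¹) * (-(2 * x) / (x ^ 2) ^ 2)) (Icc σ 1) x := fun x hx => by
      have hx0 : x ≠ 0 := (hσ.trans_le hx.1).ne'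
      have h2 : HasDerivAt (fun x : ℝ => (x ^ 2)⁻¹) (-(2 * x) / (x ^ 2) ^ 2) x := by
        have := (hasDerivAt_pow 2 x).inv (by positivity)
        simpa using! this
      exact ((hder ((x ^ 2)⁻¹)).comp x h2).hasDerivWithinAt
    -- With `s = x⁻²` the bound `|T s| ≤ c s^{-3/2}` becomes the constant bound `2c`, in agreement
    -- with `∫₁^∞ s^{-3/2} ds = 2`.
    have hb : ∀ x ∈ Ico σ 1, ‖T ((x ^ 2)⁻¹) * (-(2 * x) / (x ^ 2) ^ 2)‖ ≤
        2 * √(K₂ * K₃) * √(B * B') := by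
      intro x hx
      have hx0 : 0 < x := hσ.trans_le hx.1
      have h1 := hfar1 ((x ^ 2)⁻¹)
      have h2 := hfar2 ((x ^ 2)⁻¹)
      set t := |T ((x ^ 2)⁻¹)| with ht
      have ht0 : 0 ≤ t := abs_nonneg _
      rw [abs_mul, abs_of_pos (by positivity)] at h1
      rw [← mul_assoc, abs_mul, abs_of_pos (by positivity)] at h2
      -- The product of the two far bounds. The bound by `B'` alone is not integrable at infinity
      -- and the one by `B` alone lacks the factor that becomes small in the application; their
      -- geometric mean has both virtues.
      have h3 : (x⁻¹ ^ 3 * t) ^ 2 ≤ (K₂ * K₃) * (B * B') := by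
        calc (x⁻¹ ^ 3 * t) ^ 2 = ((x ^ 2)⁻¹ * t) * ((x ^ 2)⁻¹ * (x ^ 2)⁻¹ * t) := by
              field_simp
          _ ≤ (K₂ * B') * (K₃ * B) := mul_le_mul h1 h2 (by positivity) (by positivity)
          _ = _ := by ring
      have h4 : x⁻¹ ^ 3 * t ≤ √(K₂ * K₃) * √(B * B') := by
        rw [← Real.sqrt_mul (by positivity)]
        exact Real.le_sqrt_of_sq_le h3
      rw [norm_mul, norm_div, norm_neg, Real.norm_eq_abs, ← ht,
        Real.norm_of_nonneg (by positivity), Real.norm_of_nonneg (by positivity)]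
      calc t * (2 * x / (x ^ 2) ^ 2) = 2 * (x⁻¹ ^ 3 * t) := by field_simp
        _ ≤ _ := by linarith
    have := norm_image_sub_le_of_norm_deriv_le_segment' hJ hb 1 ⟨hσ1, le_rfl⟩
    simp only [one_pow, inv_one, Real.norm_eq_abs] at this
    refine this.trans (mul_le_of_le_one_right (by positivity) (by linarith))
  -- averages at large scales vanish
  have hI0 : I 0 = m 0 := by
    simp only [hI, scaleAvg, zero_smul]
    rw [integral_mul_const, hφ1, one_mul]
  have hMb : ∃ M, ∀ y, ‖m y‖ ≤ M := by
    have hz : ∀ᶠ y in cocompact (Vec d), ‖m y‖ ≤ 1 := by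
      have := hlim.norm.eventually (Iic_mem_nhds (b := ‖(0 : ℝ)‖) (a := 1) (by simp))
      exact this
    obtain ⟨S, hS, hSm⟩ := mem_cocompact.1 hz
    obtain ⟨M, hM⟩ := hS.exists_bound_of_continuousOn hm.continuous.continuousOn
    refine ⟨max M 1, fun y => ?_⟩
    by_cases hy : y ∈ S
    · exact (hM y hy).trans (le_max_left _ _)
    · exact (hSm hy : ‖m y‖ ≤ 1).trans (le_max_right _ _)
  have hIlim : Tendsto I atTop (𝓝 0) := by
    obtain ⟨M, hM⟩ := hMb
    have hnt : Nontrivial (Vec d) := ⟨0, EuclideanSpace.single j₀ 1, fun h => by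
      have := congrArg (fun v : Vec d => v j₀) h
      simp at this⟩
    have h1 : Tendsto I atTop (𝓝 (∫ _ : Vec d, (0 : ℝ))) := by
      refine tendsto_integral_filter_of_dominated_convergence (fun y => |φ y| * M)
        (Eventually.of_forall fun s => (hφ.integrable_mul hm.continuous s).aestronglyMeasurable)
        (Eventually.of_forall fun s => Eventually.of_forall fun y => ?_)
        (hφ.integrable.abs.mul_const M) ?_
      · rw [norm_mul]; exact mul_le_mul_of_nonneg_left (hM _) (abs_nonneg _)
      · have : ∀ᵐ y : Vec d, y ≠ 0 := by
          simp [ae_iff]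
        filter_upwards [this] with y hy
        have h2 : Tendsto (fun s : ℝ => s • y) atTop (cocompact (Vec d)) := by
          rw [← Metric.cobounded_eq_cocompact, ← tendsto_norm_atTop_iff_cobounded]
          simp_rw [norm_smul, Real.norm_eq_abs]
          exact tendsto_abs_atTop_atTop.atTop_mul_const (norm_pos_iff.2 hy)
        simpa using (hlim.comp h2).const_mul (φ y)
    simpa using h1
  have hthree : |I 1| ≤ 2 * √(K₂ * K₃) * √(B * B') := by
    have ht : Tendsto (fun k : ℕ => (((k + 1 : ℝ)⁻¹) ^ 2)⁻¹) atTop atTop := by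
      have h1 : Tendsto (fun k : ℕ => (k : ℝ) + 1) atTop atTop :=
        tendsto_natCast_atTop_atTop.atTop_add tendsto_const_nhds
      have := (tendsto_pow_atTop (two_ne_zero (α := ℕ))).comp h1
      refine this.congr fun k => ?_
      simp
    have h2 : Tendsto (fun k : ℕ => |I 1 - I ((((k + 1 : ℝ)⁻¹) ^ 2)⁻¹)|) atTop (𝓝 |I 1 - 0|) :=
      (tendsto_const_nhds.sub (hIlim.comp ht)).abs
    rw [sub_zero] at h2
    refine le_of_tendsto' h2 fun k => htwo _ (by positivity) ?_
    exact inv_le_one_of_one_le₀ (by linarith [k.cast_nonneg (α := ℝ)])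
  calc |m 0| = |I 1 - (I 1 - I 0)| := by rw [← hI0]; ring_nf
    _ ≤ |I 1| + |I 1 - I 0| := abs_sub _ _
    _ ≤ 2 * √(K₂ * K₃) * √(B * B') + 3 * (K₂ * A) := add_le_add hthree hone
    _ ≤ _ := by
      have : 0 ≤ √(K₂ * K₃) * A := by positivity
      have : 0 ≤ K₂ * √(B * B') := by positivity
      nlinarith

end Elliptic

/-! ### Eliminating the pressure on `ℝ^d` -/

section Euclidean

variable {d : ℕ}

/-- The covering homomorphism of `ℝ × ℝ^d`, the identity. -/
abbrev euclProj (d : ℕ) : ℝ × Vec d →+ ℝ × Vec d := timeProj (spaceProj d)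

lemma isCover_spaceProj (d : ℕ) : IsCover (spaceProj d) :=
  ⟨continuous_id, Function.surjective_id, IsOpenMap.id⟩

lemma isCover_euclProj (d : ℕ) : IsCover (euclProj d) := (isCover_spaceProj d).timeProj

lemma euclProj_eq (e : ℝ × Vec d) : euclProj d e = e := rfl

/-- The correlation of `q` with the spatial translates of `F`. -/
def corr (q F : ℝ × Vec d → ℝ) (h : Vec d) : ℝ := ∫ z, q z * F (z - (0, h))

variable {q F G : ℝ × Vec d → ℝ} {U : Set (ℝ × Vec d)}

/-- As a function of `h` the correlation is a mollification of `q` with the reflected kernel, so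
smoothness and derivatives are inherited from `mollify`. -/
lemma corr_eq_mollify (q F : ℝ × Vec d → ℝ) (h : Vec d) :
    corr q F h = mollify (euclProj d) (fun e => F (-e)) q (0, h) := by
  have := integral_sub_left_eq_self (fun z => q z * F (z - (0, h))) volume ((0, h) : ℝ × Vec d)
  rw [corr, ← this]
  simp only [mollify, euclProj_eq]
  congr 1; ext e
  rw [sub_sub_cancel_left, mul_comm]

lemma IsTestOn.contDiff (h : IsTestOn (euclProj d) U F) : ContDiff ℝ ∞ F := h.smooth

lemma IsTestOn.contDiff_neg (h : IsTestOn (euclProj d) U F) : ContDiff ℝ ∞ fun e => F (-e) :=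
  h.contDiff.comp (contDiff_id.neg)

lemma IsTestOn.compact_neg (h : IsTestOn (euclProj d) U F) :
    HasCompactSupport fun e => F (-e) :=
  h.compact.comp_homeomorph (Homeomorph.neg _)

lemma contDiff_corr (hm : Measurable q) (hq : LocallyIntegrable q)
    (h : IsTestOn (euclProj d) U F) : ContDiff ℝ ∞ (corr q F) := by
  have h1 : ContDiff ℝ ∞ (mollify (euclProj d) (fun e => F (-e)) q) :=
    smoothLift_mollify (isCover_euclProj d) hm hq h.contDiff_neg h.compact_neg
  have h2 : corr q F = fun y => mollify (euclProj d) (fun e => F (-e)) q (0, y) :=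
    funext fun y => corr_eq_mollify q F y
  rw [h2]
  exact h1.comp (contDiff_const.prodMk contDiff_id)

lemma pd_corr (hm : Measurable q) (hq : LocallyIntegrable q)
    (h : IsTestOn (euclProj d) U F) (j : Fin d) (y : Vec d) :
    pd j (corr q F) y = - corr q (dirDeriv (euclProj d) (spaceDir d j) F) y := by
  set M := mollify (euclProj d) (fun e => F (-e)) q with hM
  have h1 : ContDiff ℝ ∞ M :=
    smoothLift_mollify (isCover_euclProj d) hm hq h.contDiff_neg h.compact_neg
  have h2 : corr q F = fun y => M (0, y) := funext fun y => corr_eq_mollify q F y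
  have h3 : HasFDerivAt (fun y : Vec d => M (0, y))
      ((fderiv ℝ M (0, y)).comp (ContinuousLinearMap.inr ℝ ℝ (Vec d))) y :=
    (h1.differentiable (by simp) (0, y)).hasFDerivAt.comp y (hasFDerivAt_prodMk_right 0 y)
  have h4 : dirDeriv (euclProj d) (spaceDir d j) M (euclProj d (0, y)) =
      fderiv ℝ M (0, y) (spaceDir d j) :=
    SmoothLift.dirDeriv_apply (P := euclProj d) (φ := M) h1 _ (0, y)
  rw [pd, h2, h3.fderiv]
  change fderiv ℝ M (0, y) (spaceDir d j) = _
  rw [← h4, hM, dirDeriv_mollify (isCover_euclProj d) hm hq h.contDiff_neg h.compact_neg,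
    corr_eq_mollify, mollify, mollify, ← integral_neg]
  congr 1; ext e
  have h5 : HasFDerivAt (fun e => F (-e)) ((fderiv ℝ F (-e)).comp
      (-ContinuousLinearMap.id ℝ (ℝ × Vec d))) e :=
    (h.contDiff.differentiable (by simp) (-e)).hasFDerivAt.comp e (hasFDerivAt_id e).neg
  have h6 : dirDeriv (euclProj d) (spaceDir d j) F (euclProj d (-e)) =
      fderiv ℝ F (-e) (spaceDir d j) :=
    SmoothLift.dirDeriv_apply (P := euclProj d) (φ := F) h.contDiff _ (-e)
  rw [euclProj_eq] at h6
  rw [h5.fderiv, h6]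
  simp only [euclProj_eq, ContinuousLinearMap.comp_apply, neg_apply,
    ContinuousLinearMap.id_apply, map_neg, neg_mul]

lemma pd_neg (j : Fin d) (f : Vec d → ℝ) (y : Vec d) : pd j (fun y => - f y) y = - pd j f y := by
  simp [pd, fderiv_fun_neg]

lemma pd_pd_corr (hm : Measurable q) (hq : LocallyIntegrable q)
    (h : IsTestOn (euclProj d) U F) (i j : Fin d) (y : Vec d) :
    pd i (pd j (corr q F)) y = corr q (dirDeriv (euclProj d) (spaceDir d i)
      (dirDeriv (euclProj d) (spaceDir d j) F)) y := by
  have h1 : pd j (corr q F) = fun y => - corr q (dirDeriv (euclProj d) (spaceDir d j) F) y :=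
    funext fun y => pd_corr hm hq h j y
  rw [h1, pd_neg, pd_corr hm hq (h.dirDeriv (isCover_euclProj d) _), neg_neg]

lemma IsTestOn.translate (hU : ∀ z ∈ U, ∀ y : Vec d, z + (0, y) ∈ U)
    (h : IsTestOn (euclProj d) U F) (y : Vec d) :
    IsTestOn (euclProj d) U fun z => F (z - (0, y)) where
  smooth := h.contDiff.comp (contDiff_id.sub contDiff_const)
  compact := h.compact.comp_homeomorph (Homeomorph.subRight _)
  support := by
    have : tsupport (fun z => F (z - (0, y))) =
        (Homeomorph.subRight ((0, y) : ℝ × Vec d)) ⁻¹' tsupport F :=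
      tsupport_comp_eq_preimage F (Homeomorph.subRight ((0, y) : ℝ × Vec d))
    rw [this]
    intro z hz
    have := hU _ (h.support hz) y
    simpa using this

lemma integrable_corr (hq : LocallyIntegrable q) (h : IsTestOn (euclProj d) U F) (y : Vec d) :
    Integrable fun z => q z * F (z - (0, y)) :=
  integrable_mul_test (isCover_euclProj d) hq
    ((IsTestOn.mk h.smooth h.compact (subset_univ _)).translate (fun _ _ _ => mem_univ _) y)

lemma corr_sum {ι : Type} {s : Finset ι} {f : ι → ℝ × Vec d → ℝ} (hq : LocallyIntegrable q)
    (h : ∀ i, IsTestOn (euclProj d) U (f i)) (y : Vec d) :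
    corr q (fun z => ∑ i ∈ s, f i z) y = ∑ i ∈ s, corr q (f i) y := by
  simp only [corr, Finset.mul_sum]
  exact integral_finsetSum _ fun i _ => integrable_corr hq (h i) y

lemma corr_sub (hq : LocallyIntegrable q) (hF : IsTestOn (euclProj d) U F)
    (hG : IsTestOn (euclProj d) U G) (y : Vec d) :
    corr q (fun z => F z - G z) y = corr q F y - corr q G y := by
  simp only [corr, mul_sub]
  exact integral_sub (integrable_corr hq hF y) (integrable_corr hq hG y)

lemma IsTestOn.memLp (h : IsTestOn (euclProj d) U F) (p : ℝ≥0∞) : MemLp F p :=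
  h.contDiff.continuous.memLp_of_hasCompactSupport h.compact

lemma eLpNorm_translate (hF : Measurable F) (p : ℝ≥0∞) (y : Vec d) :
    eLpNorm (fun z => F (z - (0, y))) p = eLpNorm F p :=
  eLpNorm_comp_measurePreserving hF.aestronglyMeasurable
    (measurePreserving_sub_right volume ((0, y) : ℝ × Vec d))

lemma enorm_corr_le (hm : Measurable q) (hF : Measurable F) (p p' : ℝ≥0∞)
    [ENNReal.HolderTriple p p' 1] (y : Vec d) :
    ‖corr q F y‖ₑ ≤ eLpNorm q p * eLpNorm F p' := by
  rw [corr, ← eLpNorm_translate hF p' y]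
  exact enorm_integral_mul_le hm.aestronglyMeasurable
    (hF.comp (measurable_id.sub_const _)).aestronglyMeasurable p p'

lemma enorm_corr_sub_le (hm : Measurable q) (hq : LocallyIntegrable q)
    (h : IsTestOn (euclProj d) U F) (p p' : ℝ≥0∞)
    [ENNReal.HolderTriple p p' 1] (y : Vec d) :
    ‖corr q F y - corr q F 0‖ₑ ≤ eLpNorm q p * eLpNorm (fun z => F (z - (0, y)) - F z) p' := by
  have h0 := integrable_corr hq h 0
  have hF := h.contDiff.continuous.measurable
  have e0 : ((0 : ℝ), (0 : Vec d)) = 0 := rfl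
  simp only [e0, sub_zero] at h0
  rw [corr, corr, e0, ← integral_sub (integrable_corr hq h y) (by simpa using h0)]
  simp only [sub_zero, ← mul_sub]
  exact enorm_integral_mul_le hm.aestronglyMeasurable
    ((hF.comp (measurable_id.sub_const _)).sub hF).aestronglyMeasurable p p'

/-- For compactly supported `q` the correlation vanishes at large `y`. The general case follows by
density in `L^p` and Hölder's inequality, which is uniform in `y`. -/
lemma tendsto_corr (hm : Measurable q) {p p' : ℝ≥0∞} [ENNReal.HolderTriple p p' 1] (hp1 : 1 ≤ p)
    (hp : p ≠ ⊤) (hq : MemLp q p) (h : IsTestOn (euclProj d) U F) :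
    Tendsto (corr q F) (cocompact (Vec d)) (𝓝 0) := by
  have hF := h.contDiff.continuous.measurable
  rw [Metric.tendsto_nhds]
  intro ε hε
  obtain ⟨δ, hδ, hδε⟩ := ENNReal.exists_nnreal_pos_mul_lt (h.memLp p').2.ne
    (ENNReal.ofReal_pos.2 hε).ne'
  obtain ⟨q', hc, hqq', hcont, hmem⟩ := hq.exists_hasCompactSupport_eLpNorm_sub_le hp
    (ENNReal.coe_pos.2 hδ).ne'
  have hK : IsCompact ((fun p : (ℝ × Vec d) × (ℝ × Vec d) => (p.1 - p.2).2) ''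
      (tsupport q' ×ˢ tsupport F)) :=
    (hc.isCompact.prod h.compact.isCompact).image (by fun_prop)
  filter_upwards [hK.compl_mem_cocompact] with y hy
  have h1 : corr q' F y = 0 := by
    refine integral_eq_zero_of_ae (Eventually.of_forall fun z => ?_)
    by_contra hne
    exact hy ⟨(z, z - (0, y)), ⟨subset_tsupport _ (left_ne_zero_of_mul hne),
      subset_tsupport _ (right_ne_zero_of_mul hne)⟩, by simp⟩
  have h2 : corr q F y = corr (q - q') F y := by
    rw [← sub_zero (corr q F y), ← h1, corr, corr, ← integral_sub
      (integrable_corr (hq.locallyIntegrable hp1) h y)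
      (integrable_corr hcont.locallyIntegrable h y)]
    simp only [corr, Pi.sub_apply, sub_mul]
  have h3 : ‖corr q F y‖ₑ < ENNReal.ofReal ε := by
    rw [h2]
    refine (enorm_corr_le (hm.sub hcont.measurable) hF p p' y).trans_lt (lt_of_le_of_lt ?_ hδε)
    gcongr
  rw [dist_zero_right]
  rw [← ofReal_norm] at h3
  exact (ENNReal.ofReal_lt_ofReal_iff hε).1 h3

lemma eulerForm_translate {u Ψ : Fin d → ℝ × Vec d → ℝ} (hu : ∀ l, LocallyIntegrable (u l))
    (huu : ∀ j l, LocallyIntegrable fun z => u j z * u l z)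
    (hΨ : ∀ l, IsTestOn (euclProj d) U (Ψ l)) (y : Vec d) :
    eulerForm (euclProj d) (timeDir d) (spaceDir d) u (fun l z => Ψ l (z - (0, y))) =
      ∑ l, (corr (u l) (dirDeriv (euclProj d) (timeDir d) (Ψ l)) y +
        ∑ j, corr (fun z => u j z * u l z) (dirDeriv (euclProj d) (spaceDir d j) (Ψ l)) y) := by
  have hD : ∀ a l z, dirDeriv (euclProj d) a (fun z => Ψ l (z - (0, y))) z =
      dirDeriv (euclProj d) a (Ψ l) (z - (0, y)) := fun a l z =>
    dirDeriv_translate (P := euclProj d) (φ := Ψ l) (0, y) a z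
  have i1 : ∀ l, Integrable fun z => u l z * dirDeriv (euclProj d) (timeDir d) (Ψ l) (z - (0, y)) :=
    fun l => integrable_corr (hu l) ((hΨ l).dirDeriv (isCover_euclProj d) _) y
  have i2 : ∀ l j, Integrable fun z => u j z * u l z *
      dirDeriv (euclProj d) (spaceDir d j) (Ψ l) (z - (0, y)) :=
    fun l j => integrable_corr (huu j l) ((hΨ l).dirDeriv (isCover_euclProj d) _) y
  have i3 : ∀ l, Integrable fun z => ∑ j, u j z * u l z *
      dirDeriv (euclProj d) (spaceDir d j) (Ψ l) (z - (0, y)) := fun l =>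
    integrable_finsetSum _ fun j _ => i2 l j
  simp only [eulerForm, hD]
  rw [integral_finsetSum _ fun l _ => by exact (i1 l).add (i3 l)]
  refine Finset.sum_congr rfl fun l _ => ?_
  rw [integral_add (i1 l) (i3 l), integral_finsetSum _ fun j _ => i2 l j]
  rfl

lemma pd_sum_add {ι κ : Type} {s : Finset ι} {t : Finset κ} {a : ι → Vec d → ℝ}
    {b : ι → κ → Vec d → ℝ} (ha : ∀ l, ContDiff ℝ ∞ (a l)) (hb : ∀ l i, ContDiff ℝ ∞ (b l i))
    (j : Fin d) : pd j (fun y => ∑ l ∈ s, (a l y + ∑ i ∈ t, b l i y)) =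
      fun y => ∑ l ∈ s, (pd j (a l) y + ∑ i ∈ t, pd j (b l i) y) := by
  ext y
  have h1 : HasFDerivAt (fun y => ∑ l ∈ s, (a l y + ∑ i ∈ t, b l i y))
      (∑ l ∈ s, (fderiv ℝ (a l) y + ∑ i ∈ t, fderiv ℝ (b l i) y)) y :=
    HasFDerivAt.fun_sum fun l _ => ((ha l).differentiable (by simp) y).hasFDerivAt.add
      (HasFDerivAt.fun_sum fun i _ => ((hb l i).differentiable (by simp) y).hasFDerivAt)
  simp [pd, h1.fderiv]

section Laplacian

variable {u g : Fin d → ℝ × Vec d → ℝ}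

/-- The divergence of a field on space-time. -/
def divField (g : Fin d → ℝ × Vec d → ℝ) (z : ℝ × Vec d) : ℝ :=
  ∑ l, dirDeriv (euclProj d) (spaceDir d l) (g l) z

lemma isTestOn_divField (hg : ∀ l, IsTestOn (euclProj d) U (g l)) :
    IsTestOn (euclProj d) U (divField g) :=
  IsTestOn.sum fun l => (hg l).dirDeriv (isCover_euclProj d) _

/-- The Laplacian minus the gradient of the divergence. -/
def curlField (g : Fin d → ℝ × Vec d → ℝ) (l : Fin d) (z : ℝ × Vec d) : ℝ :=
  ∑ j, dirDeriv (euclProj d) (spaceDir d j) (dirDeriv (euclProj d) (spaceDir d j) (g l)) z -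
    dirDeriv (euclProj d) (spaceDir d l) (divField g) z

lemma isTestOn_curlField (hg : ∀ l, IsTestOn (euclProj d) U (g l)) (l : Fin d) :
    IsTestOn (euclProj d) U (curlField g l) := by
  have hP := isCover_euclProj d
  have h1 : IsTestOn (euclProj d) U fun z => ∑ j, dirDeriv (euclProj d) (spaceDir d j)
      (dirDeriv (euclProj d) (spaceDir d j) (g l)) z :=
    IsTestOn.sum fun j => ((hg l).dirDeriv hP _).dirDeriv hP _
  have h2 := (isTestOn_divField hg).dirDeriv hP (spaceDir d l)
  have h3 : tsupport (curlField g l) ⊆ _ := tsupport_sub _ _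
  exact ⟨h1.smooth.sub h2.smooth, h1.compact.sub h2.compact,
    h3.trans (union_subset h1.support h2.support)⟩

lemma dirDeriv_curlField (hg : ∀ l, IsTestOn (euclProj d) U (g l)) (l : Fin d) (a : ℝ × Vec d)
    (z : ℝ × Vec d) : dirDeriv (euclProj d) a (curlField g l) z =
      ∑ j, dirDeriv (euclProj d) (spaceDir d j) (dirDeriv (euclProj d) (spaceDir d j)
        (dirDeriv (euclProj d) a (g l))) z -
      dirDeriv (euclProj d) (spaceDir d l) (dirDeriv (euclProj d) a (divField g)) z := by
  have hP := isCover_euclProj d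
  have h1 : ∀ j, SmoothLift (euclProj d) (dirDeriv (euclProj d) (spaceDir d j)
      (dirDeriv (euclProj d) (spaceDir d j) (g l))) := fun j =>
    (((hg l).dirDeriv hP _).dirDeriv hP _).smooth
  have h2 := ((isTestOn_divField hg).dirDeriv hP (spaceDir d l)).smooth
  have h3 : dirDeriv (euclProj d) a (curlField g l) z = _ :=
    dirDeriv_sub hP.surjective (SmoothLift.sum h1) h2 a z
  rw [h3, dirDeriv_sum hP.surjective h1,
    dirDeriv_comm (isTestOn_divField hg).smooth hP.surjective a (spaceDir d l)]
  congr 1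
  refine Finset.sum_congr rfl fun j _ => ?_
  rw [dirDeriv_comm ((hg l).dirDeriv hP _).smooth hP.surjective a (spaceDir d j)]
  congr 1
  ext z
  exact dirDeriv_comm (hg l).smooth hP.surjective a (spaceDir d j) z

/-- The divergence of the Laplacian equals the Laplacian of the divergence, since partial
derivatives commute. -/
lemma div_curlField (hg : ∀ l, IsTestOn (euclProj d) U (g l)) (z : ℝ × Vec d) :
    ∑ l, dirDeriv (euclProj d) (spaceDir d l) (curlField g l) z = 0 := by
  have hP := isCover_euclProj d
  simp only [dirDeriv_curlField hg]
  rw [Finset.sum_sub_distrib, Finset.sum_comm, ← Finset.sum_sub_distrib]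
  refine Finset.sum_eq_zero fun j _ => ?_
  rw [sub_eq_zero]
  have h1 : dirDeriv (euclProj d) (spaceDir d j) (divField g) = fun z => ∑ l,
      dirDeriv (euclProj d) (spaceDir d j) (dirDeriv (euclProj d) (spaceDir d l) (g l)) z := by
    ext z
    exact dirDeriv_sum hP.surjective (fun l => ((hg l).dirDeriv hP _).smooth) _ z
  rw [h1, dirDeriv_sum hP.surjective fun l => (((hg l).dirDeriv hP _).dirDeriv hP _).smooth]

/-- The Poisson equation for the pressure. -/
lemma EulerCore.laplacian_eulerForm
    (hu : EulerCore (euclProj d) (timeDir d) (spaceDir d) U u)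
    (hU : ∀ z ∈ U, ∀ y : Vec d, z + (0, y) ∈ U) (hg : ∀ l, IsTestOn (euclProj d) U (g l))
    (y : Vec d) :
    ∑ j, pd j (pd j fun y => eulerForm (euclProj d) (timeDir d) (spaceDir d) u
        fun l z => g l (z - (0, y))) y =
      ∑ j, ∑ l, pd j (pd l (corr (fun z => u j z * u l z) (divField g))) y := by
  have hP := isCover_euclProj d
  have hl := hu.locallyIntegrable
  have hll := fun j l => (hu.integrable_mul j l).locallyIntegrable
  have hm := hu.measurable
  have hmm : ∀ j l, Measurable fun z => u j z * u l z := fun j l => (hm j).mul (hm l)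
  have hf := isTestOn_divField hg
  have hD := fun a l => (hg l).dirDeriv hP a
  have hDD := fun b a l => (hD a l).dirDeriv hP b
  have hDDD := fun c b a l => (hDD b a l).dirDeriv hP c
  -- the weak momentum equation for the divergence-free field
  have e1 : ∑ l, (corr (u l) (dirDeriv (euclProj d) (timeDir d) (curlField g l)) y +
      ∑ i, corr (fun z => u i z * u l z)
        (dirDeriv (euclProj d) (spaceDir d i) (curlField g l)) y) = 0 := by
    rw [← eulerForm_translate hl hll (isTestOn_curlField hg)]
    refine hu.momentum _ (fun l => (isTestOn_curlField hg l).translate hU y) fun z => ?_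
    have h1 : ∀ l, dirDeriv (euclProj d) (spaceDir d l) (fun z => curlField g l (z - (0, y))) z =
        dirDeriv (euclProj d) (spaceDir d l) (curlField g l) (z - (0, y)) := fun l =>
      dirDeriv_translate (P := euclProj d) (φ := curlField g l) (0, y) _ z
    simp_rw [h1]
    exact div_curlField hg _
  -- The time derivative of the gradient part of `curlField g` is again a gradient, which the weakly
  -- divergence-free velocity does not see. Only the quadratic terms leave a trace of the divergence
  -- of `g`.
  have e2 : ∑ l, corr (u l) (dirDeriv (euclProj d) (spaceDir d l)
      (dirDeriv (euclProj d) (timeDir d) (divField g))) y = 0 := by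
    rw [← hu.div_free _ ((hf.dirDeriv hP (timeDir d)).translate hU y), integral_finsetSum]
    · refine Finset.sum_congr rfl fun l _ => ?_
      rw [corr]
      congr 1; ext z; congr 1
      exact (dirDeriv_translate (P := euclProj d) (0, y) _ z).symm
    · exact fun l _ => integrable_mul_test hP (hl l)
        (((hf.dirDeriv hP (timeDir d)).translate hU y).dirDeriv hP _)
  have e3 : ∀ (q : ℝ × Vec d → ℝ) (hq : LocallyIntegrable q) a l,
      corr q (dirDeriv (euclProj d) a (curlField g l)) y =
      ∑ j, corr q (dirDeriv (euclProj d) (spaceDir d j) (dirDeriv (euclProj d) (spaceDir d j)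
        (dirDeriv (euclProj d) a (g l)))) y -
      corr q (dirDeriv (euclProj d) (spaceDir d l) (dirDeriv (euclProj d) a (divField g))) y := by
    intro q hq a l
    rw [funext (dirDeriv_curlField hg l a), corr_sub hq (IsTestOn.sum fun j => hDDD _ _ a l)
      ((hf.dirDeriv hP a).dirDeriv hP _), corr_sum hq fun j => hDDD _ _ a l]
  simp_rw [e3 _ (hl _), e3 _ (hll _ _)] at e1
  simp only [Finset.sum_sub_distrib, Finset.sum_add_distrib, e2, sub_zero] at e1
  -- the Laplacian of the left-hand side
  have e4 : ∀ j, pd j (pd j fun y => eulerForm (euclProj d) (timeDir d) (spaceDir d) u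
        fun l z => g l (z - (0, y))) y =
      ∑ l, (corr (u l) (dirDeriv (euclProj d) (spaceDir d j) (dirDeriv (euclProj d) (spaceDir d j)
        (dirDeriv (euclProj d) (timeDir d) (g l)))) y +
      ∑ i, corr (fun z => u i z * u l z) (dirDeriv (euclProj d) (spaceDir d j)
        (dirDeriv (euclProj d) (spaceDir d j) (dirDeriv (euclProj d) (spaceDir d i) (g l)))) y) := by
    intro j
    have h1 := fun l => contDiff_corr (hm l) (hl l) (hD (timeDir d) l)
    have h2 := fun l i => contDiff_corr (hmm i l) (hll i l) (hD (spaceDir d i) l)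
    rw [funext fun y => eulerForm_translate hl hll hg y, pd_sum_add h1 h2,
      pd_sum_add (fun l => contDiff_pd (h1 l) j) fun l i => contDiff_pd (h2 l i) j]
    simp only
    refine Finset.sum_congr rfl fun l _ => ?_
    rw [pd_pd_corr (hm l) (hl l) (hD _ l)]
    congr 1
    refine Finset.sum_congr rfl fun i _ => ?_
    exact pd_pd_corr (hmm i l) (hll i l) (hD _ l) j j y
  simp_rw [e4, fun j l => pd_pd_corr (hmm j l) (hll j l) hf j l y]
  simp only [Finset.sum_add_distrib]
  rw [add_sub_assoc', sub_eq_zero] at e1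
  -- The symmetry of `u j * u l` matches the order of derivatives produced by the gradient part with
  -- the one in the claim.
  have e5 : ∀ j l, (fun z => u j z * u l z) = fun z => u l z * u j z := fun j l =>
    funext fun z => mul_comm _ _
  conv_rhs => enter [2, j, 2, l]; rw [e5 j l]
  rw [← e1, Finset.sum_comm]
  congr 1
  rw [Finset.sum_comm]
  exact Finset.sum_congr rfl fun l _ => Finset.sum_comm

end Laplacian

lemma abs_le_of_enorm_le {x : ℝ} {c : ℝ≥0∞} {c' : ℝ} (hc : c ≤ ENNReal.ofReal c') (hc' : 0 ≤ c')
    (h : ‖x‖ₑ ≤ c) : |x| ≤ c' := by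
  have := h.trans hc
  rwa [← ofReal_norm, ENNReal.ofReal_le_ofReal_iff hc', Real.norm_eq_abs] at this

/-- A solution tested against a field that is not divergence-free. -/
theorem EulerCore.exists_abs_eulerForm_le (hd : 0 < d) : ∃ C : ℝ, 0 ≤ C ∧
    ∀ (U : Set (ℝ × Vec d)) (u g : Fin d → ℝ × Vec d → ℝ) (r s : ℝ≥0∞)
      [ENNReal.HolderTriple s r 1] (Q Q' G F F' : ℝ),
    EulerCore (euclProj d) (timeDir d) (spaceDir d) U u →
    (∀ z ∈ U, ∀ y : Vec d, z + (0, y) ∈ U) → (∀ l, IsTestOn (euclProj d) U (g l)) →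
    0 ≤ Q → 0 ≤ Q' → 0 ≤ G → 0 ≤ F → 0 ≤ F' →
    (∀ j l, eLpNorm (fun z => u j z * u l z) (3 / 2) ≤ ENNReal.ofReal Q) →
    (∀ j l, eLpNorm (fun z => u j z * u l z) s ≤ ENNReal.ofReal Q') →
    (∀ l, eLpNorm (g l) 3 ≤ ENNReal.ofReal G) → eLpNorm (divField g) 3 ≤ ENNReal.ofReal F →
    (∀ y : Vec d, eLpNorm (fun z => divField g (z - (0, y)) - divField g z) r ≤
      ENNReal.ofReal (F' * ‖y‖ ^ (1 / 3 : ℝ))) →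
    |eulerForm (euclProj d) (timeDir d) (spaceDir d) u g| ≤ C * (Q' * F' + √(Q * G * (Q * F))) := by
  obtain ⟨C, hC, hell⟩ := elliptic_estimate hd
  refine ⟨C, hC, ?_⟩
  intro U u g r s _ Q Q' G F F' hu hU hg hQ0 hQ'0 hG0 hF0 hF'0 hQ hQ' hG hF hF'
  have hP := isCover_euclProj d
  have hl := hu.locallyIntegrable
  have hll := fun j l => (hu.integrable_mul j l).locallyIntegrable
  have hm := hu.measurable
  have hmm : ∀ j l, Measurable fun z => u j z * u l z := fun j l => (hm j).mul (hm l)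
  have hf := isTestOn_divField hg
  have hD := fun a l => (hg l).dirDeriv hP a
  have hgm : ∀ l, Measurable (g l) := fun l => (hg l).contDiff.continuous.measurable
  have hfm := hf.contDiff.continuous.measurable
  -- Translating the test field turns one number into a function on `ℝ^d`, to which the elliptic
  -- estimate applies; its value at `0` is the number sought.
  set m : Vec d → ℝ := fun y => eulerForm (euclProj d) (timeDir d) (spaceDir d) u
    fun l z => g l (z - (0, y)) with hmdef
  have hm0 : m 0 = eulerForm (euclProj d) (timeDir d) (spaceDir d) u g := by
    have e0 : ((0 : ℝ), (0 : Vec d)) = 0 := rfl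
    simp only [hmdef, e0, sub_zero]
  have hmeq : m = fun y => ∑ l, (corr (u l) (dirDeriv (euclProj d) (timeDir d) (g l)) y +
      ∑ j, corr (fun z => u j z * u l z) (dirDeriv (euclProj d) (spaceDir d j) (g l)) y) :=
    funext fun y => eulerForm_translate hl hll hg y
  rw [← hm0]
  -- The roles are `A = Q' * F'`, `B = Q * G`, `B' = Q * F`. Only `F` and `F'` measure the
  -- divergence of the field; `G` measures the field itself.
  refine hell m (fun j l => corr (fun z => u j z * u l z) (divField g))
    (fun j l i y => - corr (fun z => u j z * u l z) (g i) y) (Q' * F') (Q * G) (Q * F)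
    ?_ ?_ ?_ ?_ ?_ ?_ ?_ ?_ ?_
  · rw [hmeq]
    exact ContDiff.sum fun l _ => (contDiff_corr (hm l) (hl l) (hD _ l)).add
      (ContDiff.sum fun j _ => contDiff_corr (hmm j l) (hll j l) (hD _ l))
  · exact fun j l => contDiff_corr (hmm j l) (hll j l) hf
  · exact fun j l i => (contDiff_corr (hmm j l) (hll j l) (hg i)).neg
  · rw [hmeq]
    -- Decay at infinity comes from `u l ∈ L²` and `u j * u l ∈ L¹`; it excludes a harmonic part of
    -- `m`.
    have h1 : ∀ l, Tendsto (corr (u l) (dirDeriv (euclProj d) (timeDir d) (g l)))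
        (cocompact (Vec d)) (𝓝 0) := fun l =>
      tendsto_corr (p := 2) (p' := 2) (hm l) (by norm_num) (by norm_num) (hu.memLp_two l) (hD _ l)
    have h2 : ∀ l j, Tendsto (corr (fun z => u j z * u l z)
        (dirDeriv (euclProj d) (spaceDir d j) (g l))) (cocompact (Vec d)) (𝓝 0) := fun l j =>
      tendsto_corr (p := 1) (p' := ⊤) (hmm j l) le_rfl (by norm_num)
        (memLp_one_iff_integrable.2 (hu.integrable_mul j l)) (hD _ l)
    have h3 := tendsto_finsetSum (Finset.univ : Finset (Fin d)) fun l _ =>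
      (h1 l).add (tendsto_finsetSum (Finset.univ : Finset (Fin d)) fun j _ => h2 l j)
    simpa using h3
  · exact hu.laplacian_eulerForm hU hg
  · intro j l y
    have h1 : ∀ i, pd i (fun y => - corr (fun z => u j z * u l z) (g i) y) y =
        corr (fun z => u j z * u l z) (dirDeriv (euclProj d) (spaceDir d i) (g i)) y := fun i => by
      rw [pd_neg, pd_corr (hmm j l) (hll j l) (hg i), neg_neg]
    simp_rw [h1]
    exact corr_sum (hll j l) (fun i => hD _ i) y
  · intro j l y
    refine abs_le_of_enorm_le ?_ (by positivity)
      (enorm_corr_sub_le (hmm j l) (hll j l) hf s r y)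
    rw [mul_assoc, ENNReal.ofReal_mul hQ'0]
    exact mul_le_mul' (hQ' j l) (hF' y)
  · intro j l y
    refine abs_le_of_enorm_le ?_ (by positivity) (enorm_corr_le (hmm j l) hfm (3 / 2) 3 y)
    rw [ENNReal.ofReal_mul hQ0]
    exact mul_le_mul' (hQ j l) hF
  · intro j l i y
    rw [abs_neg]
    refine abs_le_of_enorm_le ?_ (by positivity) (enorm_corr_le (hmm j l) (hgm i) (3 / 2) 3 y)
    rw [ENNReal.ofReal_mul hQ0]
    exact mul_le_mul' (hQ j l) (hG i)

end Euclidean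

/-! ### The pressure contribution for the mollified test field -/

section Euclidean

variable {d : ℕ}

lemma eLpNorm_bdd_mul_le {α : Type} [MeasurableSpace α] {μ : Measure α} {f g : α → ℝ} {c : ℝ}
    (hf : ∀ z, |f z| ≤ c) (p : ℝ≥0∞) :
    eLpNorm (fun z => f z * g z) p μ ≤ ENNReal.ofReal c * eLpNorm g p μ :=
  eLpNorm_le_mul_eLpNorm_of_ae_le_mul (Eventually.of_forall fun z => by
    rw [norm_mul]; exact mul_le_mul_of_nonneg_right (hf z) (norm_nonneg _)) p

lemma eLpNorm_sum_le_card {α : Type} [MeasurableSpace α] {μ : Measure α} {f : Fin d → α → ℝ}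
    {p : ℝ≥0∞} {c : ℝ} (hm : ∀ j, AEStronglyMeasurable (f j) μ) (hp : 1 ≤ p)
    (h : ∀ j, eLpNorm (f j) p μ ≤ ENNReal.ofReal c) :
    eLpNorm (fun z => ∑ j, f j z) p μ ≤ ENNReal.ofReal (d * c) := by
  have e : (fun z => ∑ j, f j z) = ∑ j, f j := by ext z; simp
  rw [e]
  refine (eLpNorm_sum_le (fun j _ => hm j) hp).trans ?_
  refine (Finset.sum_le_sum fun j _ => h j).trans ?_
  rw [ENNReal.ofReal_mul (Nat.cast_nonneg d)]
  simp

/-- The pressure contribution to the mollified energy balance. -/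
theorem EulerCore.exists_abs_eulerForm_mollify_le (hd : 0 < d) : ∃ C : ℝ, 0 ≤ C ∧
    ∀ (U : Set (ℝ × Vec d)) (u : Fin d → ℝ × Vec d → ℝ) (ζ : ℝ × Vec d → ℝ) (k : ℝ × Vec d → ℝ)
      (S : Set (ℝ × Vec d)) (M : ℝ≥0∞) (r s : ℝ≥0∞)
      [ENNReal.HolderTriple s r 1] (Q Q' N Nr H Z₀ Z : ℝ), 1 ≤ r →
    EulerCore (euclProj d) (timeDir d) (spaceDir d) U u →
    (∀ z ∈ U, ∀ y : Vec d, z + (0, y) ∈ U) → IsTestOn (euclProj d) U ζ →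
    IsMollifier (spaceDir d) S M k → tsupport ζ + euclProj d '' tsupport k ⊆ U →
    0 ≤ Q → 0 ≤ Q' → 0 ≤ N → 0 ≤ Nr → 0 ≤ H → 0 ≤ Z₀ → 0 ≤ Z →
    (∀ j l, eLpNorm (fun z => u j z * u l z) (3 / 2) ≤ ENNReal.ofReal Q) →
    (∀ j l, eLpNorm (fun z => u j z * u l z) s ≤ ENNReal.ofReal Q') →
    (∀ l, eLpNorm (u l) 3 ≤ ENNReal.ofReal N) → (∀ l, eLpNorm (u l) r ≤ ENNReal.ofReal Nr) →
    (∀ l, ∀ y : Vec d, eLpNorm (fun z => u l (z - (0, y)) - u l z) r ≤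
      ENNReal.ofReal (H * ‖y‖ ^ (1 / 3 : ℝ))) →
    (∀ z, |ζ z| ≤ Z₀) → (∀ j z, |dirDeriv (euclProj d) (spaceDir d j) ζ z| ≤ Z) →
    (∀ j z, ∀ y : Vec d, |dirDeriv (euclProj d) (spaceDir d j) ζ (z - (0, y)) -
      dirDeriv (euclProj d) (spaceDir d j) ζ z| ≤ Z * ‖y‖ ^ (1 / 3 : ℝ)) →
    |eulerForm (euclProj d) (timeDir d) (spaceDir d) u
      fun l => mollify (euclProj d) k fun z => ζ z * mollify (euclProj d) k (u l) z| ≤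
      C * (Q' * (d * (Z * H + Z * Nr)) + √(Q * (Z₀ * N) * (Q * (d * (Z * N))))) := by
  obtain ⟨C, hC, hmain⟩ := EulerCore.exists_abs_eulerForm_le hd
  refine ⟨C, hC, ?_⟩
  intro U u ζ k S M r s _ Q Q' N Nr H Z₀ Z hr hu hU hζ hk hsub hQ0 hQ'0 hN0 hNr0 hH0 hZ₀0 hZ0
    hQ hQ' hN hNr hH hZ₀ hZ hZ'
  have hP := isCover_euclProj d
  set w : Fin d → ℝ × Vec d → ℝ := fun l => mollify (euclProj d) k (u l) with hw
  have hws := hu.smooth_mollify hP hk.toIsKernel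
  have hwc : ∀ l, Continuous (w l) := fun l => (hws l).continuous hP
  have hDζ := fun j => hζ.dirDeriv hP (spaceDir d j)
  have hDc : ∀ j, Continuous (dirDeriv (euclProj d) (spaceDir d j) ζ) := fun j =>
    (hDζ j).contDiff.continuous
  have hum := hu.measurable
  set φ : ℝ × Vec d → ℝ := fun z => ∑ j, dirDeriv (euclProj d) (spaceDir d j) ζ z * w j z with hφ
  have hφt : IsTestOn (euclProj d) U φ := IsTestOn.sum fun j => (hDζ j).mul_right (hws j)
  have hφc : Continuous φ := hφt.contDiff.continuous
  -- The divergence is the mollification of `∇ζ · w`, hence `F` and `F'` in the preceding estimate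
  -- are linear in the bound `Z` on the gradient of `ζ`.
  have hdiv : divField (fun l => mollify (euclProj d) k fun z => ζ z * w l z) =
      mollify (euclProj d) k φ := funext fun z => hu.div_field hP hk.toIsKernel hζ hsub z
  -- increments commute with mollification
  have hinc : ∀ f : ℝ × Vec d → ℝ, Measurable f → LocallyIntegrable f → ∀ y : Vec d,
      (fun z => mollify (euclProj d) k f (z - (0, y)) - mollify (euclProj d) k f z) =
        mollify (euclProj d) k fun z => f (z - (0, y)) - f z := by
    intro f hfm hf y
    ext z
    simp only [mollify, mul_sub]
    rw [integral_sub]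
    · congr 2
      ext e; congr 2; abel
    · have := integrable_kernel_mul hP hfm hf hk.smooth.continuous hk.compact (z - (0, y))
      refine this.congr (Eventually.of_forall fun e => ?_)
      simp only
      congr 2; abel
    · exact integrable_kernel_mul hP hfm hf hk.smooth.continuous hk.compact z
  refine hmain U u _ r s Q Q' (Z₀ * N) (d * (Z * N)) (d * (Z * H + Z * Nr)) hu hU
    (hu.isTestOn_mollify_field hP hk.toIsKernel hζ hsub) hQ0 hQ'0 (by positivity) (by positivity)
    (by positivity) hQ hQ' (fun l => ?_) ?_ fun y => ?_
  · refine (hk.eLpNorm_le hP (hζ.contDiff.continuous.mul (hwc l)).measurable (by norm_num)).trans ?_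
    refine (eLpNorm_bdd_mul_le hZ₀ 3).trans ?_
    rw [ENNReal.ofReal_mul hZ₀0]
    gcongr
    exact (hk.eLpNorm_le hP (hum l) (by norm_num)).trans (hN l)
  · rw [hdiv]
    refine (hk.eLpNorm_le hP hφc.measurable (by norm_num)).trans ?_
    refine eLpNorm_sum_le_card (fun j => ((hDc j).mul (hwc j)).aestronglyMeasurable) (by norm_num)
      fun j => (eLpNorm_bdd_mul_le (hZ j) 3).trans ?_
    rw [ENNReal.ofReal_mul hZ0]
    gcongr
    exact (hk.eLpNorm_le hP (hum j) (by norm_num)).trans (hN j)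
  · rw [hdiv, hinc φ hφc.measurable hφc.locallyIntegrable y]
    have hsh : Continuous fun z : ℝ × Vec d => z - (0, y) := continuous_id.sub continuous_const
    refine (hk.eLpNorm_le (f := fun z => φ (z - (0, y)) - φ z) hP
      ((hφc.comp hsh).sub hφc).measurable hr).trans ?_
    -- Discrete product rule: the increment falls on `w`, controlled by `H`, or on the gradient of
    -- `ζ`, controlled by its Hölder bound.
    have e1 : (fun z => φ (z - (0, y)) - φ z) = fun z => ∑ j,
        (dirDeriv (euclProj d) (spaceDir d j) ζ (z - (0, y)) * (w j (z - (0, y)) - w j z) +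
          (dirDeriv (euclProj d) (spaceDir d j) ζ (z - (0, y)) -
            dirDeriv (euclProj d) (spaceDir d j) ζ z) * w j z) := by
      ext z
      simp only [hφ]
      rw [← Finset.sum_sub_distrib]
      exact Finset.sum_congr rfl fun j _ => by ring
    rw [e1, mul_assoc]
    refine eLpNorm_sum_le_card (fun j => ?_) hr fun j => ?_
    · exact (((hDc j).comp hsh).mul (((hwc j).comp hsh).sub (hwc j))).aestronglyMeasurable.add
        ((((hDc j).comp hsh).sub (hDc j)).mul (hwc j)).aestronglyMeasurable
    refine (eLpNorm_add_le (((hDc j).comp hsh).mul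
      (((hwc j).comp hsh).sub (hwc j))).aestronglyMeasurable
      ((((hDc j).comp hsh).sub (hDc j)).mul (hwc j)).aestronglyMeasurable hr).trans ?_
    have hy0 : 0 ≤ ‖y‖ ^ (1 / 3 : ℝ) := by positivity
    have e2 : (Z * H + Z * Nr) * ‖y‖ ^ (1 / 3 : ℝ) =
        Z * (H * ‖y‖ ^ (1 / 3 : ℝ)) + Z * ‖y‖ ^ (1 / 3 : ℝ) * Nr := by ring
    rw [e2, ENNReal.ofReal_add (by positivity) (by positivity)]
    refine add_le_add ?_ ?_
    · refine (eLpNorm_bdd_mul_le (fun z => hZ j _) r).trans ?_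
      rw [ENNReal.ofReal_mul hZ0]
      gcongr
      have e3 : (w j ∘ fun z => z - (0, y)) - w j =
          mollify (euclProj d) k fun z => u j (z - (0, y)) - u j z :=
        hinc (u j) (hum j) (hu.locallyIntegrable j) y
      rw [e3]
      refine (hk.eLpNorm_le hP ?_ hr).trans (hH j y)
      exact ((hum j).comp (measurable_id.sub_const _)).sub (hum j)
    · refine (eLpNorm_bdd_mul_le (fun z => hZ' j z y) r).trans ?_
      have e4 : ENNReal.ofReal (Z * ‖y‖ ^ (1 / 3 : ℝ) * Nr) =
          ENNReal.ofReal (Z * ‖y‖ ^ (1 / 3 : ℝ)) * ENNReal.ofReal Nr :=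
        ENNReal.ofReal_mul (by positivity)
      rw [e4]
      exact mul_le_mul' le_rfl ((hk.eLpNorm_le hP (hum j) hr).trans (hNr j))

end Euclidean

/-! ### Conservation of energy -/

section Cutoff

variable {d : ℕ} {η : ℝ → ℝ} {I : Set ℝ}

lemma dirDeriv_timeDir_mul {X : Type} [AddCommGroup X] (π : Vec d →+ X) (η : ℝ → ℝ) (χ : X → ℝ)
    (z : ℝ × X) : dirDeriv (timeProj π) (timeDir d) (fun z => η z.1 * χ z.2) z =
      deriv η z.1 * χ z.2 := by
  change deriv (fun s : ℝ => η (z.1 + s * 1) * χ (z.2 + π (s • 0))) 0 = _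
  simp only [smul_zero, map_zero, add_zero, mul_one]
  rw [deriv_mul_const_field, deriv_comp_const_add, add_zero]

lemma dirDeriv_spaceDir_mul {X : Type} [AddCommGroup X] (π : Vec d →+ X) (η : ℝ → ℝ) (χ : X → ℝ)
    (j : Fin d) (z : ℝ × X) :
    dirDeriv (timeProj π) (spaceDir d j) (fun z => η z.1 * χ z.2) z =
      η z.1 * dirDeriv π (EuclideanSpace.single j 1) χ z.2 := by
  change deriv (fun s : ℝ => η (z.1 + s * 0) * χ (z.2 + π (s • EuclideanSpace.single j 1))) 0 = _
  simp only [mul_zero, add_zero]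
  rw [deriv_const_mul_field]
  rfl

lemma dirDeriv_spaceProj {χ : Vec d → ℝ} (hχ : ContDiff ℝ ∞ χ) (j : Fin d) (x : Vec d) :
    dirDeriv (spaceProj d) (EuclideanSpace.single j 1) χ x = pd j χ x :=
  SmoothLift.dirDeriv_apply (P := spaceProj d) (φ := χ) hχ _ x

lemma pd_comp_smul {χ : Vec d → ℝ} (hχ : ContDiff ℝ ∞ χ) (j : Fin d) (c : ℝ) (x : Vec d) :
    pd j (fun x => χ (c • x)) x = c * pd j χ (c • x) := by
  have h1 : HasFDerivAt (fun y : Vec d => χ (c • y))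
      ((fderiv ℝ χ (c • x)).comp (c • ContinuousLinearMap.id ℝ (Vec d))) x :=
    ((hχ.differentiable (by simp) _).hasFDerivAt).comp x ((hasFDerivAt_id x).const_smul c)
  rw [pd, h1.fderiv]; simp [pd]

/-- Smooth compactly supported functions are bounded and Hölder continuous. -/
lemma exists_bound_holder {f : Vec d → ℝ} (hf : ContDiff ℝ ∞ f) (hc : HasCompactSupport f) :
    ∃ K : ℝ, 0 ≤ K ∧ (∀ x, |f x| ≤ K) ∧ ∀ x y, |f x - f y| ≤ K * ‖x - y‖ ^ (1 / 3 : ℝ) := by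
  obtain ⟨B, hB⟩ := hc.exists_bound_of_continuous hf.continuous
  obtain ⟨L, hL⟩ := ContDiff.lipschitzWith_of_hasCompactSupport hc hf (n := ∞) (by simp)
  have hB0 : 0 ≤ B := (norm_nonneg _).trans (hB 0)
  refine ⟨2 * B + L, by positivity, fun x => (hB x).trans (by linarith [L.coe_nonneg]), ?_⟩
  intro x y
  have h1 : |f x - f y| ≤ L * ‖x - y‖ := by
    simpa [Real.dist_eq, dist_eq_norm] using hL.dist_le_mul x y
  have h2 : |f x - f y| ≤ 2 * B := by
    have := (abs_sub (f x) (f y)).trans (add_le_add (hB x) (hB y)); linarith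
  have hL0 := L.coe_nonneg
  -- The Lipschitz bound is used at distance at most `1` and the sup bound beyond.
  rcases le_total ‖x - y‖ 1 with h | h
  · have h3 : ‖x - y‖ ≤ ‖x - y‖ ^ (1 / 3 : ℝ) := by
      have := Real.rpow_le_rpow_of_exponent_ge' (norm_nonneg (x - y)) h
        (by norm_num : (0 : ℝ) ≤ 1 / 3) (by norm_num : (1 / 3 : ℝ) ≤ 1)
      simpa using this
    have h4 : 0 ≤ ‖x - y‖ ^ (1 / 3 : ℝ) := by positivity
    nlinarith
  · have h3 : 1 ≤ ‖x - y‖ ^ (1 / 3 : ℝ) := Real.one_le_rpow h (by norm_num)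
    nlinarith

lemma isTestOn_time_mul {X : Type} [AddCommGroup X] [TopologicalSpace X] {π : Vec d →+ X}
    (hη : ContDiff ℝ ∞ η) (hηc : HasCompactSupport η) (hηI : tsupport η ⊆ I) {χ : X → ℝ}
    (hχ : SmoothLift π χ) (hχc : HasCompactSupport χ) :
    IsTestOn (timeProj π) (spaceTime X I) fun z => η z.1 * χ z.2 := by
  have hsub : tsupport (fun z : ℝ × X => η z.1 * χ z.2) ⊆ tsupport η ×ˢ tsupport χ :=
    closure_minimal (fun z hz => ⟨subset_tsupport _ (left_ne_zero_of_mul hz),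
      subset_tsupport _ (right_ne_zero_of_mul hz)⟩)
      ((isClosed_tsupport _).prod (isClosed_tsupport _))
  refine ⟨?_, (hηc.isCompact.prod hχc.isCompact).of_isClosed_subset (isClosed_tsupport _) hsub,
    hsub.trans fun z hz => ⟨hηI hz.1, mem_univ _⟩⟩
  exact (hη.comp contDiff_fst).mul (ContDiff.comp (g := fun y => χ (π y)) hχ contDiff_snd)

/-- Dilations of one bump by `n + 1`. The gradient and its Hölder bound both gain `(n + 1)⁻¹`; the
additional factor `(n + 1)^{-1/3}` in the latter is discarded. -/
lemma exists_cutoff (d : ℕ) : ∃ (K : ℝ) (χ : ℕ → Vec d → ℝ), 0 ≤ K ∧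
    (∀ n, ContDiff ℝ ∞ (χ n)) ∧ (∀ n, HasCompactSupport (χ n)) ∧ (∀ n x, |χ n x| ≤ 1) ∧
    (∀ x, Tendsto (fun n => χ n x) atTop (𝓝 1)) ∧
    (∀ n j x, |pd j (χ n) x| ≤ (n + 1 : ℝ)⁻¹ * K) ∧
    ∀ n j x y, |pd j (χ n) x - pd j (χ n) y| ≤ (n + 1 : ℝ)⁻¹ * K * ‖x - y‖ ^ (1 / 3 : ℝ) := by
  let β : ContDiffBump (0 : Vec d) := ⟨1, 2, by norm_num, by norm_num⟩
  have hχ : ContDiff ℝ ∞ β := β.contDiff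
  have hχc : HasCompactSupport β := β.hasCompactSupport
  have hpdc : ∀ j, HasCompactSupport (pd j β) := fun j => hχc.fderiv_apply ℝ _
  choose K' hK'0 hK' hK'' using fun j => exists_bound_holder (contDiff_pd hχ j) (hpdc j)
  have hKj : ∀ j, K' j ≤ ∑ j, K' j := fun j =>
    Finset.single_le_sum (fun j _ => hK'0 j) (Finset.mem_univ j)
  have hc0 : ∀ n : ℕ, 0 < (n + 1 : ℝ)⁻¹ := fun n => by positivity
  have hc1 : ∀ n : ℕ, (n + 1 : ℝ)⁻¹ ≤ 1 := fun n =>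
    inv_le_one_of_one_le₀ (by linarith [n.cast_nonneg (α := ℝ)])
  have hpd : ∀ (n : ℕ) j x, pd j (fun x => β ((n + 1 : ℝ)⁻¹ • x)) x =
      (n + 1 : ℝ)⁻¹ * pd j β ((n + 1 : ℝ)⁻¹ • x) := fun n j x => pd_comp_smul hχ j _ x
  refine ⟨∑ j, K' j, fun n x => β ((n + 1 : ℝ)⁻¹ • x), Finset.sum_nonneg fun j _ => hK'0 j,
    fun n => hχ.comp (contDiff_const_smul _), fun n => hχc.comp_smul (hc0 n).ne', fun n x => ?_,
    fun x => ?_, fun n j x => ?_, fun n j x y => ?_⟩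
  · rw [abs_of_nonneg β.nonneg]; exact β.le_one
  · have hcn : Tendsto (fun n : ℕ => (n + 1 : ℝ)⁻¹) atTop (𝓝 0) := by
      simpa using tendsto_one_div_add_atTop_nhds_zero_nat (𝕜 := ℝ)
    have h1 : Tendsto (fun n : ℕ => β ((n + 1 : ℝ)⁻¹ • x)) atTop (𝓝 (β ((0 : ℝ) • x))) :=
      (hχ.continuous.tendsto _).comp (hcn.smul_const x)
    rwa [zero_smul, β.one_of_mem_closedBall (by simp [β])] at h1
  · rw [hpd, abs_mul, abs_of_pos (hc0 n)]
    exact mul_le_mul_of_nonneg_left ((hK' j _).trans (hKj j)) (hc0 n).le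
  · rw [hpd, hpd, ← mul_sub, abs_mul, abs_of_pos (hc0 n), mul_assoc]
    refine mul_le_mul_of_nonneg_left ((hK'' j _ _).trans ?_) (hc0 n).le
    refine mul_le_mul (hKj j) ?_ (by positivity) (Finset.sum_nonneg fun j _ => hK'0 j)
    refine Real.rpow_le_rpow (norm_nonneg _) ?_ (by norm_num)
    rw [← smul_sub, norm_smul, Real.norm_of_nonneg (hc0 n).le]
    exact mul_le_of_le_one_left (norm_nonneg _) (hc1 n)

lemma exists_le_ofReal (f : Fin d → ℝ≥0∞) (hf : ∀ l, f l ≠ ⊤) :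
    ∃ N : ℝ, 0 ≤ N ∧ ∀ l, f l ≤ ENNReal.ofReal N :=
  ⟨(∑ l, f l).toReal, ENNReal.toReal_nonneg, fun l => by
    rw [ENNReal.ofReal_toReal (ENNReal.sum_ne_top.2 fun l _ => hf l)]
    exact le_sum_univ f l⟩

lemma exists_le_ofReal₂ (f : Fin d → Fin d → ℝ≥0∞) (hf : ∀ j l, f j l ≠ ⊤) :
    ∃ N : ℝ, 0 ≤ N ∧ ∀ j l, f j l ≤ ENNReal.ofReal N := by
  obtain ⟨N, hN0, hN⟩ := exists_le_ofReal (fun j => ∑ l, f j l)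
    fun j => ENNReal.sum_ne_top.2 fun l _ => hf j l
  exact ⟨N, hN0, fun j l => (le_sum_univ (f j) l).trans (hN j)⟩

end Cutoff

section Periodic

variable {d : ℕ} {X : Type} [AddCommGroup X] [TopologicalSpace X] [IsTopologicalAddGroup X]
  [CompactSpace X] [T2Space X] [SecondCountableTopology X]
  [MeasureSpace X] [BorelSpace X] [(volume : Measure X).IsAddHaarMeasure]
  {π : Vec d →+ X} {I : Set ℝ} {u : Fin d → ℝ × X → ℝ} {η : ℝ → ℝ}

/-- The energy balance on a compact domain. -/
theorem EulerCore.integral_deriv_mul_eq_zero_of_compact (hπ : IsCover π) (hI : IsOpen I)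
    (hu : EulerCore (timeProj π) (timeDir d) (spaceDir d) (spaceTime X I) u)
    (hsmall : ∀ K ⊆ spaceTime X I, IsCompact K → ∀ l, Tendsto (fun h : Vec d =>
      ENNReal.ofReal ‖h‖⁻¹ * eLpNorm (fun z => u l (z - timeProj π (0, h)) - u l z) 3
        (volume.restrict K) ^ 3) (𝓝[≠] 0) (𝓝 0))
    (hη : ContDiff ℝ ∞ η) (hηc : HasCompactSupport η) (hηI : tsupport η ⊆ I) :
    ∫ z : ℝ × X, 2⁻¹ * deriv η z.1 * ∑ l, u l z ^ 2 = 0 := by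
  have hP : IsCover (timeProj π) := hπ.timeProj
  have hζ := isTestOn_time_mul (π := π) hη hηc hηI (χ := fun _ => (1 : ℝ)) (SmoothLift.const 1)
    (HasCompactSupport.of_compactSpace _)
  have hs : ∀ j z, dirDeriv (timeProj π) (spaceDir d j) (fun z => η z.1 * (1 : ℝ)) z = 0 := by
    intro j z
    rw [dirDeriv_spaceDir_mul π η (fun _ => 1)]
    simp [dirDeriv]
  have hN : ∀ l, eLpNorm (u l) 3 ≤ ∑ l, eLpNorm (u l) 3 := le_sum_univ _
  -- With `ζ` independent of `x` the gradient bound is `0`, and the test field is divergence-free,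
  -- so the weak equation makes its form vanish: `A = 0`.
  have := hu.enorm_energy_le_of_tendsto hπ (hI.prod isOpen_univ)
    (hsmall _ hζ.support hζ.compact) hζ hN (Z₁ := 0) (A := 0) (fun j z => by rw [hs]; simp)
    fun S M k hk hsub => by
      rw [hu.momentum _ (hu.isTestOn_mollify_field hP hk.toIsKernel hζ hsub) fun z => by
        rw [hu.div_field hP hk.toIsKernel hζ hsub]
        simp only [hs, zero_mul, Finset.sum_const_zero, mollify, mul_zero, integral_zero]]
      simp
  simp only [zero_mul, mul_zero, add_zero, nonpos_iff_eq_zero, enorm_eq_zero] at this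
  rw [← this]
  congr 1; ext z
  rw [dirDeriv_timeDir_mul π η (fun _ => 1), mul_one]

end Periodic

/-! ### The energy balance on the whole space by spatial cutoffs -/

section Euclidean

variable {d : ℕ} {I : Set ℝ} {u : Fin d → ℝ × Vec d → ℝ} {η : ℝ → ℝ}

/-- The energy balance on the whole space. -/
theorem EulerCore.integral_deriv_mul_eq_zero (hd : 0 < d) (hI : IsOpen I)
    (hu : EulerCore (euclProj d) (timeDir d) (spaceDir d) (spaceTime (Vec d) I) u)
    (hsmall : ∀ K ⊆ spaceTime (Vec d) I, IsCompact K → ∀ l, Tendsto (fun h : Vec d =>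
      ENNReal.ofReal ‖h‖⁻¹ * eLpNorm (fun z => u l (z - euclProj d (0, h)) - u l z) 3
        (volume.restrict K) ^ 3) (𝓝[≠] 0) (𝓝 0))
    {r s : ℝ≥0∞} [ENNReal.HolderTriple s r 1] (hr : 1 ≤ r) (hur : ∀ l, MemLp (u l) r)
    (huu : ∀ j l, MemLp (fun z => u j z * u l z) s) {H : ℝ} (hH0 : 0 ≤ H)
    (hH : ∀ l, ∀ y : Vec d, eLpNorm (fun z => u l (z - (0, y)) - u l z) r ≤
      ENNReal.ofReal (H * ‖y‖ ^ (1 / 3 : ℝ)))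
    (hη : ContDiff ℝ ∞ η) (hηc : HasCompactSupport η) (hηI : tsupport η ⊆ I) :
    ∫ z : ℝ × Vec d, 2⁻¹ * deriv η z.1 * ∑ l, u l z ^ 2 = 0 := by
  have hP := isCover_euclProj d
  obtain ⟨N, hN0, hN⟩ := exists_le_ofReal (fun l => eLpNorm (u l) 3 volume) fun l => (hu.memLp_three l).eLpNorm_ne_top
  obtain ⟨Nr, hNr0, hNr⟩ := exists_le_ofReal (fun l => eLpNorm (u l) r volume) fun l => (hur l).eLpNorm_ne_top
  obtain ⟨Q', hQ'0, hQ'⟩ := exists_le_ofReal₂ (fun j l => eLpNorm (fun z => u j z * u l z) s volume)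
    fun j l => (huu j l).eLpNorm_ne_top
  have hQt : ∀ j l, eLpNorm (fun z => u j z * u l z) (3 / 2) ≠ ⊤ := fun j l =>
    ((eLpNorm_mul_le (hu.measurable j).aestronglyMeasurable
      (hu.measurable l).aestronglyMeasurable 3 3 (3 / 2)).trans_lt
        (ENNReal.mul_lt_top (hu.memLp_three j).2 (hu.memLp_three l).2)).ne
  obtain ⟨Q, hQ0, hQ⟩ := exists_le_ofReal₂
    (fun j l => eLpNorm (fun z => u j z * u l z) (3 / 2) volume) hQt
  obtain ⟨C, hC, hpr⟩ := EulerCore.exists_abs_eulerForm_mollify_le hd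
  obtain ⟨E, hE⟩ := hηc.exists_bound_of_continuous hη.continuous
  have hE0 : 0 ≤ E := (norm_nonneg _).trans (hE 0)
  obtain ⟨K, χ, hK0, hχ, hχc, hχ1, hχlim, hχd, hχh⟩ := exists_cutoff d
  -- The total error as a function of the gradient bound `Z` of the cutoff: continuous, with value
  -- `0` at `Z = 0`.
  obtain ⟨b, hb⟩ : ∃ b : ℝ → ℝ, ∀ Z, b Z = C * (Q' * (d * (Z * H + Z * Nr)) +
      √(Q * (E * N) * (Q * (d * (Z * N))))) + 3 * d ^ 2 * (Z * N ^ 3) := ⟨_, fun _ => rfl⟩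
  obtain ⟨J, hJ⟩ : ∃ J : ℝ × Vec d → ℝ, ∀ z, J z = 2⁻¹ * deriv η z.1 * ∑ l, u l z ^ 2 :=
    ⟨_, fun _ => rfl⟩
  have main : ∀ n : ℕ, |∫ z, χ n z.2 * J z| ≤ b (E * ((n + 1 : ℝ)⁻¹ * K)) := by
    intro n
    obtain ⟨Z, hZ⟩ : ∃ Z : ℝ, Z = E * ((n + 1 : ℝ)⁻¹ * K) := ⟨_, rfl⟩
    have hZ0 : 0 ≤ Z := by rw [hZ]; positivity
    have hζ := isTestOn_time_mul (π := spaceProj d) hη hηc hηI (hχ n) (hχc n)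
    have hDs : ∀ j z, dirDeriv (euclProj d) (spaceDir d j) (fun z => η z.1 * χ n z.2) z =
        η z.1 * pd j (χ n) z.2 := fun j z => by
      rw [dirDeriv_spaceDir_mul (spaceProj d) η (χ n), dirDeriv_spaceProj (hχ n)]
    have hζ1 : ∀ z : ℝ × Vec d, |η z.1 * χ n z.2| ≤ E := fun z => by
      have := mul_le_mul (hE z.1) (hχ1 n z.2) (abs_nonneg _) hE0
      rw [abs_mul]
      simpa using this
    have hζ2 : ∀ j z, |dirDeriv (euclProj d) (spaceDir d j) (fun z => η z.1 * χ n z.2) z| ≤ Z := by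
      intro j z
      rw [hDs, abs_mul, hZ]
      exact mul_le_mul (hE _) (hχd n j _) (abs_nonneg _) hE0
    have hζ3 : ∀ j z, ∀ y : Vec d,
        |dirDeriv (euclProj d) (spaceDir d j) (fun z => η z.1 * χ n z.2) (z - (0, y)) -
          dirDeriv (euclProj d) (spaceDir d j) (fun z => η z.1 * χ n z.2) z| ≤
        Z * ‖y‖ ^ (1 / 3 : ℝ) := by
      intro j z y
      rw [hDs, hDs]
      simp only [Prod.fst_sub, Prod.snd_sub, sub_zero]
      have h1 := hχh n j (z.2 - y) z.2
      rw [sub_sub_cancel_left, norm_neg] at h1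
      rw [← mul_sub, abs_mul, hZ, mul_assoc]
      exact mul_le_mul (hE _) h1 (abs_nonneg _) hE0
    have hA : 0 ≤ C * (Q' * (d * (Z * H + Z * Nr)) + √(Q * (E * N) * (Q * (d * (Z * N))))) := by
      positivity
    have h1 := hu.enorm_energy_le_of_tendsto (isCover_spaceProj d) (hI.prod isOpen_univ)
      (hsmall _ hζ.support hζ.compact) hζ hN (Z₁ := ENNReal.ofReal Z)
      (A := ENNReal.ofReal (C * (Q' * (d * (Z * H + Z * Nr)) + √(Q * (E * N) * (Q * (d * (Z * N)))))))
      (fun j z => by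
        rw [← ofReal_norm]; exact ENNReal.ofReal_le_ofReal (hζ2 j z))
      fun S M k hk hsub => by
        rw [← ofReal_norm]
        exact ENNReal.ofReal_le_ofReal (hpr _ u _ k S M r s Q Q' N Nr H E Z hr hu
          (fun z hz y => ⟨by simpa using hz.1, mem_univ _⟩) hζ hk hsub hQ0 hQ'0 hN0 hNr0 hH0 hE0 hZ0
          hQ hQ' hN hNr hH hζ1 hζ2 hζ3)
    rw [← hZ, hb]
    have hB : 0 ≤ 3 * (d : ℝ) ^ 2 * (Z * N ^ 3) := by positivity
    refine abs_le_of_enorm_le (le_of_eq ?_) (add_nonneg hA hB) (le_trans (le_of_eq ?_) h1)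
    · rw [ENNReal.ofReal_add hA hB]
      congr 1
      rw [ENNReal.ofReal_mul (by positivity), ENNReal.ofReal_mul hZ0, ENNReal.ofReal_pow hN0,
        ENNReal.ofReal_mul (by norm_num), ENNReal.ofReal_pow (by positivity)]
      simp
    · congr 2; ext z
      rw [dirDeriv_timeDir_mul (spaceProj d) η (χ n), hJ]
      ring
  have hJi : Integrable J := by
    obtain ⟨E', hE'⟩ := hηc.deriv.exists_bound_of_continuous
      ((contDiff_infty_iff_deriv.1 hη).2.continuous)
    have h1 : Integrable fun z => ∑ l, u l z ^ 2 :=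
      integrable_finsetSum _ fun l _ => (hu.memLp_two l).integrable_sq
    have h2 : Continuous fun z : ℝ × Vec d => 2⁻¹ * deriv η z.1 :=
      continuous_const.mul ((contDiff_infty_iff_deriv.1 hη).2.continuous.comp continuous_fst)
    rw [funext hJ]
    refine h1.bdd_mul (c := 2⁻¹ * E') h2.aestronglyMeasurable (Eventually.of_forall fun z => ?_)
    rw [norm_mul]
    simpa using hE' z.1
  have hlim : Tendsto (fun n : ℕ => |∫ z, χ n z.2 * J z|) atTop (𝓝 |∫ z, J z|) := by
    refine (tendsto_integral_of_dominated_convergence (fun z => |J z|) (fun n => ?_) hJi.abs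
      (fun n => Eventually.of_forall fun z => ?_) (Eventually.of_forall fun z => ?_)).abs
    · exact ((hχ n).continuous.comp continuous_snd).aestronglyMeasurable.mul
        hJi.aestronglyMeasurable
    · rw [norm_mul]
      exact mul_le_of_le_one_left (abs_nonneg _) (hχ1 n _)
    · simpa using (hχlim z.2).mul_const (J z)
  have hblim : Tendsto (fun n : ℕ => b (E * ((n + 1 : ℝ)⁻¹ * K))) atTop (𝓝 0) := by
    have hbc : Continuous b := by rw [funext hb]; fun_prop
    have hcn : Tendsto (fun n : ℕ => E * ((n + 1 : ℝ)⁻¹ * K)) atTop (𝓝 0) := by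
      have := ((tendsto_one_div_add_atTop_nhds_zero_nat (𝕜 := ℝ)).mul_const K).const_mul E
      simpa using this
    have h1 := (hbc.tendsto 0).comp hcn
    have h2 : b 0 = 0 := by simp [hb]
    rw [h2] at h1
    exact h1
  have h3 := abs_nonpos_iff.1 (le_of_tendsto_of_tendsto' hlim hblim main)
  rwa [integral_congr_ae (Eventually.of_forall hJ)] at h3

end Euclidean

/-! ### Small increments away from the singular set -/

section Increments

variable {d : ℕ} {X : Type} [AddCommGroup X] [TopologicalSpace X] [IsTopologicalAddGroup X]
  [LocallyCompactSpace X] [T2Space X] [SecondCountableTopology X]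
  [MeasureSpace X] [BorelSpace X] [(volume : Measure X).IsAddHaarMeasure]
  {π : Vec d →+ X} {V : ℝ × X → Vec d} {s t : Set (ℝ × X)}

/-- The scaled cubic mean on `s` of the spatial increments of `V`. -/
def cubicIncrement (π : Vec d →+ X) (V : ℝ × X → Vec d) (s : Set (ℝ × X)) (h : Vec d) : ℝ≥0∞ :=
  ENNReal.ofReal ‖h‖⁻¹ *
    eLpNorm (fun z => V (z - timeProj π (0, h)) - V z) 3 (volume.restrict s) ^ 3

/-- The cubic increments on `s` vanish in the limit. -/
def SmallIncrements (π : Vec d →+ X) (V : ℝ × X → Vec d) (s : Set (ℝ × X)) : Prop :=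
  Tendsto (cubicIncrement π V s) (𝓝[≠] 0) (𝓝 0)

lemma eLpNorm_three_pow {α F : Type} [MeasurableSpace α] [ENorm F] (μ : Measure α)
    (f : α → F) : eLpNorm f 3 μ ^ 3 = ∫⁻ z, ‖f z‖ₑ ^ 3 ∂μ := by
  rw [eLpNorm_eq_lintegral_rpow_enorm_toReal (by norm_num) (by norm_num), ← ENNReal.rpow_natCast,
    ← ENNReal.rpow_mul]
  norm_num

lemma cubicIncrement_mono (hst : s ⊆ t) (h : Vec d) :
    cubicIncrement π V s h ≤ cubicIncrement π V t h := by
  unfold cubicIncrement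
  gcongr

lemma cubicIncrement_union_le (s t : Set (ℝ × X)) (h : Vec d) :
    cubicIncrement π V (s ∪ t) h ≤ cubicIncrement π V s h + cubicIncrement π V t h := by
  simp only [cubicIncrement, eLpNorm_three_pow]
  rw [← mul_add]
  gcongr
  rw [← lintegral_add_measure]
  exact lintegral_mono' (Measure.restrict_union_le s t) le_rfl

lemma SmallIncrements.mono (h : SmallIncrements π V t) (hst : s ⊆ t) : SmallIncrements π V s :=
  tendsto_of_tendsto_of_tendsto_of_le_of_le tendsto_const_nhds h (fun _ => zero_le)
    fun y => cubicIncrement_mono hst y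

lemma SmallIncrements.union (hs : SmallIncrements π V s) (ht : SmallIncrements π V t) :
    SmallIncrements π V (s ∪ t) := by
  have h1 : Tendsto (fun h => cubicIncrement π V s h + cubicIncrement π V t h) (𝓝[≠] 0) (𝓝 0) := by
    simpa using Tendsto.add hs ht
  exact tendsto_of_tendsto_of_tendsto_of_le_of_le tendsto_const_nhds h1 (fun _ => zero_le)
    fun y => cubicIncrement_union_le s t y

/-- The property passes to subsets and finite unions, so a local statement suffices on compact sets.
-/
lemma smallIncrements_of_isCompact {K : Set (ℝ × X)} (hK : IsCompact K)
    (h : ∀ q ∈ K, ∃ W ∈ 𝓝 q, SmallIncrements π V W) : SmallIncrements π V K := by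
  refine hK.induction_on (p := SmallIncrements π V) ?_ (fun s t hst ht => ht.mono hst)
    (fun s t hs ht => hs.union ht) fun q hq => ?_
  · have : cubicIncrement π V ∅ = fun _ => 0 := by ext h; simp [cubicIncrement]
    rw [SmallIncrements, this]
    exact tendsto_const_nhds
  · obtain ⟨W, hW, hWs⟩ := h q hq
    exact ⟨W, mem_nhdsWithin_of_mem_nhds hW, hWs⟩

/-- Hölder from `L^r` to `L³` on `U` costs `|U|^{1/3 - 1/r}`, and the cube of `‖h‖^{1/3}` cancels
`‖h‖⁻¹`. The bound is uniform in `h`. -/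
lemma cubicIncrement_le_of_eLpNorm_le (hV : Measurable V) {r : ℝ≥0∞} (hr : 3 ≤ r)
    {H : ℝ≥0∞} {h : Vec d} (hh : h ≠ 0)
    (hH : eLpNorm (fun z => V (z - timeProj π (0, h)) - V z) r ≤
      ENNReal.ofReal (‖h‖ ^ (1 / 3 : ℝ)) * H) (U : Set (ℝ × X)) :
    cubicIncrement π V U h ≤ H ^ 3 * volume U ^ (1 - 3 * (1 / r.toReal)) := by
  have hm : Measurable fun z => V (z - timeProj π (0, h)) - V z :=
    (hV.comp (measurable_id.sub_const _)).sub hV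
  have h1 := eLpNorm_le_eLpNorm_mul_rpow_measure_univ (μ := volume.restrict U) hr
    hm.aestronglyMeasurable
  have h2 := h1.trans (mul_le_mul_left ((eLpNorm_mono_measure _ Measure.restrict_le_self).trans hH) _)
  have hpos : 0 < ‖h‖ := norm_pos_iff.2 hh
  have h3 : ENNReal.ofReal ‖h‖⁻¹ * ENNReal.ofReal (‖h‖ ^ (1 / 3 : ℝ)) ^ 3 = 1 := by
    have e : (‖h‖ ^ (1 / 3 : ℝ)) ^ 3 = ‖h‖ := by
      rw [← Real.rpow_natCast, ← Real.rpow_mul hpos.le]; norm_num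
    rw [← ENNReal.ofReal_pow (by positivity), ← ENNReal.ofReal_mul (by positivity), e,
      inv_mul_cancel₀ hpos.ne', ENNReal.ofReal_one]
  have h4 : ((volume U) ^ (1 / (3 : ℝ≥0∞).toReal - 1 / r.toReal)) ^ 3 =
      volume U ^ (1 - 3 * (1 / r.toReal)) := by
    rw [← ENNReal.rpow_natCast, ← ENNReal.rpow_mul]
    congr 1
    norm_num
    ring
  calc cubicIncrement π V U h ≤ ENNReal.ofReal ‖h‖⁻¹ * (ENNReal.ofReal (‖h‖ ^ (1 / 3 : ℝ)) * H *
        (volume U) ^ (1 / (3 : ℝ≥0∞).toReal - 1 / r.toReal)) ^ 3 := by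
        unfold cubicIncrement
        gcongr
        simpa using h2
    _ = (ENNReal.ofReal ‖h‖⁻¹ * ENNReal.ofReal (‖h‖ ^ (1 / 3 : ℝ)) ^ 3) * (H ^ 3 *
        ((volume U) ^ (1 / (3 : ℝ≥0∞).toReal - 1 / r.toReal)) ^ 3) := by ring
    _ = _ := by rw [h3, h4, one_mul]

/-- If `V` is regular outside of a null set then its increments are small on compact sets. -/
theorem smallIncrements_of_null (hV : Measurable V) {r : ℝ≥0∞} (hr : 3 < r)
    {H : ℝ≥0∞} (hHt : H ≠ ⊤)
    (hH : ∀ h : Vec d, h ≠ 0 → eLpNorm (fun z => V (z - timeProj π (0, h)) - V z) r ≤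
      ENNReal.ofReal (‖h‖ ^ (1 / 3 : ℝ)) * H)
    {K S : Set (ℝ × X)} (hK : IsCompact K) (hS : volume S = 0)
    (hreg : ∀ q ∈ K, q ∉ S → ∃ W ∈ 𝓝 q, SmallIncrements π V W) : SmallIncrements π V K := by
  have hθ : 0 < 1 - 3 * (1 / r.toReal) := by
    rcases eq_or_ne r ⊤ with rfl | hrt
    · simp
    · have h3 : 3 < r.toReal := by
        have := (ENNReal.toReal_lt_toReal (by norm_num) hrt).2 hr
        simpa using this
      rw [mul_one_div, sub_pos, div_lt_one (by linarith)]
      exact h3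
  have hlim : Tendsto (fun x : ℝ≥0∞ => H ^ 3 * x ^ (1 - 3 * (1 / r.toReal))) (𝓝 0) (𝓝 0) := by
    have h1 : Tendsto (fun x : ℝ≥0∞ => x ^ (1 - 3 * (1 / r.toReal))) (𝓝 0) (𝓝 0) := by
      have := (ENNReal.continuous_rpow_const (y := 1 - 3 * (1 / r.toReal))).tendsto 0
      rwa [ENNReal.zero_rpow_of_pos hθ] at this
    have := ENNReal.Tendsto.const_mul h1 (Or.inr (ENNReal.pow_ne_top hHt : H ^ 3 ≠ ⊤))
    rwa [mul_zero] at this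
  rw [SmallIncrements, ENNReal.tendsto_nhds_zero]
  intro ε hε
  have hε2 : 0 < ε / 2 := ENNReal.half_pos hε.ne'
  have hev := (ENNReal.tendsto_nhds_zero.1 hlim) (ε / 2) hε2
  obtain ⟨τ, hτ, hτε⟩ := ENNReal.nhds_zero_basis.eventually_iff.1 hev
  -- Outer regularity: an open set around the null set so small that its contribution is at most `ε
  -- / 2` for every nonzero `h`.
  obtain ⟨U, hSU, hUo, hUτ⟩ := Set.exists_isOpen_lt_of_lt S τ (by rwa [hS])
  have h1 : SmallIncrements π V (K \ U) := smallIncrements_of_isCompact (hK.diff hUo)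
    fun q hq => hreg q hq.1 fun h => hq.2 (hSU h)
  filter_upwards [(ENNReal.tendsto_nhds_zero.1 h1) (ε / 2) hε2, self_mem_nhdsWithin] with h h2 h3
  calc cubicIncrement π V K h ≤ cubicIncrement π V (K \ U ∪ U) h :=
        cubicIncrement_mono (by simp) h
    _ ≤ _ := cubicIncrement_union_le _ _ h
    _ ≤ ε / 2 + ε / 2 := add_le_add h2 ((cubicIncrement_le_of_eLpNorm_le hV hr.le h3 (hH h h3) U).trans
        (hτε hUτ))
    _ = ε := ENNReal.add_halves ε

/-- Functions with a smooth lift have Lipschitz increments. -/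
lemma exists_lipschitz_increment {E Y F : Type} [NormedAddCommGroup E] [NormedSpace ℝ E]
    [FiniteDimensional ℝ E] [AddCommGroup Y] [NormedAddCommGroup F] [NormedSpace ℝ F] {P : E →+ Y}
    {w : Y → F} {O : Set Y} (hw : ContDiffOn ℝ ∞ (fun e => w (P e)) (P ⁻¹' O)) {e₀ : E} {ρ : ℝ}
    (hρ : Metric.closedBall e₀ (2 * ρ) ⊆ P ⁻¹' O) : ∃ L : ℝ, 0 ≤ L ∧ ∀ e ∈ Metric.ball e₀ ρ,
      ∀ h : E, ‖h‖ < ρ → ‖w (P e - P h) - w (P e)‖ ≤ L * ‖h‖ := by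
  obtain ⟨L, hL⟩ := (hw.mono hρ).exists_lipschitzOnWith (by simp) (convex_closedBall _ _)
    (isCompact_closedBall _ _)
  refine ⟨L, L.coe_nonneg, fun e he h hh => ?_⟩
  have hρ0 : 0 < ρ := (norm_nonneg h).trans_lt hh
  have h1 : e ∈ Metric.closedBall e₀ (2 * ρ) :=
    Metric.ball_subset_closedBall (Metric.ball_subset_ball (by linarith) he)
  have h2 : e - h ∈ Metric.closedBall e₀ (2 * ρ) := by
    rw [Metric.mem_closedBall, dist_eq_norm]
    rw [Metric.mem_ball, dist_eq_norm] at he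
    calc ‖e - h - e₀‖ = ‖(e - e₀) - h‖ := by congr 1; abel
      _ ≤ ‖e - e₀‖ + ‖h‖ := norm_sub_le _ _
      _ ≤ _ := by linarith
  have := hL.dist_le_mul _ h2 _ h1
  simpa [dist_eq_norm, map_sub] using this

lemma exists_closedBall_subset {E Y : Type} [NormedAddCommGroup E] [NormedSpace ℝ E]
    [AddCommGroup Y] [TopologicalSpace Y] {P : E →+ Y} (hP : IsCover P) {O : Set Y} (hO : IsOpen O)
    {q : Y} (hq : q ∈ O) : ∃ (e : E) (ρ : ℝ), P e = q ∧ 0 < ρ ∧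
      Metric.closedBall e (2 * ρ) ⊆ P ⁻¹' O := by
  obtain ⟨e, rfl⟩ := hP.surjective q
  obtain ⟨ρ, hρ, hsub⟩ := Metric.nhds_basis_closedBall.mem_iff.1
    ((hO.preimage hP.continuous).mem_nhds hq)
  exact ⟨e, ρ / 2, rfl, by positivity, by rwa [mul_div_cancel₀ _ (two_ne_zero' ℝ)]⟩

/-- Points near which `V` is smooth. -/
lemma smallIncrements_of_smooth (hπ : IsCover π) {O : Set (ℝ × X)} (hO : IsOpen O) {q : ℝ × X}
    (hq : q ∈ O) {w : ℝ × X → Vec d}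
    (hw : ContDiffOn ℝ ∞ (fun z : ℝ × Vec d => w (z.1, π z.2)) {z | (z.1, π z.2) ∈ O})
    (hVw : ∀ᵐ z ∂(volume.restrict O), V z = w z) : ∃ W ∈ 𝓝 q, SmallIncrements π V W := by
  have hP := hπ.timeProj
  obtain ⟨e, ρ, rfl, hρ, hsub⟩ := exists_closedBall_subset hP hO hq
  obtain ⟨L, hL0, hL⟩ := exists_lipschitz_increment (P := timeProj π) hw hsub
  have hVw' : ∀ᵐ z, z ∈ O → V z = w z := (ae_restrict_iff' hO.measurableSet).1 hVw
  set W := timeProj π '' Metric.ball e ρ with hW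
  have hWK : W ⊆ timeProj π '' Metric.closedBall e ρ := image_mono Metric.ball_subset_closedBall
  have hWt : volume W ≠ ⊤ := (measure_mono hWK).trans_lt
    ((isCompact_closedBall e ρ).image hP.continuous).measure_lt_top |>.ne
  have hWm : MeasurableSet W := (hP.isOpenMap _ Metric.isOpen_ball).measurableSet
  refine ⟨W, (hP.isOpenMap _ Metric.isOpen_ball).mem_nhds ⟨e, Metric.mem_ball_self hρ, rfl⟩, ?_⟩
  have hnorm : ∀ h : Vec d, ‖((0 : ℝ), h)‖ = ‖h‖ := fun h => by simp [Prod.norm_def]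
  -- The Lipschitz bound gives `‖h‖⁻¹ (L ‖h‖)³ = L³ ‖h‖²`. The ball defining `W` is small enough for
  -- both `z` and its translate to stay in `O`.
  have hbound : ∀ h : Vec d, h ≠ 0 → ‖h‖ < ρ → cubicIncrement π V W h ≤
      volume W * ENNReal.ofReal (L ^ 3 * ‖h‖ ^ 2) := by
    intro h hh0 hh
    have h1 : ∀ᵐ z, z - timeProj π (0, h) ∈ O →
        V (z - timeProj π (0, h)) = w (z - timeProj π (0, h)) :=
      (measurePreserving_sub_right volume (timeProj π (0, h))).quasiMeasurePreserving.ae hVw'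
    have h2 : ∀ᵐ z ∂(volume.restrict W), ‖V (z - timeProj π (0, h)) - V z‖ ≤ L * ‖h‖ := by
      rw [ae_restrict_iff' hWm]
      filter_upwards [hVw', h1] with z h3 h4
      rintro ⟨y, hy, rfl⟩
      have h5 : timeProj π y ∈ O := hsub (Metric.ball_subset_closedBall
        (Metric.ball_subset_ball (by linarith) hy))
      have h6 : timeProj π y - timeProj π (0, h) ∈ O := by
        rw [← map_sub]
        refine hsub ?_
        rw [Metric.mem_closedBall, dist_eq_norm]
        rw [Metric.mem_ball, dist_eq_norm] at hy
        calc ‖y - (0, h) - e‖ = ‖(y - e) - (0, h)‖ := by congr 1; abel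
          _ ≤ ‖y - e‖ + ‖((0 : ℝ), h)‖ := norm_sub_le _ _
          _ ≤ _ := by rw [hnorm]; linarith
      rw [h3 h5, h4 h6]
      have := hL y hy (0, h) (by rwa [hnorm])
      rwa [hnorm] at this
    have hpos : 0 < ‖h‖ := norm_pos_iff.2 hh0
    unfold cubicIncrement
    rw [eLpNorm_three_pow]
    calc ENNReal.ofReal ‖h‖⁻¹ * ∫⁻ z in W, ‖V (z - timeProj π (0, h)) - V z‖ₑ ^ 3 ≤
          ENNReal.ofReal ‖h‖⁻¹ * ∫⁻ z in W, ENNReal.ofReal (L * ‖h‖) ^ 3 := by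
          refine mul_le_mul' le_rfl (lintegral_mono_ae ?_)
          filter_upwards [h2] with z hz
          gcongr
          rw [← ofReal_norm]; exact ENNReal.ofReal_le_ofReal hz
      _ = volume W * (ENNReal.ofReal ‖h‖⁻¹ * ENNReal.ofReal (L * ‖h‖) ^ 3) := by
          rw [lintegral_const, Measure.restrict_apply_univ]; ring
      _ = _ := by
          rw [← ENNReal.ofReal_pow (by positivity), ← ENNReal.ofReal_mul (by positivity)]
          congr 2
          field_simp
  have hlim : Tendsto (fun h : Vec d => volume W * ENNReal.ofReal (L ^ 3 * ‖h‖ ^ 2)) (𝓝[≠] 0)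
      (𝓝 0) := by
    have h1 : Tendsto (fun h : Vec d => ENNReal.ofReal (L ^ 3 * ‖h‖ ^ 2)) (𝓝 0) (𝓝 0) := by
      have : Continuous fun h : Vec d => ENNReal.ofReal (L ^ 3 * ‖h‖ ^ 2) :=
        ENNReal.continuous_ofReal.comp (by fun_prop)
      simpa using this.tendsto 0
    have := ENNReal.Tendsto.const_mul (h1.mono_left (nhdsWithin_le_nhds (s := {0}ᶜ)))
      (Or.inr hWt)
    rwa [mul_zero] at this
  refine tendsto_of_tendsto_of_tendsto_of_le_of_le' tendsto_const_nhds hlim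
    (Eventually.of_forall fun _ => zero_le) ?_
  filter_upwards [self_mem_nhdsWithin, mem_nhdsWithin_of_mem_nhds (Metric.ball_mem_nhds 0 hρ)]
    with h h1 h2
  exact hbound h h1 (by simpa using h2)

lemma eLpNorm_increment_le_besovNorm {p : ℝ≥0∞} {B Ω : Set X} {h : Vec d} (hh : h ≠ 0)
    (hB : ∀ x ∈ B, x ∈ Ω ∧ x - π h ∈ Ω) (f : X → Vec d) :
    ENNReal.ofReal (‖h‖ ^ (-(1 / 3) : ℝ)) *
      eLpNorm (fun x => f (x - π h) - f x) p (volume.restrict B) ≤ besovNorm π (1 / 3) p Ω f := by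
  refine le_trans ?_ le_add_self
  refine le_trans ?_ (le_iSup₂_of_le h hh le_rfl)
  gcongr
  exact fun x hx => hB x hx

lemma ofReal_mul_pow_three {h : Vec d} (hh : h ≠ 0) (a : ℝ≥0∞) :
    (ENNReal.ofReal (‖h‖ ^ (-(1 / 3) : ℝ)) * a) ^ 3 = ENNReal.ofReal ‖h‖⁻¹ * a ^ 3 := by
  have hpos : 0 < ‖h‖ := norm_pos_iff.2 hh
  rw [mul_pow, ← ENNReal.ofReal_pow (by positivity), ← Real.rpow_natCast, ← Real.rpow_mul hpos.le,
    ← Real.rpow_neg_one]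
  norm_num

lemma continuousOn_of_lift (hπ : IsCover π) {F : Type} [NormedAddCommGroup F] [NormedSpace ℝ F]
    {w : X → F} {Ω : Set X} (hΩ : IsOpen Ω)
    (hw : ContDiffOn ℝ ∞ (fun y => w (π y)) (π ⁻¹' Ω)) : ContinuousOn w Ω := by
  intro x hx
  obtain ⟨y, rfl⟩ := hπ.surjective x
  have h1 : ContinuousAt (fun y => w (π y)) y :=
    (hw.continuousOn y hx).continuousAt ((hΩ.preimage hπ.continuous).mem_nhds hx)
  have h2 : Tendsto w (𝓝 (π y)) (𝓝 (w (π y))) :=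
    (tendsto_map'_iff.2 h1 : Tendsto w (map π (𝓝 y)) _).mono_left (hπ.isOpenMap.nhds_le y)
  exact ContinuousAt.continuousWithinAt h2

lemma ae_increment_eq {f g : X → Vec d} (hfg : ∀ᵐ x, g x = f x) (a : X) :
    ∀ᵐ x, g (x - a) - g x = f (x - a) - f x := by
  have h1 : ∀ᵐ x, g (x - a) = f (x - a) :=
    (measurePreserving_sub_right volume a).quasiMeasurePreserving.ae hfg
  filter_upwards [hfg, h1] with x h2 h3
  rw [h2, h3]

lemma mem_of_mem_image_ball {Ω : Set X} {y₀ : Vec d} {ρ : ℝ}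
    (hρ : Metric.closedBall y₀ (2 * ρ) ⊆ π ⁻¹' Ω) {h : Vec d} (hh : ‖h‖ < ρ) :
    ∀ x ∈ π '' Metric.ball y₀ ρ, x ∈ Ω ∧ x - π h ∈ Ω := by
  have hρ0 : 0 < ρ := (norm_nonneg h).trans_lt hh
  rintro _ ⟨y, hy, rfl⟩
  refine ⟨hρ (Metric.ball_subset_closedBall (Metric.ball_subset_ball (by linarith) hy)), ?_⟩
  rw [← map_sub]
  refine hρ ?_
  rw [Metric.mem_closedBall, dist_eq_norm]
  rw [Metric.mem_ball, dist_eq_norm] at hy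
  calc ‖y - h - y₀‖ = ‖(y - y₀) - h‖ := by congr 1; abel
    _ ≤ ‖y - y₀‖ + ‖h‖ := norm_sub_le _ _
    _ ≤ _ := by linarith

/-- The increments of functions of class `B^{1/3}_{3,c₀(ℕ)}` are small. -/
lemma MemBesovC0.tendsto_increment (hπ : IsCover π) {Ω : Set X} (hΩ : IsOpen Ω) {f g : X → Vec d}
    (hf : MemBesovC0 π (1 / 3) 3 Ω f) (hg : Measurable g) (hgf : ∀ᵐ x, g x = f x) {y₀ : Vec d}
    {ρ : ℝ} (hρ0 : 0 < ρ) (hρ : Metric.closedBall y₀ (2 * ρ) ⊆ π ⁻¹' Ω) :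
    Tendsto (fun h : Vec d => ENNReal.ofReal (‖h‖ ^ (-(1 / 3) : ℝ)) *
      eLpNorm (fun x => g (x - π h) - g x) 3 (volume.restrict (π '' Metric.ball y₀ ρ)))
      (𝓝[≠] 0) (𝓝 0) := by
  set B := π '' Metric.ball y₀ ρ with hB
  have hBm : MeasurableSet B := (hπ.isOpenMap _ Metric.isOpen_ball).measurableSet
  have hBt : volume B ≠ ⊤ := (measure_mono (image_mono Metric.ball_subset_closedBall)).trans_lt
    ((isCompact_closedBall y₀ ρ).image hπ.continuous).measure_lt_top |>.ne
  rw [ENNReal.tendsto_nhds_zero]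
  intro ε hε
  have hε2 : 0 < ε / 2 := ENNReal.half_pos hε.ne'
  -- The part `f - w` is small in the Besov norm uniformly in `h`; the smooth part `w` is Lipschitz
  -- near the ball and contributes only `‖h‖^{2/3}` after rescaling.
  obtain ⟨w, hw, hwf⟩ := hf.2 (ε / 2) hε2
  obtain ⟨L, hL0, hL⟩ := exists_lipschitz_increment hw hρ
  have hwc := continuousOn_of_lift hπ hΩ hw
  have hlim : Tendsto (fun h : Vec d => volume B ^ (3 : ℝ≥0∞).toReal⁻¹ *
      ENNReal.ofReal (L * ‖h‖ ^ (2 / 3 : ℝ))) (𝓝[≠] 0) (𝓝 0) := by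
    have h1 : Tendsto (fun h : Vec d => ENNReal.ofReal (L * ‖h‖ ^ (2 / 3 : ℝ))) (𝓝 0) (𝓝 0) := by
      have : Continuous fun h : Vec d => ENNReal.ofReal (L * ‖h‖ ^ (2 / 3 : ℝ)) :=
        ENNReal.continuous_ofReal.comp (continuous_const.mul
          (continuous_norm.rpow_const fun _ => Or.inr (by norm_num)))
      have h2 := this.tendsto 0
      rwa [norm_zero, Real.zero_rpow (by norm_num), mul_zero, ENNReal.ofReal_zero] at h2
    have := ENNReal.Tendsto.const_mul (h1.mono_left (nhdsWithin_le_nhds (s := {0}ᶜ)))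
      (Or.inr (ENNReal.rpow_ne_top_of_nonneg (y := (3 : ℝ≥0∞).toReal⁻¹) (by norm_num) hBt))
    rwa [mul_zero] at this
  filter_upwards [self_mem_nhdsWithin, mem_nhdsWithin_of_mem_nhds (Metric.ball_mem_nhds 0 hρ0),
    (ENNReal.tendsto_nhds_zero.1 hlim) (ε / 2) hε2] with h hh0 hh1 hh2
  have hh : ‖h‖ < ρ := by simpa using hh1
  have hpos : 0 < ‖h‖ := norm_pos_iff.2 hh0
  have hmem := mem_of_mem_image_ball hρ hh
  have hgm : AEStronglyMeasurable (fun x => g (x - π h) - g x) (volume.restrict B) :=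
    ((hg.comp (measurable_id.sub_const _)).sub hg).aestronglyMeasurable
  have hwm : AEStronglyMeasurable (fun x => w (x - π h) - w x) (volume.restrict B) := by
    refine ContinuousOn.aestronglyMeasurable (ContinuousOn.sub ?_ ?_) hBm
    · exact hwc.comp (continuous_id.sub continuous_const).continuousOn fun x hx => (hmem x hx).2
    · exact hwc.mono fun x hx => (hmem x hx).1
  have h1 : eLpNorm (fun x => g (x - π h) - g x) 3 (volume.restrict B) ≤
      eLpNorm (fun x => (f (x - π h) - w (x - π h)) - (f x - w x)) 3 (volume.restrict B) +
      eLpNorm (fun x => w (x - π h) - w x) 3 (volume.restrict B) := by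
    have e1 : (fun x => g (x - π h) - g x) =
        (fun x => (g (x - π h) - g x) - (w (x - π h) - w x)) + fun x => w (x - π h) - w x := by
      ext x : 1; simp
    have e2 : eLpNorm (fun x => (g (x - π h) - g x) - (w (x - π h) - w x)) 3 (volume.restrict B) =
        eLpNorm (fun x => (f (x - π h) - w (x - π h)) - (f x - w x)) 3 (volume.restrict B) := by
      refine eLpNorm_congr_ae ?_
      filter_upwards [ae_restrict_of_ae (ae_increment_eq hgf (π h))] with x hx
      rw [hx]; abel
    calc _ = eLpNorm ((fun x => (g (x - π h) - g x) - (w (x - π h) - w x)) +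
          fun x => w (x - π h) - w x) 3 (volume.restrict B) := by rw [← e1]
      _ ≤ _ := eLpNorm_add_le (hgm.sub hwm) hwm (by norm_num)
      _ = _ := by rw [e2]
  have h2 : eLpNorm (fun x => w (x - π h) - w x) 3 (volume.restrict B) ≤
      volume B ^ (3 : ℝ≥0∞).toReal⁻¹ * ENNReal.ofReal (L * ‖h‖) := by
    have := eLpNorm_le_of_ae_bound (p := 3) (μ := volume.restrict B) (C := L * ‖h‖)
      (f := fun x => w (x - π h) - w x) (by
        rw [ae_restrict_iff' hBm]
        refine Eventually.of_forall ?_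
        rintro _ ⟨y, hy, rfl⟩
        exact hL y hy h hh)
    rwa [Measure.restrict_apply_univ] at this
  calc _ ≤ ENNReal.ofReal (‖h‖ ^ (-(1 / 3) : ℝ)) *
        eLpNorm (fun x => (f (x - π h) - w (x - π h)) - (f x - w x)) 3 (volume.restrict B) +
        ENNReal.ofReal (‖h‖ ^ (-(1 / 3) : ℝ)) *
          (volume B ^ (3 : ℝ≥0∞).toReal⁻¹ * ENNReal.ofReal (L * ‖h‖)) := by
        rw [← mul_add]
        exact mul_le_mul' le_rfl (h1.trans (add_le_add le_rfl h2))
    _ ≤ ε / 2 + ε / 2 := by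
        refine add_le_add ?_ (le_trans (le_of_eq ?_) hh2)
        · exact (eLpNorm_increment_le_besovNorm hh0 hmem fun x => f x - w x).trans hwf.le
        · rw [mul_left_comm, ← ENNReal.ofReal_mul (by positivity)]
          congr 2
          have : ‖h‖ ^ (2 / 3 : ℝ) = ‖h‖ ^ (-(1 / 3) : ℝ) * ‖h‖ := by
            nth_rw 3 [← Real.rpow_one ‖h‖]
            rw [← Real.rpow_add hpos]; norm_num
          rw [this]; ring
    _ = ε := ENNReal.add_halves ε

/-- Points near which `V` is of class `L^3_t B^{1/3}_{3,c₀(ℕ)}`. -/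
lemma smallIncrements_of_critical (hπ : IsCover π) {I J : Set ℝ} {Ω : Set X} (hJ : IsOpen J)
    (hΩ : IsOpen Ω) (hJI : J ⊆ I) {q : ℝ × X} (hq1 : q.1 ∈ J) (hq2 : q.2 ∈ Ω)
    {v : ℝ × X → Vec d} (hv : MemTimeBesovC0 π 3 (1 / 3) 3 J Ω v) (hV : Measurable V)
    (hVv : ∀ᵐ t ∂(volume.restrict I), ∀ᵐ x, V (t, x) = v (t, x)) :
    ∃ W ∈ 𝓝 q, SmallIncrements π V W := by
  obtain ⟨y₀, ρ, hy₀, hρ0, hρ⟩ := exists_closedBall_subset hπ hΩ hq2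
  set B := π '' Metric.ball y₀ ρ with hB
  have hBo : IsOpen B := hπ.isOpenMap _ Metric.isOpen_ball
  have hqB : q.2 ∈ B := ⟨y₀, Metric.mem_ball_self hρ0, hy₀⟩
  refine ⟨J ×ˢ B, (hJ.prod hBo).mem_nhds ⟨hq1, hqB⟩, ?_⟩
  have hVJ : ∀ᵐ t ∂(volume.restrict J), ∀ᵐ x, V (t, x) = v (t, x) :=
    ae_mono (Measure.restrict_mono hJI le_rfl) hVv
  have hVt : ∀ t, Measurable fun x => V (t, x) := fun t => hV.comp measurable_prodMk_left
  set G : Vec d → ℝ → ℝ≥0∞ := fun h t => ENNReal.ofReal ‖h‖⁻¹ *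
    ∫⁻ x in B, ‖V (t, x - π h) - V (t, x)‖ₑ ^ 3 with hG
  have hmeas : ∀ h : Vec d, Measurable fun z : ℝ × X => ‖V (z.1, z.2 - π h) - V z‖ₑ ^ 3 := fun h =>
    ((hV.comp (measurable_fst.prodMk (measurable_snd.sub_const _))).sub hV).enorm.pow_const 3
  have hsub : ∀ (h : Vec d) (z : ℝ × X), z - timeProj π (0, h) = (z.1, z.2 - π h) := fun h z => by
    ext <;> simp
  have hcub : ∀ h, cubicIncrement π V (J ×ˢ B) h = ∫⁻ t in J, G h t := by
    intro h
    rw [cubicIncrement, eLpNorm_three_pow, Measure.volume_eq_prod, ← Measure.prod_restrict]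
    simp_rw [hsub]
    rw [lintegral_prod _ (hmeas h).aemeasurable, hG]
    simp only
    rw [lintegral_const_mul _ ((hmeas h).lintegral_prod_right')]
  have hGeq : ∀ h : Vec d, h ≠ 0 → ∀ t, G h t = (ENNReal.ofReal (‖h‖ ^ (-(1 / 3) : ℝ)) *
      eLpNorm (fun x => V (t, x - π h) - V (t, x)) 3 (volume.restrict B)) ^ 3 := by
    intro h hh t
    rw [ofReal_mul_pow_three hh, eLpNorm_three_pow]
  -- Dominated convergence in time: at almost every time the rescaled increments vanish in the
  -- limit, and the cube of the Besov norm of the time slice is an integrable majorant.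
  have hlim : Tendsto (fun h => ∫⁻ t in J, G h t) (𝓝[≠] 0) (𝓝 (∫⁻ t in J, 0)) := by
    refine tendsto_lintegral_filter_of_dominated_convergence'
      (fun t => besovNorm π (1 / 3) 3 Ω (fun x => v (t, x)) ^ 3) (Eventually.of_forall fun h => ?_)
      ?_ ?_ ?_
    · exact ((hmeas h).lintegral_prod_right'.const_mul _).aemeasurable
    · filter_upwards [self_mem_nhdsWithin,
        mem_nhdsWithin_of_mem_nhds (Metric.ball_mem_nhds 0 hρ0)] with h hh0 hh1
      filter_upwards [hVJ] with t ht
      rw [hGeq h hh0]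
      have e1 : eLpNorm (fun x => V (t, x - π h) - V (t, x)) 3 (volume.restrict B) =
          eLpNorm (fun x => v (t, x - π h) - v (t, x)) 3 (volume.restrict B) :=
        eLpNorm_congr_ae (ae_restrict_of_ae (ae_increment_eq ht (π h)))
      rw [e1]
      gcongr
      exact eLpNorm_increment_le_besovNorm hh0 (mem_of_mem_image_ball hρ (by simpa using hh1))
        fun x => v (t, x)
    · have h1 := hv.2
      have h2 : timeBesovNorm π 3 (1 / 3) 3 J Ω v ^ 3 ≠ ⊤ := ENNReal.pow_ne_top h1.ne
      rw [timeBesovNorm, eLpNorm_three_pow] at h2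
      exact h2
    · filter_upwards [hVJ, hv.1] with t ht ht'
      have h1 := ht'.tendsto_increment hπ hΩ (hVt t) ht hρ0 hρ
      have h2 := ((ENNReal.continuous_pow 3).tendsto 0).comp h1
      rw [zero_pow three_ne_zero] at h2
      refine h2.congr' ?_
      filter_upwards [self_mem_nhdsWithin] with h hh
      exact (hGeq h hh t).symm
  rw [SmallIncrements, funext hcub]
  simpa using hlim

end Increments

/-! ### Reduction to globally defined velocities -/

section Interpolation

variable {α F : Type} [MeasurableSpace α] {μ : Measure α} [NormedAddCommGroup F]

/-- For finite `q` one has `|f|^s ≤ |f|^p + |f|^q`; for `q = ⊤` the factor `|f|^{s-p}` is bounded by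
a power of the essential supremum. -/
lemma memLp_of_le_of_le {f : α → F} {p q s : ℝ≥0∞} (hp0 : p ≠ 0) (hps : p ≤ s) (hsq : s ≤ q)
    (hp : MemLp f p μ) (hq : MemLp f q μ) : MemLp f s μ := by
  rcases eq_or_ne s ⊤ with rfl | hst
  · rwa [← top_le_iff.1 hsq]
  have hs0 : s ≠ 0 := fun h => hp0 (by rw [h] at hps; exact le_bot_iff.1 hps)
  have hpt : p ≠ ⊤ := (hps.trans_lt hst.lt_top).ne
  have hp' : 0 < p.toReal := ENNReal.toReal_pos hp0 hpt
  have hps' : p.toReal ≤ s.toReal := (ENNReal.toReal_le_toReal hpt hst).2 hps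
  have hpf := (eLpNorm_lt_top_iff_lintegral_rpow_enorm_lt_top hp0 hpt).1 hp.2
  refine ⟨hp.1, (eLpNorm_lt_top_iff_lintegral_rpow_enorm_lt_top hs0 hst).2 ?_⟩
  rcases eq_or_ne q ⊤ with rfl | hqt
  · set M := eLpNorm f ⊤ μ with hM
    have hMt : M ≠ ⊤ := hq.2.ne
    have hb : ∀ᵐ z ∂μ, ‖f z‖ₑ ≤ M := by
      rw [hM, eLpNorm_exponent_top]; exact enorm_ae_le_eLpNormEssSup f μ
    calc ∫⁻ z, ‖f z‖ₑ ^ s.toReal ∂μ ≤ ∫⁻ z, M ^ (s.toReal - p.toReal) * ‖f z‖ₑ ^ p.toReal ∂μ := by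
          refine lintegral_mono_ae ?_
          filter_upwards [hb] with z hz
          rw [← sub_add_cancel s.toReal p.toReal, ENNReal.rpow_add_of_nonneg _ _
            (sub_nonneg.2 hps') hp'.le, add_sub_cancel_right]
          gcongr
      _ = M ^ (s.toReal - p.toReal) * ∫⁻ z, ‖f z‖ₑ ^ p.toReal ∂μ :=
          lintegral_const_mul' _ _ (ENNReal.rpow_ne_top_of_nonneg (sub_nonneg.2 hps') hMt)
      _ < ⊤ := ENNReal.mul_lt_top
          (ENNReal.rpow_ne_top_of_nonneg (sub_nonneg.2 hps') hMt).lt_top hpf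
  · have hq0 : q ≠ 0 := fun h => hs0 (by rw [h] at hsq; exact le_bot_iff.1 hsq)
    have hqf := (eLpNorm_lt_top_iff_lintegral_rpow_enorm_lt_top hq0 hqt).1 hq.2
    have hsq' : s.toReal ≤ q.toReal := (ENNReal.toReal_le_toReal hst hqt).2 hsq
    calc ∫⁻ z, ‖f z‖ₑ ^ s.toReal ∂μ ≤ ∫⁻ z, (‖f z‖ₑ ^ p.toReal + ‖f z‖ₑ ^ q.toReal) ∂μ := by
          refine lintegral_mono fun z => ?_
          rcases le_total ‖f z‖ₑ 1 with h | h
          · exact (ENNReal.rpow_le_rpow_of_exponent_ge h hps').trans le_self_add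
          · exact (ENNReal.rpow_le_rpow_of_exponent_le h hsq').trans le_add_self
      _ = (∫⁻ z, ‖f z‖ₑ ^ p.toReal ∂μ) + ∫⁻ z, ‖f z‖ₑ ^ q.toReal ∂μ :=
          lintegral_add_left' (hp.1.enorm.pow_const _) _
      _ < ⊤ := ENNReal.add_lt_top.2 ⟨hpf, hqf⟩

/-- Tonelli for finite `r`, and Fubini for null sets when `r = ⊤`. No measurability of `b` is
assumed, which suits Besov norms of time slices. -/
lemma eLpNorm_prod_le {β : Type} [MeasurableSpace β] {ν : Measure β} [SFinite μ] [SFinite ν]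
    [MeasurableSpace F] [BorelSpace F]
    {f : α × β → F} (hf : Measurable f) {r : ℝ≥0∞} (hr : r ≠ 0) {b : α → ℝ≥0∞}
    (hb : ∀ᵐ a ∂μ, eLpNorm (fun y => f (a, y)) r ν ≤ b a) :
    eLpNorm f r (μ.prod ν) ≤ eLpNorm b r μ := by
  rcases eq_or_ne r ⊤ with rfl | hrt
  · rw [eLpNorm_exponent_top, eLpNorm_exponent_top]
    refine essSup_le_of_ae_le _ ?_
    have hms : MeasurableSet {z : α × β | ‖f z‖ₑ ≤ eLpNormEssSup b μ} :=
      measurableSet_le hf.enorm measurable_const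
    refine (Measure.ae_prod_mem_iff_ae_ae_mem hms).2 ?_
    filter_upwards [hb, enorm_ae_le_eLpNormEssSup b μ] with a h1 h2
    rw [eLpNorm_exponent_top] at h1
    filter_upwards [enorm_ae_le_eLpNormEssSup (fun y => f (a, y)) ν] with y h3
    exact h3.trans (h1.trans h2)
  · rw [eLpNorm_eq_lintegral_rpow_enorm_toReal hr hrt, eLpNorm_eq_lintegral_rpow_enorm_toReal hr hrt]
    have hr' : 0 < r.toReal := ENNReal.toReal_pos hr hrt
    refine ENNReal.rpow_le_rpow ?_ (by positivity)
    rw [lintegral_prod _ (hf.enorm.pow_const _).aemeasurable]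
    refine lintegral_mono_ae ?_
    filter_upwards [hb] with a ha
    rw [eLpNorm_eq_lintegral_rpow_enorm_toReal hr hrt, one_div,
      ENNReal.rpow_inv_le_iff hr'] at ha
    exact ha

end Interpolation

/-! ### Global measurable representatives extended by zero -/

section Reduction

variable {d : ℕ} {X : Type} [AddCommGroup X] [TopologicalSpace X] [IsTopologicalAddGroup X]
  [LocallyCompactSpace X] [T2Space X] [SecondCountableTopology X]
  [MeasureSpace X] [BorelSpace X] [(volume : Measure X).IsAddHaarMeasure]
  {π : Vec d →+ X} {I : Set ℝ} {v : ℝ × X → Vec d} {p : ℝ × X → ℝ} {r : ℝ≥0∞}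

lemma restrict_spaceTime (I : Set ℝ) : (volume : Measure (ℝ × X)).restrict (spaceTime X I) =
    (volume.restrict I).prod volume := by
  rw [spaceTime, Measure.volume_eq_prod, ← Measure.prod_restrict, Measure.restrict_univ]

lemma isOpen_spaceTime (hI : IsOpen I) : IsOpen (spaceTime X I) := hI.prod isOpen_univ

/-- A global measurable representative of the velocity, extended by zero. -/
structure IsExtension (I : Set ℝ) (v V : ℝ × X → Vec d) : Prop where
  measurable : Measurable V
  eq_zero : ∀ z ∉ spaceTime X I, V z = 0
  ae_eq : ∀ᵐ z ∂(volume.restrict (spaceTime X I)), V z = v z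

lemma exists_isExtension (hI : IsOpen I) (hv : MemLp v 2 (volume.restrict (spaceTime X I))) :
    ∃ V, IsExtension I v V := by
  refine ⟨(spaceTime X I).indicator (hv.1.mk v),
    hv.1.stronglyMeasurable_mk.measurable.indicator (isOpen_spaceTime hI).measurableSet,
    fun z hz => indicator_of_notMem hz _, ?_⟩
  filter_upwards [hv.1.ae_eq_mk, ae_restrict_mem (isOpen_spaceTime hI).measurableSet] with z h1 h2
  rw [indicator_of_mem h2, h1]

variable {V : ℝ × X → Vec d}

lemma IsExtension.ae_ae_eq (h : IsExtension I v V) :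
    ∀ᵐ t ∂(volume.restrict I), ∀ᵐ x, V (t, x) = v (t, x) := by
  have := h.ae_eq
  rw [restrict_spaceTime] at this
  exact Measure.ae_ae_of_ae_prod this

lemma eLpNorm_eq_of_eq_zero {F : Type} [NormedAddCommGroup F] {f : ℝ × X → F} (hI : IsOpen I)
    (hf : ∀ z ∉ spaceTime X I, f z = 0) (r : ℝ≥0∞) :
    eLpNorm f r = eLpNorm f r ((volume.restrict I).prod volume) := by
  rw [← restrict_spaceTime, ← eLpNorm_indicator_eq_eLpNorm_restrict
    (isOpen_spaceTime hI).measurableSet]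
  congr 1
  ext z : 1
  by_cases hz : z ∈ spaceTime X I
  · rw [indicator_of_mem hz]
  · rw [indicator_of_notMem hz, hf z hz]

lemma IsExtension.memLp_two (h : IsExtension I v V) (hI : IsOpen I)
    (hv : MemLp v 2 (volume.restrict (spaceTime X I))) : MemLp V 2 := by
  refine ⟨h.measurable.aestronglyMeasurable, ?_⟩
  rw [eLpNorm_eq_of_eq_zero hI h.eq_zero, ← restrict_spaceTime, eLpNorm_congr_ae h.ae_eq]
  exact hv.2

lemma IsExtension.memLp (h : IsExtension I v V) (hI : IsOpen I) (hr : r ≠ 0)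
    (hv : timeBesovNorm π r (1 / 3) r I univ v < ⊤) : MemLp V r := by
  refine ⟨h.measurable.aestronglyMeasurable, lt_of_le_of_lt ?_ hv⟩
  rw [eLpNorm_eq_of_eq_zero hI h.eq_zero]
  refine eLpNorm_prod_le h.measurable hr ?_
  filter_upwards [h.ae_ae_eq] with t ht
  rw [eLpNorm_congr_ae ht, besovNorm, Measure.restrict_univ]
  exact le_self_add

/-- Spatial translations preserve `I × X`, so extension by zero creates no jump in the increments,
and the Besov bound can be integrated slice by slice in time. -/
lemma IsExtension.eLpNorm_increment_le (h : IsExtension I v V) (hI : IsOpen I) (hr : r ≠ 0)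
    {y : Vec d} (hy : y ≠ 0) :
    eLpNorm (fun z => V (z - timeProj π (0, y)) - V z) r ≤
      ENNReal.ofReal (‖y‖ ^ (1 / 3 : ℝ)) * timeBesovNorm π r (1 / 3) r I univ v := by
  have hpos : 0 < ‖y‖ := norm_pos_iff.2 hy
  have hsub : ∀ z : ℝ × X, z - timeProj π (0, y) = (z.1, z.2 - π y) := fun z => by ext <;> simp
  have hm : Measurable fun z : ℝ × X => V (z.1, z.2 - π y) - V z :=
    (h.measurable.comp (measurable_fst.prodMk (measurable_snd.sub_const _))).sub h.measurable
  have h1 : eLpNorm ((‖y‖ ^ (-(1 / 3) : ℝ)) • fun z : ℝ × X => V (z.1, z.2 - π y) - V z) r ≤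
      timeBesovNorm π r (1 / 3) r I univ v := by
    rw [eLpNorm_eq_of_eq_zero hI fun z hz => ?_]
    · refine eLpNorm_prod_le (hm.const_smul _) hr ?_
      filter_upwards [h.ae_ae_eq] with t ht
      have e1 : (fun x => ((‖y‖ ^ (-(1 / 3) : ℝ)) • fun z : ℝ × X => V (z.1, z.2 - π y) - V z) (t, x))
          = (‖y‖ ^ (-(1 / 3) : ℝ)) • fun x => V (t, x - π y) - V (t, x) := rfl
      have e2 := eLpNorm_congr_ae (p := r) (ae_increment_eq ht (π y))
      rw [e1, eLpNorm_const_smul, e2, Real.enorm_eq_ofReal (by positivity)]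
      have := eLpNorm_increment_le_besovNorm (π := π) (p := r) (B := univ) (Ω := univ) hy (by simp)
        fun x => v (t, x)
      rwa [Measure.restrict_univ] at this
    · have hz' : (z.1, z.2 - π y) ∉ spaceTime X I := fun h' => hz ⟨h'.1, mem_univ _⟩
      simp [h.eq_zero z hz, h.eq_zero _ hz']
  simp_rw [hsub]
  rw [eLpNorm_const_smul, Real.enorm_eq_ofReal (by positivity)] at h1
  have h2 := mul_le_mul_right h1 (ENNReal.ofReal (‖y‖ ^ (1 / 3 : ℝ)))
  have e3 : ENNReal.ofReal (‖y‖ ^ (1 / 3 : ℝ)) * ENNReal.ofReal (‖y‖ ^ (-(1 / 3) : ℝ)) = 1 := by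
    rw [← ENNReal.ofReal_mul (by positivity), ← Real.rpow_add hpos]; simp
  rwa [← mul_assoc, e3, one_mul] at h2

lemma timeDeriv_eq (π : Vec d →+ X) (φ : ℝ × X → ℝ) (z : ℝ × X) :
    timeDeriv φ z = dirDeriv (timeProj π) (timeDir d) φ z := by
  change _ = deriv (fun s : ℝ => φ (z.1 + s * 1, z.2 + π (s • 0))) 0
  simp only [smul_zero, map_zero, add_zero, mul_one]
  rw [deriv_comp_const_add (fun s => φ (s, z.2)), add_zero]
  rfl

lemma spaceDeriv_eq (π : Vec d →+ X) (j : Fin d) (φ : ℝ × X → ℝ) (z : ℝ × X) :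
    spaceDeriv π j φ z = dirDeriv (timeProj π) (spaceDir d j) φ z := by
  change _ = deriv (fun s : ℝ => φ (z.1 + s * 0, z.2 + π (s • EuclideanSpace.single j 1))) 0
  simp only [mul_zero, add_zero]
  have : ∀ s : ℝ, s • EuclideanSpace.single j (1 : ℝ) = EuclideanSpace.single j s := fun s => by
    ext i; simp
  simp_rw [this]
  rfl

lemma IsTestOn.isTest {φ : ℝ × X → ℝ} (h : IsTestOn (timeProj π) (spaceTime X I) φ) :
    IsTest π I φ := ⟨h.smooth, h.compact, h.support⟩

end Reduction

/-! ### The equations without pressure and the regularity of the extension -/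

section Equations

variable {d : ℕ} {X : Type} [AddCommGroup X] [TopologicalSpace X] [IsTopologicalAddGroup X]
  [LocallyCompactSpace X] [T2Space X] [SecondCountableTopology X]
  [MeasureSpace X] [BorelSpace X] [(volume : Measure X).IsAddHaarMeasure]
  {π : Vec d →+ X} {I : Set ℝ} {v V : ℝ × X → Vec d} {p : ℝ × X → ℝ} {r : ℝ≥0∞}

lemma measurable_coord {α : Type} [MeasurableSpace α] {f : α → Vec d} (hf : Measurable f)
    (l : Fin d) : Measurable fun z => f z l :=
  (EuclideanSpace.proj l : Vec d →L[ℝ] ℝ).continuous.measurable.comp hf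

lemma memLp_coord {α : Type} [MeasurableSpace α] {μ : Measure α} {f : α → Vec d}
    (hf : MemLp f r μ) (l : Fin d) : MemLp (fun z => f z l) r μ :=
  (EuclideanSpace.proj l : Vec d →L[ℝ] ℝ).comp_memLp' hf

lemma IsExtension.integral_eq (h : IsExtension I v V)
    (F : Vec d → ℝ × X → ℝ) (hF : ∀ z, F 0 z = 0) :
    ∫ z, F (V z) z = ∫ z in spaceTime X I, F (v z) z := by
  rw [← setIntegral_eq_integral_of_forall_compl_eq_zero (s := spaceTime X I) fun z hz => by
    rw [h.eq_zero z hz, hF]]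
  refine integral_congr_ae ?_
  filter_upwards [h.ae_eq] with z hz
  rw [hz]

lemma IsExtension.integrableOn (h : IsExtension I v V)
    (F : Vec d → ℝ × X → ℝ) (hF : Integrable fun z => F (V z) z) :
    IntegrableOn (fun z => F (v z) z) (spaceTime X I) := by
  refine hF.integrableOn.congr ?_
  filter_upwards [h.ae_eq] with z hz
  rw [hz]

lemma integrable_mul_of_integrableOn_tsupport {P : ℝ × Vec d →+ ℝ × X} (hP : IsCover P)
    {U : Set (ℝ × X)} {φ q : ℝ × X → ℝ} (h : IsTestOn P U φ) (hq : IntegrableOn q (tsupport φ)) :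
    Integrable fun z => q z * φ z := by
  obtain ⟨C, hC⟩ := h.compact.exists_bound_of_continuous (h.smooth.continuous hP)
  have h1 : Integrable ((tsupport φ).indicator q) :=
    (integrable_indicator_iff h.compact.measurableSet).2 hq
  refine (h1.mul_bdd (c := C) (h.smooth.continuous hP).aestronglyMeasurable
    (Eventually.of_forall hC)).congr (Eventually.of_forall fun z => ?_)
  by_cases hz : z ∈ tsupport φ
  · simp [hz]
  · simp [image_eq_zero_of_notMem_tsupport hz]

lemma IsExtension.eulerCore (h : IsExtension I v V) (hπ : IsCover π)
    (hE : IsWeakEulerSolution π I v p) (hV2 : MemLp V 2) (hV3 : MemLp V 3) :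
    EulerCore (timeProj π) (timeDir d) (spaceDir d) (spaceTime X I) fun l z => V z l where
  measurable := measurable_coord h.measurable
  memLp_two := memLp_coord hV2
  memLp_three := memLp_coord hV3
  div_free φ hφ := by
    rw [h.integral_eq (fun w z => ∑ j, w j * dirDeriv (timeProj π) (spaceDir d j) φ z) (by simp),
      ← hE.divergence_free φ hφ.isTest]
    simp_rw [spaceDeriv_eq]
  momentum Ψ hΨ hdiv := by
    have hP := hπ.timeProj
    have hVl : ∀ l, LocallyIntegrable fun z => V z l := fun l =>
      (memLp_coord hV2 l).locallyIntegrable (by norm_num)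
    have hVV : ∀ j l, Integrable fun z => V z j * V z l := fun j l =>
      (memLp_coord hV2 j).integrable_mul (memLp_coord hV2 l)
    have i1 : ∀ l, IntegrableOn (fun z => v z l * dirDeriv (timeProj π) (timeDir d) (Ψ l) z +
        ∑ j, v z j * v z l * dirDeriv (timeProj π) (spaceDir d j) (Ψ l) z) (spaceTime X I) :=
      fun l => h.integrableOn (fun w z => w l * dirDeriv (timeProj π) (timeDir d) (Ψ l) z +
        ∑ j, w j * w l * dirDeriv (timeProj π) (spaceDir d j) (Ψ l) z)
        ((integrable_mul_test hP (hVl l) ((hΨ l).dirDeriv hP _)).add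
          (integrable_finsetSum _ fun j _ => integrable_mul_test hP
            (hVV j l).locallyIntegrable ((hΨ l).dirDeriv hP _)))
    have i2 : ∀ l, IntegrableOn (fun z => p z * dirDeriv (timeProj π) (spaceDir d l) (Ψ l) z)
        (spaceTime X I) := fun l =>
      have ht := (hΨ l).dirDeriv hP (spaceDir d l)
      (integrable_mul_of_integrableOn_tsupport hP ht
        (hE.pressure_loc _ ht.support ht.compact)).integrableOn
    have e := h.integral_eq (fun w z => ∑ l, (w l * dirDeriv (timeProj π) (timeDir d) (Ψ l) z +
      ∑ j, w j * w l * dirDeriv (timeProj π) (spaceDir d j) (Ψ l) z)) (by simp)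
    rw [eulerForm, e]
    -- The pressure term may be added freely because the divergence of `Ψ` vanishes pointwise. Each
    -- component of the momentum equation can then be used separately.
    have e2 : ∀ z, ∑ l, (v z l * dirDeriv (timeProj π) (timeDir d) (Ψ l) z +
        ∑ j, v z j * v z l * dirDeriv (timeProj π) (spaceDir d j) (Ψ l) z) =
        ∑ l, (v z l * dirDeriv (timeProj π) (timeDir d) (Ψ l) z +
        ∑ j, v z j * v z l * dirDeriv (timeProj π) (spaceDir d j) (Ψ l) z +
        p z * dirDeriv (timeProj π) (spaceDir d l) (Ψ l) z) := fun z => by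
      rw [Finset.sum_add_distrib (g := fun l => p z * _), ← Finset.mul_sum, hdiv, mul_zero, add_zero]
    simp_rw [e2]
    refine (integral_finsetSum _ fun l _ => (i1 l).add (i2 l)).trans
      (Finset.sum_eq_zero fun l _ => ?_)
    rw [← hE.momentum l (Ψ l) (hΨ l).isTest]
    simp_rw [spaceDeriv_eq, timeDeriv_eq π]
    rfl

lemma SmallIncrements.coord {K : Set (ℝ × X)} (h : SmallIncrements π V K) (l : Fin d) :
    Tendsto (fun y : Vec d => ENNReal.ofReal ‖y‖⁻¹ *
      eLpNorm (fun z => V (z - timeProj π (0, y)) l - V z l) 3 (volume.restrict K) ^ 3)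
      (𝓝[≠] 0) (𝓝 0) := by
  refine tendsto_of_tendsto_of_tendsto_of_le_of_le tendsto_const_nhds h (fun _ => zero_le)
    fun y => ?_
  change _ ≤ cubicIncrement π V K y
  unfold cubicIncrement
  gcongr
  exact eLpNorm_mono fun z => PiLp.norm_apply_le (V (z - timeProj π (0, y)) - V z) l

/-- The two kinds of regularity outside of a null set give small increments on compact sets. -/
lemma IsExtension.smallIncrements (h : IsExtension I v V) (hπ : IsCover π) (hI : IsOpen I)
    (hr : 3 < r) (hv : timeBesovNorm π r (1 / 3) r I univ v < ⊤)
    (hS : volume (singularSupport π I v) = 0 ∨ volume (criticalSingularSupport π I v) = 0)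
    {K : Set (ℝ × X)} (hKI : K ⊆ spaceTime X I) (hK : IsCompact K) : SmallIncrements π V K := by
  have hr0 : r ≠ 0 := (zero_le.trans_lt hr).ne'
  rcases hS with hS | hS
  · refine smallIncrements_of_null h.measurable hr hv.ne
      (fun y hy => h.eLpNorm_increment_le hI hr0 hy) hK hS fun q hq hqS => ?_
    by_contra hcon
    refine hqS ⟨hKI hq, fun ⟨O, hO, hqO, hOI, w, hw, hvw⟩ => hcon ?_⟩
    refine smallIncrements_of_smooth hπ hO hqO hw ?_
    filter_upwards [hvw, ae_mono (Measure.restrict_mono hOI le_rfl) h.ae_eq] with z h1 h2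
    rw [h2, h1]
  · refine smallIncrements_of_null h.measurable hr hv.ne
      (fun y hy => h.eLpNorm_increment_le hI hr0 hy) hK hS fun q hq hqS => ?_
    by_contra hcon
    exact hqS ⟨hKI hq, fun ⟨J, Ω, hJ, hΩ, hJI, h1, h2, hm⟩ =>
      hcon (smallIncrements_of_critical hπ hJ hΩ hJI h1 h2 hm h.measurable h.ae_ae_eq)⟩

end Equations

/-! ### From vanishing distributional derivative to constant energy -/

section Conclusion

variable {d : ℕ} {X : Type} [AddCommGroup X] [TopologicalSpace X] [IsTopologicalAddGroup X]
  [LocallyCompactSpace X] [T2Space X] [SecondCountableTopology X]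
  [MeasureSpace X] [BorelSpace X] [(volume : Measure X).IsAddHaarMeasure]
  {π : Vec d →+ X} {I : Set ℝ} {v V : ℝ × X → Vec d} {r : ℝ≥0∞}

/-- The lemma of du Bois-Reymond: an integrable function on an interval whose distributional
derivative vanishes is constant. -/
lemma ae_eq_const_of_integral_deriv_mul_eq_zero (hI : IsOpen I) (hIc : I.OrdConnected)
    {e : ℝ → ℝ} (he : IntegrableOn e I)
    (h : ∀ η : ℝ → ℝ, ContDiff ℝ ∞ η → HasCompactSupport η → tsupport η ⊆ I →
      ∫ t in I, deriv η t * e t = 0) : ∃ c : ℝ, ∀ᵐ t ∂(volume.restrict I), e t = c := by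
  rcases I.eq_empty_or_nonempty with rfl | ⟨t₀, ht₀⟩
  · exact ⟨0, by simp⟩
  obtain ⟨f, hfI, hfc, hfs, hf01, hf1⟩ := exists_contDiff_tsupport_subset (n := ⊤) (hI.mem_nhds ht₀)
  have hf0 : 0 < ∫ t, f t := hfs.continuous.integral_pos_of_hasCompactSupport_nonneg_nonzero hfc
    (fun t => (hf01 ⟨t, rfl⟩).1) (x := t₀) (by rw [hf1]; exact one_ne_zero)
  obtain ⟨θ, hθs, hθc, hθI, hθ1⟩ : ∃ θ : ℝ → ℝ, ContDiff ℝ ∞ θ ∧ HasCompactSupport θ ∧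
      tsupport θ ⊆ I ∧ ∫ t, θ t = 1 :=
    ⟨fun t => (∫ t, f t)⁻¹ * f t, contDiff_const.mul hfs, hfc.mul_left,
      (tsupport_mul_subset_right (f := fun _ => (∫ t, f t)⁻¹)).trans hfI, by
      rw [integral_const_mul, inv_mul_cancel₀ hf0.ne']⟩
  have hint : ∀ φ : ℝ → ℝ, ContDiff ℝ ∞ φ → HasCompactSupport φ →
      Integrable (fun t => φ t * e t) (volume.restrict I) := fun φ hφ hφc => by
    obtain ⟨C, hC⟩ := hφc.exists_bound_of_continuous hφ.continuous
    exact he.bdd_mul hφ.continuous.aestronglyMeasurable (Eventually.of_forall hC)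
  refine ⟨∫ t in I, θ t * e t, ?_⟩
  have hconst : LocallyIntegrable (fun _ : ℝ => ∫ t in I, θ t * e t) :=
    locallyIntegrable_const _
  have key := hI.ae_eq_zero_of_integral_contDiff_smul_eq_zero (μ := volume)
    (he.locallyIntegrableOn.sub (hconst.locallyIntegrableOn I)) fun φ hφ hφc hφI => ?_
  · refine (ae_restrict_iff' hI.measurableSet).2 ?_
    filter_upwards [key] with t ht htI
    exact sub_eq_zero.1 (ht htI)
  have hφi : Integrable φ := hφ.continuous.integrable_of_hasCompactSupport hφc
  have hθi : Integrable θ := hθs.continuous.integrable_of_hasCompactSupport hθc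
  -- Subtracting the multiple of `θ` with the same integral leaves a function of mean zero, whose
  -- primitive is compactly supported and hence an admissible `η`.
  set g : ℝ → ℝ := fun t => φ t - (∫ s, φ s) * θ t with hg
  have hgs : ContDiff ℝ ∞ g := hφ.sub (contDiff_const.mul hθs)
  have hg0 : ∫ t, g t = 0 := by
    rw [hg, integral_sub hφi (hθi.const_mul _), integral_const_mul, hθ1, mul_one, sub_self]
  obtain ⟨η, hη, hηc, hηI, hηg⟩ : ∃ η : ℝ → ℝ, ContDiff ℝ ∞ η ∧ HasCompactSupport η ∧
      tsupport η ⊆ I ∧ deriv η = g := by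
    have hK : IsCompact (tsupport φ ∪ tsupport θ) := hφc.isCompact.union hθc
    have hKne : (tsupport φ ∪ tsupport θ).Nonempty := by
      by_contra hcon
      rw [not_nonempty_iff_eq_empty, union_empty_iff, tsupport_eq_empty_iff (f := θ)] at hcon
      simp [hcon.2] at hθ1
    obtain ⟨a, haK, ha⟩ := hK.exists_isLeast hKne
    obtain ⟨b, hbK, hb⟩ := hK.exists_isGreatest hKne
    have hKI : tsupport φ ∪ tsupport θ ⊆ I := union_subset hφI hθI
    have hgK : ∀ t, t ∉ Icc a b → g t = 0 := fun t ht => by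
      have h1 : t ∉ tsupport φ := fun h' => ht ⟨ha (Or.inl h'), hb (Or.inl h')⟩
      have h2 : t ∉ tsupport θ := fun h' => ht ⟨ha (Or.inr h'), hb (Or.inr h')⟩
      simp [hg, image_eq_zero_of_notMem_tsupport h1, image_eq_zero_of_notMem_tsupport h2]
    have hsupp : ∀ t, t ∉ Icc a b → ∫ s in a..t, g s = 0 := fun t ht => by
      rcases lt_or_ge t a with hta | hta
      · rw [intervalIntegral.integral_symm, intervalIntegral.integral_of_le hta.le,
          integral_Ioc_eq_integral_Ioo, setIntegral_eq_zero_of_forall_eq_zero fun s hs =>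
            hgK s fun h' => hs.2.not_ge h'.1, neg_zero]
      · have hbt : b < t := not_le.1 fun h' => ht ⟨hta, h'⟩
        rw [intervalIntegral.integral_of_le hta, ← integral_Icc_eq_integral_Ioc,
          setIntegral_eq_integral_of_forall_compl_eq_zero fun s hs =>
            hgK s fun h' => hs (Icc_subset_Icc_right hbt.le h'), hg0]
    have hd : ∀ t, HasDerivAt (fun t => ∫ s in a..t, g s) (g t) t := fun t =>
      intervalIntegral.integral_hasDerivAt_right (hgs.continuous.intervalIntegrable _ _)
        (hgs.continuous.stronglyMeasurableAtFilter _ _) hgs.continuous.continuousAt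
    have hderiv : deriv (fun t => ∫ s in a..t, g s) = g := funext fun t => (hd t).deriv
    -- The endpoints `a` and `b` lie in `I`, so order-connectedness places the support of the
    -- primitive in `I`.
    have hts : tsupport (fun t => ∫ s in a..t, g s) ⊆ Icc a b :=
      closure_minimal (fun t ht => by_contra fun h' => ht (hsupp t h')) isClosed_Icc
    refine ⟨fun t => ∫ s in a..t, g s, contDiff_infty_iff_deriv.2
      ⟨fun t => (hd t).differentiableAt, by rwa [hderiv]⟩,
      HasCompactSupport.of_support_subset_isCompact isCompact_Icc ((subset_tsupport _).trans hts),
      hts.trans (hIc.out (hKI haK) (hKI hbK)), hderiv⟩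
  have h0 := h η hη hηc hηI
  rw [hηg] at h0
  have h1 : ∫ t in I, φ t * e t = (∫ s, φ s) * ∫ t in I, θ t * e t := by
    rw [← sub_eq_zero, ← integral_const_mul, ← integral_sub (hint φ hφ hφc)
      ((hint θ hθs hθc).const_mul _), ← h0]
    congr 1; ext t; simp only [hg]; ring
  have hz : ∀ t, t ∉ I → φ t = 0 := fun t ht =>
    image_eq_zero_of_notMem_tsupport fun h' => ht (hφI h')
  have h2 : ∫ t in I, φ t = ∫ t, φ t := setIntegral_eq_integral_of_forall_compl_eq_zero hz
  rw [← setIntegral_eq_integral_of_forall_compl_eq_zero (s := I) fun t ht => by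
    simp [hz t ht]]
  simp only [Pi.sub_apply, smul_eq_mul, mul_sub]
  rw [integral_sub (hint φ hφ hφc) (hφi.integrableOn.mul_const _), integral_mul_const, h1, h2,
    sub_self]

lemma IsExtension.conservesEnergy (h : IsExtension I v V) (hI : IsOpen I) (hIc : I.OrdConnected)
    (hV2 : MemLp V 2)
    (hbal : ∀ η : ℝ → ℝ, ContDiff ℝ ∞ η → HasCompactSupport η → tsupport η ⊆ I →
      ∫ z : ℝ × X, 2⁻¹ * deriv η z.1 * ∑ l, V z l ^ 2 = 0) : ConservesEnergy I v := by
  have hint : Integrable (fun z => ∑ l, V z l ^ 2) :=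
    integrable_finsetSum _ fun l _ => (memLp_coord hV2 l).integrable_sq
  have hen : ∀ᵐ t ∂(volume.restrict I), kineticEnergy v t = 2⁻¹ * ∫ x, ∑ l, V (t, x) l ^ 2 := by
    filter_upwards [h.ae_ae_eq] with t ht
    rw [kineticEnergy, one_div]
    congr 1
    refine integral_congr_ae ?_
    filter_upwards [ht] with x hx
    rw [← hx, EuclideanSpace.norm_sq_eq]
    simp
  have hei : Integrable fun t => 2⁻¹ * ∫ x, ∑ l, V (t, x) l ^ 2 :=
    hint.integral_prod_left.const_mul _
  obtain ⟨c, hc⟩ := ae_eq_const_of_integral_deriv_mul_eq_zero hI hIc hei.integrableOn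
    fun η hη hηc hηI => by
      rw [setIntegral_eq_integral_of_forall_compl_eq_zero fun t ht => by
        rw [image_eq_zero_of_notMem_tsupport fun h' => ht (hηI (tsupport_deriv_subset h')), zero_mul]]
      rw [← hbal η hη hηc hηI]
      obtain ⟨C, hC⟩ := hηc.deriv.exists_bound_of_continuous (hη.continuous_deriv (by simp))
      have hi : Integrable (fun z : ℝ × X => 2⁻¹ * deriv η z.1 * ∑ l, V z l ^ 2) := by
        simp_rw [mul_assoc]
        exact (hint.bdd_mul (c := C) ((hη.continuous_deriv (by simp)).comp
          continuous_fst).aestronglyMeasurable (Eventually.of_forall fun z => hC z.1)).const_mul _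
      rw [Measure.volume_eq_prod, integral_prod _ hi]
      refine integral_congr_ae (Eventually.of_forall fun t => ?_)
      simp only [integral_const_mul]
      ring
  refine ⟨c, ?_⟩
  filter_upwards [hen, hc] with t h1 h2
  rw [h1, h2]

end Conclusion

/-! ### Energy conservation on the torus and on the whole space -/

section Theorem

variable {d : ℕ} {I : Set ℝ} {r : ℝ≥0∞}

lemma isCover_torusProj (d : ℕ) : IsCover (torusProj d) where
  continuous := continuous_pi fun i =>
    (AddCircle.continuous_mk' (1 : ℝ)).comp (EuclideanSpace.proj i : Vec d →L[ℝ] ℝ).continuous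
  surjective x := by
    choose y hy using fun i => QuotientAddGroup.mk_surjective (x i)
    exact ⟨WithLp.toLp 2 y, funext hy⟩
  isOpenMap := by
    have h1 : IsOpenMap (Pi.map fun (_ : Fin d) (t : ℝ) => (t : UnitAddCircle)) :=
      IsOpenMap.piMap (fun _ => QuotientAddGroup.isOpenMap_coe)
        (Eventually.of_forall fun _ => QuotientAddGroup.mk_surjective)
    exact h1.comp (EuclideanSpace.equiv (Fin d) ℝ).toHomeomorph.isOpenMap

instance isAddHaarMeasure_unitAddCircle :
    (volume : Measure UnitAddCircle).IsAddHaarMeasure := inferInstance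

instance isAddHaarMeasure_unitAddTorus (d : ℕ) :
    (volume : Measure (UnitAddTorus (Fin d))).IsAddHaarMeasure :=
  inferInstanceAs (Measure.pi fun _ : Fin d => (volume : Measure UnitAddCircle)).IsAddHaarMeasure

/-- Energy conservation on the torus for velocities that are regular outside of a null set. -/
theorem conservesEnergy_torus (hI : IsOpen I) (hIc : I.OrdConnected) (hr : 3 < r)
    {v : ℝ × UnitAddTorus (Fin d) → Vec d} {p : ℝ × UnitAddTorus (Fin d) → ℝ}
    (hE : IsWeakEulerSolution (torusProj d) I v p)
    (hv : timeBesovNorm (torusProj d) r (1 / 3) r I univ v < ⊤)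
    (hv2 : MemLp v 2 (volume.restrict (spaceTime (UnitAddTorus (Fin d)) I)))
    (hS : volume (singularSupport (torusProj d) I v) = 0 ∨
      volume (criticalSingularSupport (torusProj d) I v) = 0) : ConservesEnergy I v := by
  have hπ := isCover_torusProj d
  obtain ⟨V, h⟩ := exists_isExtension hI hv2
  have hV2 := h.memLp_two hI hv2
  have hV3 : MemLp V 3 := memLp_of_le_of_le (by norm_num) (by norm_num) hr.le hV2
    (h.memLp hI (pos_of_gt hr).ne' hv)
  exact h.conservesEnergy hI hIc hV2 fun η hη hηc hηI =>
    (h.eulerCore hπ hE hV2 hV3).integral_deriv_mul_eq_zero_of_compact hπ hI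
      (fun K hKI hK l => (h.smallIncrements hπ hI hr hv hS hKI hK).coord l) hη hηc hηI

lemma IsExtension.eLpNorm_coord_increment_le {v V : ℝ × Vec d → Vec d} (h : IsExtension I v V)
    (hI : IsOpen I) (hr : r ≠ 0) (hv : timeBesovNorm (spaceProj d) r (1 / 3) r I univ v < ⊤)
    (l : Fin d) (y : Vec d) : eLpNorm (fun z : ℝ × Vec d => V (z - (0, y)) l - V z l) r volume ≤
      ENNReal.ofReal ((timeBesovNorm (spaceProj d) r (1 / 3) r I univ v).toReal *
        ‖y‖ ^ (1 / 3 : ℝ)) := by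
  rcases eq_or_ne y 0 with rfl | hy
  · have : (fun z : ℝ × Vec d => V (z - (0, 0)) l - V z l) = 0 := by
      funext z; simp only [Prod.mk_zero_zero, sub_zero, sub_self, Pi.zero_apply]
    rw [this, eLpNorm_zero]; exact zero_le
  · rw [mul_comm, ENNReal.ofReal_mul (by positivity), ENNReal.ofReal_toReal hv.ne]
    refine le_trans (eLpNorm_mono (g := fun z => V (z - (0, y)) - V z) fun z =>
      PiLp.norm_apply_le (V (z - (0, y)) - V z) l) ?_
    exact h.eLpNorm_increment_le (π := spaceProj d) hI hr hy

/-- On the whole space the increments are controlled globally only in `L^r`, so the products `u_j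
u_l` must be paired with them in the dual exponent `s`. As `r > 3`, it lies between `1` and `3/2`,
the range reached by interpolation from `u ∈ L² ∩ L³`. -/
lemma exists_holderConjugate_le (hr : 3 < r) :
    ∃ s : ℝ≥0∞, s.HolderConjugate r ∧ 1 ≤ s ∧ s ≤ 3 / 2 := by
  have hc : r.HolderConjugate (1 - r⁻¹)⁻¹ :=
    ENNReal.HolderConjugate.inv_one_sub_inv' (le_trans (by norm_num) hr.le)
  refine ⟨_, hc.symm, hc.symm.one_le, ?_⟩
  have h3 : r⁻¹ ≤ 3⁻¹ := ENNReal.inv_le_inv.2 hr.le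
  rw [ENNReal.inv_le_iff_inv_le, ENNReal.inv_div (by simp) (by simp)]
  refine ENNReal.le_sub_of_add_le_right (h3.trans_lt (by simp)).ne ?_
  calc 2 / 3 + r⁻¹ ≤ 2 / 3 + 3⁻¹ := by gcongr
    _ = (2 + 1) / 3 := by rw [ENNReal.add_div, one_div]
    _ = 1 := by norm_num; exact ENNReal.div_self (by simp) (by simp)
    _ ≤ 1 := le_rfl

lemma memLp_coord_mul {α : Type} [MeasurableSpace α] {μ : Measure α} {V : α → Vec d} {s : ℝ≥0∞}
    (h2 : MemLp V 2 μ) (h3 : MemLp V 3 μ) (hs1 : 1 ≤ s) (hs2 : s ≤ 3 / 2) (j l : Fin d) :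
    MemLp (fun z => V z j * V z l) s μ :=
  memLp_of_le_of_le one_ne_zero hs1 hs2
    (memLp_one_iff_integrable.2 ((memLp_coord h2 j).integrable_mul (memLp_coord h2 l)))
    ⟨((memLp_coord h2 j).1.mul (memLp_coord h2 l).1),
      (eLpNorm_mul_le (memLp_coord h2 j).1 (memLp_coord h2 l).1 3 3 (3 / 2)).trans_lt
        (ENNReal.mul_lt_top (memLp_coord h3 j).2 (memLp_coord h3 l).2)⟩

/-- Energy conservation on the whole space for velocities that are regular outside of a null set. -/
theorem conservesEnergy_euclidean (hI : IsOpen I) (hIc : I.OrdConnected) (hr : 3 < r)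
    {v : ℝ × Vec d → Vec d} {p : ℝ × Vec d → ℝ}
    (hE : IsWeakEulerSolution (spaceProj d) I v p)
    (hv : timeBesovNorm (spaceProj d) r (1 / 3) r I univ v < ⊤)
    (hv2 : MemLp v 2 (volume.restrict (spaceTime (Vec d) I)))
    (hS : volume (singularSupport (spaceProj d) I v) = 0 ∨
      volume (criticalSingularSupport (spaceProj d) I v) = 0) : ConservesEnergy I v := by
  -- The elliptic estimate needs at least one direction; in dimension zero the velocity takes values
  -- in a trivial space and the energy vanishes.
  rcases Nat.eq_zero_or_pos d with rfl | hd
  · refine ⟨0, Eventually.of_forall fun t => ?_⟩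
    have : ∀ x, v (t, x) = 0 := fun x => Subsingleton.elim _ _
    simp [kineticEnergy, this]
  have hπ := isCover_spaceProj d
  have hr0 : r ≠ 0 := (pos_of_gt hr).ne'
  obtain ⟨V, h⟩ := exists_isExtension hI hv2
  have hV2 := h.memLp_two hI hv2
  have hVr := h.memLp hI hr0 hv
  have hV3 : MemLp V 3 := memLp_of_le_of_le (by norm_num) (by norm_num) hr.le hV2 hVr
  obtain ⟨s, hsr, hs1, hs2⟩ := exists_holderConjugate_le hr
  have hsm : ∀ K ⊆ spaceTime (Vec d) I, IsCompact K → SmallIncrements (spaceProj d) V K :=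
    fun K hKI hK => h.smallIncrements hπ hI hr hv hS hKI hK
  have hcore := h.eulerCore hπ hE hV2 hV3
  exact h.conservesEnergy hI hIc hV2 fun η hη hηc hηI =>
    hcore.integral_deriv_mul_eq_zero (r := r) (s := s) hd hI
      (fun K hKI hK l => (hsm K hKI hK).coord l) (le_trans (by norm_num) hr.le)
      (memLp_coord hVr) (memLp_coord_mul hV2 hV3 hs1 hs2) ENNReal.toReal_nonneg
      (h.eLpNorm_coord_increment_le hI hr0 hv) hη hηc hηI

end Theorem

end CriticalEuler

end

theorem mainTheorem3 (d : ℕ) (I : Set ℝ) (hI_open : IsOpen I) (hI_interval : I.OrdConnected)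
    (r : ℝ≥0∞) (hr : 3 < r) :
    (∀ (v : ℝ × CriticalEuler.Vec d → CriticalEuler.Vec d) (p : ℝ × CriticalEuler.Vec d → ℝ),
      CriticalEuler.IsWeakEulerSolution (CriticalEuler.spaceProj d) I v p →
      CriticalEuler.timeBesovNorm (CriticalEuler.spaceProj d) r (1 / 3) r I univ v < ⊤ →
      MemLp v 2 (volume.restrict (CriticalEuler.spaceTime (CriticalEuler.Vec d) I)) →
      ¬ CriticalEuler.ConservesEnergy I v →
      0 < volume (CriticalEuler.singularSupport (CriticalEuler.spaceProj d) I v) ∧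
      0 < volume (CriticalEuler.criticalSingularSupport (CriticalEuler.spaceProj d) I v)) ∧
    (∀ (v : ℝ × UnitAddTorus (Fin d) → CriticalEuler.Vec d) (p : ℝ × UnitAddTorus (Fin d) → ℝ),
      CriticalEuler.IsWeakEulerSolution (CriticalEuler.torusProj d) I v p →
      CriticalEuler.timeBesovNorm (CriticalEuler.torusProj d) r (1 / 3) r I univ v < ⊤ →
      MemLp v 2 (volume.restrict (CriticalEuler.spaceTime (UnitAddTorus (Fin d)) I)) →
      ¬ CriticalEuler.ConservesEnergy I v →
      0 < volume (CriticalEuler.singularSupport (CriticalEuler.torusProj d) I v) ∧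
      0 < volume (CriticalEuler.criticalSingularSupport (CriticalEuler.torusProj d) I v)) := by
  refine ⟨fun v p hE hv hv2 hnc => ⟨?_, ?_⟩, fun v p hE hv hv2 hnc => ⟨?_, ?_⟩⟩
  · exact pos_iff_ne_zero.2 fun h0 => hnc
      (CriticalEuler.conservesEnergy_euclidean hI_open hI_interval hr hE hv hv2 (Or.inl h0))
  · exact pos_iff_ne_zero.2 fun h0 => hnc
      (CriticalEuler.conservesEnergy_euclidean hI_open hI_interval hr hE hv hv2 (Or.inr h0))
  · exact pos_iff_ne_zero.2 fun h0 => hnc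
      (CriticalEuler.conservesEnergy_torus hI_open hI_interval hr hE hv hv2 (Or.inl h0))
  · exact pos_iff_ne_zero.2 fun h0 => hnc
      (CriticalEuler.conservesEnergy_torus hI_open hI_interval hr hE hv hv2 (Or.inr h0))
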